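/- **Setting.** Let $X$ be a locally compact metric space and $k\ge 0$. For a metric space $Y$, $\mathrm{LIP}_\infty(Y)$ is the space of bounded Lipschitz functions with norm $L(f)=\max\{\mathrm{Lip}(f),\|f\|_\infty\}$, and $\mathrm{LIP}_c(Y)$ the subspace of compactly supported ones. A metric $k$-current on $X$ is a $(k+1)$-linear functional $T$ on $\mathrm{LIP}_c(X)\times \mathrm{LIP}_\infty(X)^k$ which is *sequentially continuous* ($T(\pi^n)\to T(\pi)$ whenever $\pi_i^n\to\pi_i$ with $\sup_n\mathrm{Lip}(\pi_i^n)<\infty$, uniformly and with supports in a common compact set for $i=0$, and uniformly on compact sets for $i\ge1$) and *local* ($T(\pi)=0$ if some $\pi_i$, $i\ge 1$, is constant on a neighbourhood of $\operatorname{spt}\pi_0$). It has locally finite mass if there is a Radon measure $\mu$ with $$|T(\pi_0,\dots,\pi_k)|\le \mathrm{Lip}(\pi_1)\cdots \mathrm{Lip}(\pi_k)\int_X|\pi_0|\,d\mu\quad\text{for all }\pi .$$ There is then a least such Radon measure, denoted $\|T\|$, and $T$ is extended by $L^1(\|T\|)$-continuity in $\pi_0$ to tuples in which $\pi_0$ is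 a compactly supported bounded Borel function. For a Borel set $E$ put $T\lfloor E(\pi_0,\dots,\pi_k)=T(\chi_E\pi_0,\pi_1,\dots,\pi_k)$. **Polylipschitz forms.** $\mathrm{Poly}^k(Y)$ is the $(k+1)$-fold completed projective tensor power of $\mathrm{LIP}_\infty(Y)$, and $\overline{\mathrm{Poly}}{}^k(Y)$ the completed projective tensor product of $\mathrm{LIP}_\infty(Y)$ and $k$ copies of $\mathrm{LIP}_\infty(Y)/\{\text{constants}\}$; let $Q:\mathrm{Poly}^k(Y)\to\overline{\mathrm{Poly}}{}^k(Y)$ be the natural map. A representation of $\bar\pi\in\overline{\mathrm{Poly}}{}^k(Y)$ is a sequence $(\pi_0^j,\dots,\pi_k^j)_j$ with $\sum_j\prod_iL(\pi_i^j)<\infty$ and $Q(\sum_j\pi_0^j\otimes\cdots\otimes\pi_k^j)=\bar\pi$. For $A\subset Y$ let $$\mathrm{Lip}_k(\bar\pi;A)=\inf\ \sup_{x\in A}\ \sum_j|\pi^j_0(x)|\,\mathrm{Lip}(\pi^j_1|_A)\cdots\mathrm{Lip}(\pi_k^j|_A),$$ the infimum being over all representations. The spaces $\overline{\mathrm{Poly}}{}^k(U)$,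 $U\subset Y$ open, form a presheaf under restriction. A section $\omega$ over $Y$ is a choice of a germ $\omega(x)$ of this presheaf at each $x\in Y$; it is *continuous* if locally it is given by the germs of one element of some $\overline{\mathrm{Poly}}{}^k(U)$, and its support is the closure of $\{\omega\ne0\}$. The compactly supported continuous sections over $X$ are the compactly supported polylipschitz forms $\overline\Gamma{}_c^k(X)$. The map $\bar\iota:\mathrm{LIP}_c(X)\times \mathrm{LIP}_\infty(X)^k\to\overline\Gamma{}^k_c(X)$ sends $(\pi_0,\dots,\pi_k)$ to the germs of $\pi_0\otimes[\pi_1]\otimes\cdots\otimes[\pi_k]$. The pointwise norm is $\|\omega\|_x=\lim_{r\to0}\mathrm{Lip}_k(\bar\pi;B_r(x))$, for any $\bar\pi$ representing $\omega(x)$ near $x$. An *overlap-compatible* family for a section $\omega$ over $Y$ consists of a locally finite open cover $\mathcal U$ of $Y$ and $\bar\pi_U\in\overline{\mathrm{Poly}}{}^k(U)$ for $U\in\mathcal U$ with $\bar\pi_U|_{U\cap V}=\bar\pi_V|_{U\cap V}$ for all $U,V$, and such that each $\omega(x)$ is the germ of some $\bar\pi_U$, $U\ni x$. *Sequential convergence.*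 In $\mathrm{Poly}^k(Y)$, $\pi^n\to\pi$ means: for all compact $V_0,\dots,V_k\subset Y$ there are representations $(\pi^{n,j})_j$ of $\pi^n-\pi$ with $\sum_j\sup_n\prod_iL(\pi_i^{n,j})<\infty$ and $\sum_j\prod_i\sup_{V_i}|\pi_i^{n,j}|\to0$ as $n\to\infty$; in $\overline{\mathrm{Poly}}{}^k(Y)$, convergence means that there are preimages under $Q$ which converge. In $\overline\Gamma{}_c^k(X)$, $\omega_n\to\omega$ means: there are a compact $K\supset\operatorname{spt}(\omega_n-\omega)$ for all $n$, a locally finite cover $\mathcal U$ of $X$ by precompact open sets, and families $(\bar\pi^n_U)_{U\in\mathcal U}$ overlap-compatible with $\omega_n-\omega$, such that $\bar\pi^n_U\to0$ in $\overline{\mathrm{Poly}}{}^k(U)$ for each $U\in\mathcal U$. **Theorem.** Let $T$ be a metric $k$-current of locally finite mass on $X$. (1) There is a unique sequentially continuous linear functional $\widehat T:\overline\Gamma{}_c^k(X)\to\mathbb R$ with $\widehat T\circ\bar\iota=T$, and for every $\omega\in\overline\Gamma{}_c^k(X)$ $$|\widehat T(\omega)|\le\int_X\|\omega\|_x\,d\|T\|(x)<\infty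 .$$ (2) Let $E\subset X$ be a Borel set. For every relatively open $U\subset E$ which is precompact in $X$ and every $\varphi\in\mathrm{LIP}_\infty(E)$ with $\operatorname{spt}\varphi\subset U$ (support taken in $E$) there is a unique bounded linear functional $\overline T{}^{U}_\varphi$ on $\overline{\mathrm{Poly}}{}^k(U)$ with $\overline T{}^{U}_\varphi(\pi_0\otimes[\pi_1|_U]\otimes\cdots\otimes[\pi_k|_U])=T(\varphi\pi_0,\pi_1,\dots,\pi_k)$ for $\pi_0\in\mathrm{LIP}_\infty(U)$, $\pi_1,\dots,\pi_k\in\mathrm{LIP}_\infty(X)$, where $\varphi\pi_0$ is extended by $0$. Let $\mathcal D_E$ be the set of all compactly supported sections $\omega$ over $X$ whose restriction $\omega|_E$ to the metric space $E$ is continuous and satisfies $\int_E\|\omega|_E\|_x\,d\|T\|(x)<\infty$. Then $\mathcal D_E$ is a linear space containing $\overline\Gamma{}_c^k(X)$; if $E$ is closed, the integrability condition is automatic. For every $\omega\in\mathcal D_E$ there exist a family $(\bar\pi_U)_{U\in\mathcal U}$ overlap-compatible with $\omega|_E$, with all $U$ precompact in $X$, and a Lipschitz partition of unity $(\varphi_U)_{U\in\mathcal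 U}$ on $E$ with $\operatorname{spt}\varphi_U\subset U$; and the sum $$\widehat T_E(\omega)=\sum_{U\in\mathcal U}\overline T{}^{U}_{\varphi_U}(\bar\pi_U)$$ converges absolutely and has the same value for all such families and partitions. The functional $\widehat T_E:\mathcal D_E\to\mathbb R$ is linear, $\widehat T_E\circ\bar\iota=T\lfloor E$, $$|\widehat T_E(\omega)|\le\int_E\|\omega|_E\|_x\,d\|T\|(x)\qquad(\omega\in\mathcal D_E),$$ and $\widehat T_X=\widehat T$ on $\overline\Gamma{}_c^k(X)$. -/

import Mathlib

open TopologicalSpace MeasureTheory Filter Topology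
open scoped ENNReal TensorProduct

noncomputable section

namespace Polylip

universe u v w

/-! ### Bounded Lipschitz functions -/

/-- The Lipschitz constant of `f|_A`, i.e. the supremum of the difference quotients of `f` over
pairs of points of `A` (for a Lipschitz function `f`; it is `0` if `A` has at most one point). -/
def lipOn {Y : Type u} [MetricSpace Y] (f : Y → ℝ) (A : Set Y) : ℝ :=
  ⨆ p : A × A, |f p.1 - f p.2| / dist (p.1 : Y) (p.2 : Y)

/-- The bounded Lipschitz functions, as a subspace of all functions. -/
def bLipSubmodule (Y : Type u) [MetricSpace Y] : Submodule ℝ (Y → ℝ) where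
  carrier := {f | (∃ C : ℝ, ∀ x y, |f x - f y| ≤ C * dist x y) ∧ ∃ C : ℝ, ∀ x, |f x| ≤ C}
  add_mem' := by
    rintro f g ⟨⟨C, hC⟩, C', hC'⟩ ⟨⟨D, hD⟩, D', hD'⟩
    refine ⟨⟨C + D, fun x y => ?_⟩, C' + D', fun x => ?_⟩
    · have : (f + g) x - (f + g) y = (f x - f y) + (g x - g y) := by
        simp only [Pi.add_apply]; ring
      rw [this, add_mul]
      exact (abs_add_le _ _).trans (add_le_add (hC x y) (hD x y))
    · exact (abs_add_le _ _).trans (add_le_add (hC' x) (hD' x))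
  zero_mem' := ⟨⟨0, by simp⟩, 0, by simp⟩
  smul_mem' := by
    rintro a f ⟨⟨C, hC⟩, C', hC'⟩
    refine ⟨⟨|a| * C, fun x y => ?_⟩, |a| * C', fun x => ?_⟩
    · have : (a • f) x - (a • f) y = a * (f x - f y) := by
        simp only [Pi.smul_apply, smul_eq_mul]; ring
      rw [this, abs_mul, mul_assoc]
      exact mul_le_mul_of_nonneg_left (hC x y) (abs_nonneg a)
    · simp only [Pi.smul_apply, smul_eq_mul, abs_mul]
      exact mul_le_mul_of_nonneg_left (hC' x) (abs_nonneg a)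

/-- `LIP_∞(Y)`, the space of bounded Lipschitz functions on the metric space `Y`. -/
def BLip (Y : Type u) [MetricSpace Y] : Type u := bLipSubmodule Y

namespace BLip

variable {Y : Type u} [MetricSpace Y] {Z : Type v} [MetricSpace Z]

instance : AddCommGroup (BLip Y) := inferInstanceAs (AddCommGroup (bLipSubmodule Y))

instance : Module ℝ (BLip Y) := inferInstanceAs (Module ℝ (bLipSubmodule Y))

instance : CoeFun (BLip Y) (fun _ => Y → ℝ) := ⟨fun f => f.1⟩

theorem ext {f g : BLip Y} (h : ∀ x, f x = g x) : f = g := Subtype.ext (funext h)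

@[simp] theorem add_apply (f g : BLip Y) (x : Y) : (f + g) x = f x + g x := rfl

@[simp] theorem smul_apply (a : ℝ) (f : BLip Y) (x : Y) : (a • f) x = a * f x := rfl

@[simp] theorem zero_apply (x : Y) : (0 : BLip Y) x = 0 := rfl

/-- The norm `L(f) = max {Lip f, ‖f‖_∞}`. -/
instance : Norm (BLip Y) := ⟨fun f => max (lipOn f Set.univ) (⨆ x, |f x|)⟩

theorem norm_def (f : BLip Y) : ‖f‖ = max (lipOn f Set.univ) (⨆ x, |f x|) := rfl

theorem abs_le_norm (f : BLip Y) (x : Y) : |f x| ≤ ‖f‖ := by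
  obtain ⟨-, C, hC⟩ := f.2
  exact (le_ciSup (f := fun x => |f x|) ⟨C, by rintro _ ⟨x, rfl⟩; exact hC x⟩ x).trans
    (le_max_right _ _)

theorem abs_sub_le_norm (f : BLip Y) (x y : Y) : |f x - f y| ≤ ‖f‖ * dist x y := by
  obtain ⟨⟨C, hC⟩, -⟩ := f.2
  rcases (dist_nonneg (x := x) (y := y)).eq_or_lt with h | h
  · have := hC x y
    rw [← h] at this ⊢
    simpa using this
  · rw [← div_le_iff₀ h]
    refine le_trans ?_ (le_max_left _ _)
    refine le_ciSup (f := fun p : ↥(@Set.univ Y) × ↥(@Set.univ Y) =>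
      |f p.1 - f p.2| / dist (p.1 : Y) (p.2 : Y)) ⟨|C|, ?_⟩ (⟨x, trivial⟩, ⟨y, trivial⟩)
    rintro _ ⟨p, rfl⟩
    exact div_le_of_le_mul₀ dist_nonneg (abs_nonneg C)
      ((hC _ _).trans (mul_le_mul_of_nonneg_right (le_abs_self C) dist_nonneg))

theorem norm_le {f : BLip Y} {C : ℝ} (hC : 0 ≤ C) (h₁ : ∀ x y, |f x - f y| ≤ C * dist x y)
    (h₂ : ∀ x, |f x| ≤ C) : ‖f‖ ≤ C :=
  max_le (Real.iSup_le (fun _ => div_le_of_le_mul₀ dist_nonneg hC (h₁ _ _)) hC)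
    (Real.iSup_le h₂ hC)

theorem norm_nonneg' (f : BLip Y) : 0 ≤ ‖f‖ :=
  le_max_of_le_right (Real.iSup_nonneg fun x => abs_nonneg (f x))

theorem norm_smul_le' (a : ℝ) (f : BLip Y) : ‖a • f‖ ≤ ‖a‖ * ‖f‖ := by
  refine norm_le (mul_nonneg (norm_nonneg a) (norm_nonneg' f)) (fun x y => ?_) (fun x => ?_)
  · rw [smul_apply, smul_apply, ← mul_sub, abs_mul, mul_assoc, Real.norm_eq_abs]
    exact mul_le_mul_of_nonneg_left (abs_sub_le_norm f x y) (abs_nonneg a)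
  · rw [smul_apply, abs_mul, Real.norm_eq_abs]
    exact mul_le_mul_of_nonneg_left (abs_le_norm f x) (abs_nonneg a)

theorem normCore (Y : Type u) [MetricSpace Y] : NormedSpace.Core ℝ (BLip Y) where
  norm_nonneg := norm_nonneg'
  norm_smul a f := by
    refine le_antisymm (norm_smul_le' a f) ?_
    rcases eq_or_ne a 0 with rfl | ha
    · simpa using norm_nonneg' ((0 : ℝ) • f)
    · have h := norm_smul_le' a⁻¹ (a • f)
      rw [smul_smul, inv_mul_cancel₀ ha, one_smul, norm_inv] at h
      rwa [← div_eq_inv_mul, le_div_iff₀ (norm_pos_iff.2 ha), mul_comm] at h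
  norm_triangle f g := by
    refine norm_le (add_nonneg (norm_nonneg' f) (norm_nonneg' g)) (fun x y => ?_) (fun x => ?_)
    · rw [add_apply, add_apply, add_sub_add_comm, add_mul]
      exact (abs_add_le _ _).trans (add_le_add (abs_sub_le_norm f x y) (abs_sub_le_norm g x y))
    · rw [add_apply]
      exact (abs_add_le _ _).trans (add_le_add (abs_le_norm f x) (abs_le_norm g x))
  norm_eq_zero_iff f := by
    constructor
    · intro h
      refine ext fun x => ?_
      have := abs_le_norm f x
      rw [h] at this
      simpa using this
    · rintro rfl
      exact le_antisymm (norm_le le_rfl (by simp) (by simp)) (norm_nonneg' _)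

instance : NormedAddCommGroup (BLip Y) := NormedAddCommGroup.ofCore (normCore Y)

instance : NormedSpace ℝ (BLip Y) := NormedSpace.ofCore (normCore Y)

theorem abs_comp_sub_le {g : Y → Z} (hg : LipschitzWith 1 g) (f : BLip Z) (x y : Y) :
    |f (g x) - f (g y)| ≤ ‖f‖ * dist x y := by
  refine (abs_sub_le_norm f _ _).trans (mul_le_mul_of_nonneg_left ?_ (norm_nonneg f))
  simpa using hg.dist_le_mul x y

/-- Composition with a `1`-Lipschitz map; for an inclusion of subsets this is the
restriction of functions. -/
def comp (g : Y → Z) (hg : LipschitzWith 1 g) : BLip Z →L[ℝ] BLip Y :=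
  LinearMap.mkContinuous
    { toFun := fun f => ⟨fun x => f (g x), ⟨‖f‖, abs_comp_sub_le hg f⟩, ‖f‖,
        fun x => abs_le_norm f (g x)⟩
      map_add' := fun _ _ => rfl
      map_smul' := fun _ _ => rfl } 1 fun f => by
    rw [one_mul]
    exact norm_le (norm_nonneg f) (abs_comp_sub_le hg f) fun x => abs_le_norm f (g x)

@[simp] theorem comp_apply (g : Y → Z) (hg : LipschitzWith 1 g) (f : BLip Z) (x : Y) :
    comp g hg f x = f (g x) := rfl

/-- Restriction of functions to a subset. -/
def restrict (A : Set Y) : BLip Y →L[ℝ] BLip A := comp Subtype.val (LipschitzWith.subtype_val A)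

/-- The subspace of constant functions. -/
def const (Y : Type u) [MetricSpace Y] : Submodule ℝ (BLip Y) where
  carrier := {f | ∃ c : ℝ, ∀ x, f x = c}
  add_mem' := by
    rintro f g ⟨c, hc⟩ ⟨d, hd⟩
    exact ⟨c + d, fun x => by rw [add_apply, hc, hd]⟩
  zero_mem' := ⟨0, fun _ => rfl⟩
  smul_mem' := by
    rintro a f ⟨c, hc⟩
    exact ⟨a * c, fun x => by rw [smul_apply, hc]⟩

end BLip

/-- `LIP_c(Y)`, the space of compactly supported Lipschitz functions. -/
def LipC (Y : Type u) [MetricSpace Y] : Submodule ℝ (BLip Y) where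
  carrier := {f | HasCompactSupport (f : Y → ℝ)}
  add_mem' := fun hf hg => HasCompactSupport.add hf hg
  zero_mem' := HasCompactSupport.zero
  smul_mem' := fun a _ hf => hf.comp_left (g := fun t => a * t) (mul_zero a)

/-! ### Polylipschitz functions -/

/-- The space `Poly^k(Y)` of `k`-polylipschitz functions: the `(k+1)`-fold completed projective
tensor power of `LIP_∞(Y)`.  (Mathlib's norm on `⨂` is the projective one.) -/
abbrev Poly (k : ℕ) (Y : Type u) [MetricSpace Y] : Type u :=
  UniformSpace.Completion (⨂[ℝ] _i : Fin (k + 1), BLip Y)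

/-- The subspace by which the `i`-th tensor factor is divided in the homogeneous case: nothing for
`i = 0`, and the constants for `i = 1, …, k`. -/
def homKer (k : ℕ) (Y : Type u) [MetricSpace Y] (i : Fin (k + 1)) : Submodule ℝ (BLip Y) :=
  if i = 0 then ⊥ else BLip.const Y

/-- The `i`-th tensor factor: `LIP_∞(Y)` for `i = 0`, and the space of bounded Lipschitz functions
modulo constants, with the quotient norm, for `i = 1, …, k`. -/
abbrev HomFactor (k : ℕ) (Y : Type u) [MetricSpace Y] (i : Fin (k + 1)) : Type u :=
  BLip Y ⧸ homKer k Y i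

/-- The space of homogeneous `k`-polylipschitz functions: the completed projective tensor product
of `LIP_∞(Y)` and `k` copies of `LIP_∞(Y)` modulo constants. -/
abbrev HPoly (k : ℕ) (Y : Type u) [MetricSpace Y] : Type u :=
  UniformSpace.Completion (⨂[ℝ] i : Fin (k + 1), HomFactor k Y i)

section functions

variable {k : ℕ} {Y : Type u} [MetricSpace Y] {Z : Type v} [MetricSpace Z]
  {W : Type w} [MetricSpace W]

/-- The simple tensor `f₀ ⊗ ⋯ ⊗ f_k` in `Poly^k(Y)`. -/
def Poly.tensor (f : Fin (k + 1) → BLip Y) : Poly k Y := ((⨂ₜ[ℝ] i, f i : _) : Poly k Y)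

/-- The simple tensor `f₀ ⊗ [f₁] ⊗ ⋯ ⊗ [f_k]` among the homogeneous polylipschitz functions. -/
def HPoly.tensor (f : Fin (k + 1) → BLip Y) : HPoly k Y :=
  ((⨂ₜ[ℝ] i, (homKer k Y i).mkQL (f i) : ⨂[ℝ] i, HomFactor k Y i) : HPoly k Y)

/-- The quotient map `Q = id ⊗ q ⊗ ⋯ ⊗ q` from polylipschitz to homogeneous polylipschitz
functions. -/
def Poly.toHom (k : ℕ) (Y : Type u) [MetricSpace Y] : Poly k Y →L[ℝ] HPoly k Y :=
  (PiTensorProduct.mapL fun i => (homKer k Y i).mkQL).completion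

theorem homKer_le (g : Y → Z) (hg : LipschitzWith 1 g) (i : Fin (k + 1)) :
    homKer k Z i ≤ (((homKer k Y i).mkQL).comp (BLip.comp g hg)).ker := by
  intro f hf
  rw [LinearMap.mem_ker]
  refine (Submodule.Quotient.mk_eq_zero _).2 ?_
  unfold homKer at hf ⊢
  split_ifs at hf ⊢ with h
  · rw [(Submodule.mem_bot ℝ).1 hf]
    exact Submodule.zero_mem _
  · obtain ⟨c, hc⟩ := hf
    exact ⟨c, fun x => hc (g x)⟩

/-- The map induced on the `i`-th factors by composition with a `1`-Lipschitz map. -/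
def HomFactor.pull (g : Y → Z) (hg : LipschitzWith 1 g) (i : Fin (k + 1)) :
    HomFactor k Z i →L[ℝ] HomFactor k Y i :=
  (homKer k Z i).liftQL (((homKer k Y i).mkQL).comp (BLip.comp g hg)) (homKer_le g hg i)

/-- The pull-back of homogeneous polylipschitz functions under a `1`-Lipschitz map; for an
inclusion of subsets this is the restriction map. -/
def HPoly.pull (g : Y → Z) (hg : LipschitzWith 1 g) : HPoly k Z →L[ℝ] HPoly k Y :=
  (PiTensorProduct.mapL fun i => HomFactor.pull g hg i).completion

theorem HPoly.pull_tensor (g : Y → Z) (hg : LipschitzWith 1 g) (f : Fin (k + 1) → BLip Z) :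
    HPoly.pull g hg (HPoly.tensor f) = HPoly.tensor fun i => BLip.comp g hg (f i) := by
  simp only [HPoly.pull, HPoly.tensor, ContinuousLinearMap.completion_apply_coe,
    PiTensorProduct.mapL_apply, PiTensorProduct.map_tprod]
  rfl

theorem HPoly.pull_pull (g : Y → Z) (hg : LipschitzWith 1 g) (h : Z → W)
    (hh : LipschitzWith 1 h) (hgh : LipschitzWith 1 fun y => h (g y)) (p : HPoly k W) :
    HPoly.pull g hg (HPoly.pull h hh p) = HPoly.pull (fun y => h (g y)) hgh p := by
  have key : (fun i => HomFactor.pull (fun y => h (g y)) hgh i) =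
      fun i : Fin (k + 1) => (HomFactor.pull g hg i) ∘L (HomFactor.pull h hh i) := by
    funext i
    ext x
    induction x using Submodule.Quotient.induction_on with
    | _ f => rfl
  unfold HPoly.pull
  rw [key, PiTensorProduct.mapL_comp]
  induction p using UniformSpace.Completion.induction_on with
  | hp => exact isClosed_eq ((ContinuousLinearMap.continuous _).comp
      (ContinuousLinearMap.continuous _)) (ContinuousLinearMap.continuous _)
  | ih x => simp

/-- The sequence of tuples `(r j 0, …, r j k)` represents the polylipschitz function `p`. -/
def Poly.Represents (r : ℕ → Fin (k + 1) → BLip Y) (p : Poly k Y) : Prop :=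
  (Summable fun j => ∏ i, ‖r j i‖) ∧ HasSum (fun j => Poly.tensor (r j)) p

/-- The sequence of tuples `(r j 0, …, r j k)` represents some polylipschitz function which is
mapped to the homogeneous polylipschitz function `p` by `Poly.toHom`. -/
def HPoly.Represents (r : ℕ → Fin (k + 1) → BLip Y) (p : HPoly k Y) : Prop :=
  ∃ q : Poly k Y, Poly.toHom k Y q = p ∧ Poly.Represents r q

/-- Sequential convergence in `Poly^k(Y)`. -/
def Poly.SeqConv (p : ℕ → Poly k Y) (q : Poly k Y) : Prop :=
  ∀ V : Fin (k + 1) → Set Y, (∀ i, IsCompact (V i)) →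
    ∃ r : ℕ → ℕ → Fin (k + 1) → BLip Y, (∀ n, Poly.Represents (r n) (p n - q)) ∧
      (∑' j, ⨆ n, ∏ i, ‖r n j i‖ₑ) < ∞ ∧
      Tendsto (fun n => ∑' j, ∏ i, ⨆ x ∈ V i, ‖r n j i x‖ₑ) atTop (𝓝 0)

/-- Sequential convergence of homogeneous polylipschitz functions. -/
def HPoly.SeqConv (p : ℕ → HPoly k Y) (q : HPoly k Y) : Prop :=
  ∃ (p' : ℕ → Poly k Y) (q' : Poly k Y), (∀ n, Poly.toHom k Y (p' n) = p n) ∧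
    Poly.toHom k Y q' = q ∧ Poly.SeqConv p' q'

/-- `Lip_k(p; A)`: the infimum over all representations of `p` of
`sup_{x ∈ A} ∑_j |π₀^j(x)| Lip(π₁^j|_A) ⋯ Lip(π_k^j|_A)`. -/
def HPoly.lipOn (p : HPoly k Y) (A : Set Y) : ℝ≥0∞ :=
  ⨅ (r : ℕ → Fin (k + 1) → BLip Y) (_ : HPoly.Represents r p),
    ⨆ x ∈ A, ∑' j, ENNReal.ofReal (|r j 0 x| * ∏ i : Fin k, Polylip.lipOn (r j i.succ) A)

end functions

/-! ### Germs, sections and polylipschitz forms -/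

section germs

variable {k : ℕ} {Y : Type u} [MetricSpace Y]

/-- The restriction map from `V` to `U ⊆ V`. -/
def HPoly.res {U V : Opens Y} (h : U ≤ V) : HPoly k V →L[ℝ] HPoly k U :=
  HPoly.pull (fun x => ⟨x.1, h x.2⟩) (LipschitzWith.of_edist_le fun _ _ => le_rfl)

theorem HPoly.res_res {U V W : Opens Y} (h : U ≤ V) (h' : V ≤ W) (p : HPoly k W) :
    HPoly.res h (HPoly.res h' p) = HPoly.res (h.trans h') p :=
  HPoly.pull_pull _ _ _ _ _ p

theorem HPoly.res_self {U : Opens Y} (h : U ≤ U) (p : HPoly k U) : HPoly.res h p = p := by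
  have key : (fun i => HomFactor.pull (fun x : U => (⟨x.1, h x.2⟩ : U))
      (LipschitzWith.of_edist_le fun _ _ => le_rfl) i) =
      fun i : Fin (k + 1) => ContinuousLinearMap.id ℝ (HomFactor k U i) := by
    funext i
    ext x
    induction x using Submodule.Quotient.induction_on with
    | _ f => rfl
  unfold HPoly.res HPoly.pull
  rw [key, PiTensorProduct.mapL_id]
  induction p using UniformSpace.Completion.induction_on with
  | hp => exact isClosed_eq (ContinuousLinearMap.continuous _) continuous_id
  | ih x => simp

/-- The open neighbourhoods of `y`, ordered by reverse inclusion. -/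
abbrev StalkIndex {Y : Type u} [MetricSpace Y] (y : Y) : Type u := (OpenNhdsOf y)ᵒᵈ

/-- The open set underlying an index. -/
def StalkIndex.set {y : Y} (i : StalkIndex y) : Opens Y := (OrderDual.ofDual i).toOpens

theorem StalkIndex.set_anti {y : Y} {i j : StalkIndex y} (h : i ≤ j) : j.set ≤ i.set := h

/-- The restriction maps, indexed by the neighbourhoods of `y`. -/
def stalkMap (k : ℕ) {Y : Type u} [MetricSpace Y] (y : Y) (i j : StalkIndex y) (h : i ≤ j) :
    HPoly k i.set →ₗ[ℝ] HPoly k j.set :=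
  (HPoly.res (StalkIndex.set_anti h)).toLinearMap

instance (y : Y) : DirectedSystem (fun i : StalkIndex y => HPoly k i.set)
    (fun i j h => stalkMap k y i j h) where
  map_self := fun _ p => HPoly.res_self _ p
  map_map := fun _ _ _ _ _ p => HPoly.res_res _ _ p

open Classical in
/-- The stalk at `y` of the presheaf `U ↦ HPoly k U`: the direct limit over the open
neighbourhoods of `y`. -/
def Stalk (k : ℕ) {Y : Type u} [MetricSpace Y] (y : Y) : Type u :=
  Module.DirectLimit (R := ℝ) (fun i : StalkIndex y => HPoly k i.set) (stalkMap k y)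

open Classical in
instance (y : Y) : AddCommGroup (Stalk k y) :=
  Module.DirectLimit.addCommGroup (fun i : StalkIndex y => HPoly k i.set) (stalkMap k y)

open Classical in
instance (y : Y) : Module ℝ (Stalk k y) :=
  Module.DirectLimit.module (fun i : StalkIndex y => HPoly k i.set) (stalkMap k y)

open Classical in
/-- The germ at `y` of a homogeneous polylipschitz function defined on a neighbourhood of `y`. -/
def germ (U : Opens Y) {y : Y} (hy : y ∈ U) : HPoly k U →ₗ[ℝ] Stalk k y :=
  Module.DirectLimit.of ℝ (StalkIndex y) (fun i : StalkIndex y => HPoly k i.set) (stalkMap k y)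
    (OrderDual.toDual ⟨U, hy⟩)

theorem germ_res {U V : Opens Y} (h : U ≤ V) {y : Y} (hy : y ∈ U) (p : HPoly k V) :
    germ U hy (HPoly.res h p) = germ V (h hy) p := by
  classical
  exact Module.DirectLimit.of_f (R := ℝ) (f := stalkMap k y)
    (i := OrderDual.toDual ⟨V, h hy⟩) (j := OrderDual.toDual ⟨U, hy⟩) (hij := h) (x := p)

theorem exists_germ {y : Y} (g : Stalk k y) :
    ∃ (U : Opens Y) (hy : y ∈ U) (p : HPoly k U), germ U hy p = g := by
  classical
  obtain ⟨i, p, h⟩ := Module.DirectLimit.exists_of (R := ℝ) (f := stalkMap k y) g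
  exact ⟨i.set, (OrderDual.ofDual i).mem, p, h⟩

theorem exists_res_eq {U V : Opens Y} {y : Y} (hU : y ∈ U) (hV : y ∈ V) {p : HPoly k U}
    {q : HPoly k V} (h : germ U hU p = germ V hV q) :
    ∃ (W : Opens Y) (_ : y ∈ W) (h₁ : W ≤ U) (h₂ : W ≤ V), HPoly.res h₁ p = HPoly.res h₂ q := by
  classical
  let W : Opens Y := U ⊓ V
  have hW : y ∈ W := ⟨hU, hV⟩
  have hWU : W ≤ U := inf_le_left
  have hWV : W ≤ V := inf_le_right
  rw [← germ_res hWU hW, ← germ_res hWV hW, ← sub_eq_zero, ← map_sub] at h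
  obtain ⟨j, hj, e⟩ := Module.DirectLimit.of.zero_exact (R := ℝ) (f := stalkMap k y)
    (i := OrderDual.toDual ⟨W, hW⟩) h
  have hD : j.set ≤ W := hj
  refine ⟨j.set, (OrderDual.ofDual j).mem, hD.trans hWU, hD.trans hWV, ?_⟩
  have e' : HPoly.res hD (HPoly.res hWU p - HPoly.res hWV q) = 0 := e
  rwa [map_sub, sub_eq_zero, HPoly.res_res, HPoly.res_res] at e'

/-- The space of all global sections `ω : Y → ⨆_y Stalk k y` (not necessarily continuous). -/
abbrev Sect (k : ℕ) (Y : Type u) [MetricSpace Y] : Type u := ∀ y : Y, Stalk k y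

/-- The étalé space of the presheaf `U ↦ HPoly k U`. -/
def Etale (k : ℕ) (Y : Type u) [MetricSpace Y] : Type u := Σ y : Y, Stalk k y

/-- A germ at `y`, as a point of the étalé space. -/
def Etale.mk (y : Y) (g : Stalk k y) : Etale k Y := ⟨y, g⟩

/-- The étalé topology, with the basic open sets `{[p]_x : x ∈ U}`. -/
instance : TopologicalSpace (Etale k Y) :=
  TopologicalSpace.generateFrom
    {O | ∃ (U : Opens Y) (p : HPoly k U), O = Set.range fun x : U => Etale.mk x.1 (germ U x.2 p)}

/-- Continuity of a section, as a map into the étalé space. -/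
def Sect.IsCont (ω : Sect k Y) : Prop := Continuous fun y => Etale.mk y (ω y)

theorem Sect.isCont_iff {ω : Sect k Y} : ω.IsCont ↔
    ∀ y, ∃ (U : Opens Y) (_ : y ∈ U) (p : HPoly k U), ∀ z (hz : z ∈ U), ω z = germ U hz p := by
  constructor
  · intro h y
    obtain ⟨U, hy, p, hp⟩ := exists_germ (ω y)
    let O : Set (Etale k Y) := Set.range fun x : U => Etale.mk x.1 (germ U x.2 p)
    have hO : IsOpen O := TopologicalSpace.isOpen_generateFrom_of_mem ⟨U, p, rfl⟩
    have h' : Continuous fun y => Etale.mk y (ω y) := h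
    let W : Opens Y := ⟨_, hO.preimage h'⟩
    have hWU : ∀ z ∈ W, ∃ hz : z ∈ U, ω z = germ U hz p := by
      rintro z ⟨x, hx⟩
      cases hx' : x with
      | mk x hxU =>
        subst hx'
        have h1 : x = z := congrArg Sigma.fst hx
        subst h1
        exact ⟨hxU, (eq_of_heq (Sigma.mk.inj hx).2).symm⟩
    refine ⟨W, ⟨⟨y, hy⟩, ?_⟩, HPoly.res (fun z hz => (hWU z hz).1) p, fun z hz => ?_⟩
    · exact Sigma.ext rfl (heq_of_eq hp)
    · rw [germ_res]
      exact (hWU z hz).2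
  · intro h
    unfold Sect.IsCont
    refine continuous_generateFrom_iff.2 ?_
    rintro _ ⟨V, q, rfl⟩
    rw [isOpen_iff_forall_mem_open]
    rintro y ⟨x, hx⟩
    cases hx' : x with
    | mk x hxV =>
      subst hx'
      have h1 : x = y := congrArg Sigma.fst hx
      subst h1
      have h2 : germ V hxV q = ω x := eq_of_heq (Sigma.mk.inj hx).2
      obtain ⟨U, hU, p, hp⟩ := h x
      rw [hp x hU] at h2
      obtain ⟨W, hW, hWV, hWU, e⟩ := exists_res_eq hxV hU h2
      refine ⟨W, fun z hz => ⟨⟨z, hWV hz⟩, ?_⟩, W.isOpen, hW⟩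
      refine Sigma.ext rfl (heq_of_eq ?_)
      change germ V (hWV hz) q = ω z
      rw [hp z (hWU hz), ← germ_res hWV hz, e, germ_res]

/-- The space of continuous sections, that is, of polylipschitz `k`-forms on `Y`. -/
def Forms (k : ℕ) (Y : Type u) [MetricSpace Y] : Submodule ℝ (Sect k Y) where
  carrier := {ω : Sect k Y | ω.IsCont}
  add_mem' := by
    intro ω η hω hη
    change (ω + η).IsCont
    refine Sect.isCont_iff.2 fun y => ?_
    obtain ⟨U, hU, p, hp⟩ := Sect.isCont_iff.1 hω y
    obtain ⟨V, hV, q, hq⟩ := Sect.isCont_iff.1 hη y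
    refine ⟨U ⊓ V, ⟨hU, hV⟩, HPoly.res inf_le_left p + HPoly.res inf_le_right q,
      fun z hz => ?_⟩
    rw [map_add, germ_res, germ_res, Pi.add_apply, hp z hz.1, hq z hz.2]
  zero_mem' := by
    change (0 : Sect k Y).IsCont
    exact Sect.isCont_iff.2 fun y => ⟨⊤, trivial, 0, fun z hz => (map_zero _).symm⟩
  smul_mem' := by
    intro a ω hω
    change (a • ω).IsCont
    refine Sect.isCont_iff.2 fun y => ?_
    obtain ⟨U, hU, p, hp⟩ := Sect.isCont_iff.1 hω y
    exact ⟨U, hU, a • p, fun z hz => by rw [map_smul, Pi.smul_apply, hp z hz]⟩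

/-- The support of a section: the closure of the set where its germ is not zero. -/
def Sect.support (ω : Sect k Y) : Set Y := closure {y | ω y ≠ 0}

/-- The space of sections with compact support. -/
def SectC (k : ℕ) (Y : Type u) [MetricSpace Y] : Submodule ℝ (Sect k Y) where
  carrier := {ω : Sect k Y | IsCompact ω.support}
  add_mem' := by
    intro ω η hω hη
    refine (hω.union hη).of_isClosed_subset isClosed_closure ?_
    unfold Sect.support
    rw [← closure_union]
    refine closure_mono fun y hy => ?_
    by_contra hn
    simp only [Set.mem_union, Set.mem_ofPred_eq, not_or, not_not] at hn
    exact hy (by rw [Pi.add_apply, hn.1, hn.2, add_zero])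
  zero_mem' := by simp [Sect.support]
  smul_mem' := by
    intro a ω hω
    refine hω.of_isClosed_subset isClosed_closure (closure_mono fun y hy hn => hy ?_)
    rw [Pi.smul_apply, hn, smul_zero]

/-- The space of compactly supported polylipschitz `k`-forms on `Y`. -/
def FormsC (k : ℕ) (Y : Type u) [MetricSpace Y] : Submodule ℝ (Sect k Y) := Forms k Y ⊓ SectC k Y

/-- The open subset `E ∩ U` of the metric space `E`. -/
def relOpen (E : Set Y) (U : Opens Y) : Opens E := U.comap ⟨Subtype.val, continuous_subtype_val⟩

/-- The restriction map from `U` to `E ∩ U`. -/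
def HPoly.toRelOpen (E : Set Y) (U : Opens Y) : HPoly k U →L[ℝ] HPoly k (relOpen E U) :=
  HPoly.pull (fun z => ⟨z.1.1, z.2⟩) (LipschitzWith.of_edist_le fun _ _ => le_rfl)

theorem HPoly.res_toRelOpen (E : Set Y) {U V : Opens Y} (h : U ≤ V) (h' : relOpen E U ≤ relOpen E V)
    (p : HPoly k V) :
    HPoly.toRelOpen E U (HPoly.res h p) = HPoly.res h' (HPoly.toRelOpen E V p) := by
  unfold HPoly.toRelOpen HPoly.res
  rw [HPoly.pull_pull (hgh := LipschitzWith.of_edist_le fun _ _ => le_rfl),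
    HPoly.pull_pull (hgh := LipschitzWith.of_edist_le fun _ _ => le_rfl)]

open Classical in
/-- Restriction of germs to a subset `E`: the germ at `x ∈ E` of `p` is sent to the germ at `x` of
`p|_{E ∩ U}`, where `U` is the domain of `p`. -/
def Stalk.restrict (E : Set Y) (x : E) : Stalk k (x : Y) →ₗ[ℝ] Stalk k x :=
  Module.DirectLimit.lift ℝ (StalkIndex (x : Y)) (fun i : StalkIndex (x : Y) => HPoly k i.set)
    (stalkMap k (x : Y))
    (fun i => (germ (relOpen E i.set) (OrderDual.ofDual i).mem).comp
      (HPoly.toRelOpen E i.set).toLinearMap)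
    (fun i j h p => by
      have h' : relOpen E j.set ≤ relOpen E i.set := fun z hz => h hz
      have e := HPoly.res_toRelOpen E (StalkIndex.set_anti h) h' p
      refine (congrArg (germ (relOpen E j.set) (OrderDual.ofDual j).mem) e).trans ?_
      exact germ_res h' (OrderDual.ofDual j).mem _)

/-- The restriction `ω|_E`, a section over the metric space `E`. -/
def Sect.restrict (E : Set Y) : Sect k Y →ₗ[ℝ] Sect k E :=
  LinearMap.pi fun x => (Stalk.restrict E x).comp (LinearMap.proj (x : Y))

/-- The compactly supported sections of `Y` whose restriction to `E` is continuous. -/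
def SectEC (k : ℕ) {Y : Type u} [MetricSpace Y] (E : Set Y) : Submodule ℝ (Sect k Y) :=
  (Forms k E).comap (Sect.restrict E) ⊓ SectC k Y

/-- The pointwise norm of a germ at `y`: the limit as `r → 0` (an infimum, by monotonicity) of
`Lip_k(p; B_r(y))`, where `p` is a homogeneous polylipschitz function on a neighbourhood of `y`
which represents the germ. -/
def Stalk.pnorm {y : Y} (g : Stalk k y) : ℝ≥0∞ :=
  ⨅ (U : Opens Y) (hy : y ∈ U) (p : HPoly k U) (_ : germ U hy p = g) (r : ℝ) (_ : 0 < r),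
    HPoly.lipOn p {z | dist (z : Y) y < r}

/-- The global section `x ↦ [p]_x` defined by a homogeneous polylipschitz function on `Y`. -/
def HPoly.toSect (p : HPoly k Y) : Sect k Y := fun y =>
  germ ⊤ (y := y) trivial (HPoly.pull Subtype.val (LipschitzWith.of_edist_le fun _ _ => le_rfl) p)

theorem HPoly.toSect_mem (p : HPoly k Y) : p.toSect ∈ Forms k Y := by
  change p.toSect.IsCont
  exact Sect.isCont_iff.2 fun _ => ⟨⊤, trivial, _, fun _ _ => rfl⟩

theorem HPoly.tensor_eq_zero {f : Fin (k + 1) → BLip Y} (h : f 0 = 0) : HPoly.tensor f = 0 := by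
  have : (⨂ₜ[ℝ] i, (homKer k Y i).mkQL (f i)) = 0 := by
    refine (PiTensorProduct.tprod ℝ).map_coord_zero 0 ?_
    rw [h, map_zero]
  unfold HPoly.tensor
  rw [this, UniformSpace.Completion.coe_zero]

theorem HPoly.germ_toSect (p : HPoly k Y) (V : Opens Y) {y : Y} (hy : y ∈ V) :
    p.toSect y = germ V hy
      (HPoly.pull Subtype.val (LipschitzWith.of_edist_le fun _ _ => le_rfl) p) := by
  unfold HPoly.toSect
  rw [← germ_res (le_top : V ≤ ⊤) hy]
  unfold HPoly.res
  rw [HPoly.pull_pull (hgh := LipschitzWith.of_edist_le fun _ _ => le_rfl)]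

theorem HPoly.pull_tensor_eq_zero {V : Opens Y} {f : Fin (k + 1) → BLip Y}
    (hV : ∀ x ∈ V, f 0 x = 0) :
    HPoly.pull (Subtype.val : V → Y) (LipschitzWith.of_edist_le fun _ _ => le_rfl)
      (HPoly.tensor f) = 0 := by
  rw [HPoly.pull_tensor]
  exact HPoly.tensor_eq_zero (BLip.ext fun z => hV z.1 z.2)

theorem toSect_tensor_mem (f : LipC Y) (π : Fin k → BLip Y) :
    (HPoly.tensor (Fin.cons f.1 π) : HPoly k Y).toSect ∈ FormsC k Y := by
  refine ⟨HPoly.toSect_mem _, ?_⟩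
  have hf : IsCompact (tsupport (f.1 : Y → ℝ)) := f.2
  refine hf.of_isClosed_subset isClosed_closure
    (closure_minimal (fun y hy => ?_) (isClosed_tsupport _))
  by_contra hn
  apply hy
  have hV : ∀ x ∈ (⟨(tsupport (f.1 : Y → ℝ))ᶜ, (isClosed_tsupport _).isOpen_compl⟩ : Opens Y),
      (Fin.cons f.1 π : Fin (k + 1) → BLip Y) 0 x = 0 := by
    intro x hx
    rw [Fin.cons_zero]
    exact image_eq_zero_of_notMem_tsupport hx
  rw [HPoly.germ_toSect _ ⟨(tsupport (f.1 : Y → ℝ))ᶜ, (isClosed_tsupport _).isOpen_compl⟩ hn,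
    HPoly.pull_tensor_eq_zero hV, map_zero]

/-- The natural map `ῑ : (π₀, …, π_k) ↦ π₀ ⊗ [π₁] ⊗ ⋯ ⊗ [π_k]` into the compactly supported
polylipschitz forms, for `π₀` with compact support. -/
def toForm (f : LipC Y) (π : Fin k → BLip Y) : FormsC k Y :=
  ⟨(HPoly.tensor (Fin.cons f.1 π) : HPoly k Y).toSect, toSect_tensor_mem f π⟩

end germs

/-! ### Overlap-compatible families, partitions of unity, convergence of forms -/

section families

variable {k : ℕ} {Y : Type u} [MetricSpace Y]

/-- The family `p i`, `i : ι`, of homogeneous polylipschitz functions on the sets `U i` of a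
locally finite open cover of `Y` is overlap-compatible with the section `ω`. -/
def OverlapCompatible {ι : Type u} (U : ι → Opens Y) (p : ∀ i, HPoly k (U i))
    (ω : Sect k Y) : Prop :=
  LocallyFinite (fun i => (U i : Set Y)) ∧ (∀ y, ∃ i, y ∈ U i) ∧
    (∀ y, ∃ (i : ι) (hy : y ∈ U i), ω y = germ (U i) hy (p i)) ∧
    ∀ i j, HPoly.res (inf_le_left : U i ⊓ U j ≤ U i) (p i) =
      HPoly.res (inf_le_right : U i ⊓ U j ≤ U j) (p j)

/-- A Lipschitz partition of unity on `Y` subordinate to the (locally finite) cover `U`. -/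
def LipPartition {ι : Type u} (U : ι → Opens Y) (φ : ι → BLip Y) : Prop :=
  (∀ i y, 0 ≤ φ i y) ∧ (∀ i, tsupport (φ i : Y → ℝ) ⊆ U i) ∧ ∀ y, ∑ᶠ i, φ i y = 1

/-- Sequential convergence of compactly supported polylipschitz forms. -/
def FormsC.SeqConv (ω : ℕ → FormsC k Y) (η : FormsC k Y) : Prop :=
  ∃ (K : Set Y) (ι : Type u) (U : ι → Opens Y) (p : ℕ → ∀ i, HPoly k (U i)),
    IsCompact K ∧ (∀ i, IsCompact (closure (U i : Set Y))) ∧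
    (∀ n, OverlapCompatible U (p n) (ω n - η : FormsC k Y).1) ∧
    (∀ n, Sect.support (ω n - η : FormsC k Y).1 ⊆ K) ∧
    ∀ i, HPoly.SeqConv (fun n => p n i) 0

open Classical in
/-- The function `x ↦ ‖ω|_E‖_x`, extended by zero to the complement of `E`. -/
def Sect.pnormOn (E : Set Y) (ω : Sect k Y) (x : Y) : ℝ≥0∞ :=
  if h : x ∈ E then (Sect.restrict E ω ⟨x, h⟩).pnorm else 0

end families

/-! ### Metric currents -/

section currents

variable {k : ℕ} {X : Type u} [MetricSpace X]

/-- Convergence of sequences in `LIP_∞(X)`. -/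
def BLip.SeqConv (f : ℕ → BLip X) (g : BLip X) : Prop :=
  (∃ C : ℝ, ∀ n, lipOn (f n) Set.univ ≤ C) ∧
    ∀ K : Set X, IsCompact K → TendstoUniformlyOn (fun n x => f n x) (fun x => g x) atTop K

/-- Convergence of sequences in `LIP_c(X)`. -/
def LipC.SeqConv (f : ℕ → LipC X) (g : LipC X) : Prop :=
  (∃ C : ℝ, ∀ n, lipOn (f n).1 Set.univ ≤ C) ∧
    IsCompact (closure (⋃ n, tsupport ((f n).1 : X → ℝ))) ∧
    TendstoUniformly (fun n x => (f n).1 x) (fun x => g.1 x) atTop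

/-- A metric `k`-current on `X`: a `(k+1)`-linear, sequentially continuous and local functional on
`LIP_c(X) × LIP_∞(X)^k`. -/
structure Current (k : ℕ) (X : Type u) [MetricSpace X] where
  /-- The underlying `(k+1)`-linear functional. -/
  toMap : LipC X →ₗ[ℝ] MultilinearMap ℝ (fun _ : Fin k => BLip X) ℝ
  seqCont : ∀ (f : ℕ → LipC X) (f₀ : LipC X) (π : ℕ → Fin k → BLip X) (π₀ : Fin k → BLip X),
    LipC.SeqConv f f₀ → (∀ i, BLip.SeqConv (fun n => π n i) (π₀ i)) →
      Tendsto (fun n => toMap (f n) (π n)) atTop (𝓝 (toMap f₀ π₀))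
  locality : ∀ (f : LipC X) (π : Fin k → BLip X),
    (∃ (i : Fin k) (V : Set X) (c : ℝ), IsOpen V ∧ tsupport (f.1 : X → ℝ) ⊆ V ∧
      ∀ x ∈ V, π i x = c) → toMap f π = 0

namespace Current

variable [MeasurableSpace X]

/-- The inequality `|T(f, π₁, …, π_k)| ≤ Lip(π₁) ⋯ Lip(π_k) ∫ |f| dμ`. -/
def MassBound (T : Current k X) (μ : Measure X) : Prop :=
  ∀ (f : LipC X) (π : Fin k → BLip X),
    |T.toMap f π| ≤ (∏ i, lipOn (π i) Set.univ) * ∫ x, |f.1 x| ∂μ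

/-- `T` has locally finite mass: the mass bound holds for some Radon measure. -/
def LocallyFiniteMass [BorelSpace X] (T : Current k X) : Prop :=
  ∃ μ : Measure X, μ.Regular ∧ T.MassBound μ

/-- The mass measure `‖T‖` of a current of locally finite mass: the least Radon measure satisfying
the mass bound, here written as the infimum of all of them in the lattice of measures. -/
def mass [BorelSpace X] (T : Current k X) : Measure X :=
  sInf {μ : Measure X | μ.Regular ∧ T.MassBound μ}

/-- The extension of a current `T` of locally finite mass to tuples `(f, π₁, …, π_k)` in which `f`
is a compactly supported bounded Borel function: the limit of `T(g, π₁, …, π_k)` as `g ∈ LIP_c(X)`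
tends to `f` in `L¹(‖T‖)`.  By the mass bound this is the unique extension which is
continuous under bounded pointwise convergence with uniformly compact supports. -/
def borelExt [BorelSpace X] (T : Current k X) (f : X → ℝ) (π : Fin k → BLip X) : ℝ :=
  limUnder (comap (fun g : LipC X => ∫⁻ x, ‖g.1 x - f x‖ₑ ∂T.mass) (𝓝 0)) fun g => T.toMap g π

/-- The restriction `T⌊E`, given by `(f, π₁, …, π_k) ↦ T(χ_E f, π₁, …, π_k)`. -/
def restrict [BorelSpace X] (T : Current k X) (E : Set X) (f : LipC X) (π : Fin k → BLip X) : ℝ :=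
  T.borelExt (E.indicator fun x => f.1 x) π

/-- A sequentially continuous linear functional on the compactly supported polylipschitz forms
which extends `T`, that is, `T̂ ∘ ῑ = T`. -/
def IsExtension (T : Current k X) (A : FormsC k X →ₗ[ℝ] ℝ) : Prop :=
  (∀ (ω : ℕ → FormsC k X) (η : FormsC k X), FormsC.SeqConv ω η →
      Tendsto (fun n => A (ω n)) atTop (𝓝 (A η))) ∧
    ∀ (f : LipC X) (π : Fin k → BLip X), A (toForm f π) = T.toMap f π

end Current

open Classical in
/-- For a relatively open subset `U` of `E`, the product `φ f` of functions on `E` and on `U`,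
extended by zero to the complement of `U`. -/
def zeroExt {E : Set X} (U : Opens E) (φ : BLip E) (f : BLip U) (x : X) : ℝ :=
  if h : ∃ hx : x ∈ E, (⟨x, hx⟩ : E) ∈ U then φ ⟨x, h.1⟩ * f ⟨⟨x, h.1⟩, h.2⟩ else 0

/-- The restriction of a function on `X` to a relatively open subset `U` of `E ⊆ X`. -/
def resBLip {E : Set X} (U : Opens E) : BLip X →L[ℝ] BLip U :=
  BLip.comp (fun z => z.1.1) (LipschitzWith.of_edist_le fun _ _ => le_rfl)

namespace Current

variable [MeasurableSpace X] [BorelSpace X]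

/-- `A` is the linearization of the functional
`(π₀, …, π_k) ↦ (T⌊E)(φ π₀, π₁, …, π_k)` on `LIP_∞(U)^{k+1}`, where `U` is a relatively open subset
of `E` and `π₁, …, π_k` are extended to `X` in an arbitrary way. -/
def IsLinearization (T : Current k X) (E : Set X) (U : Opens E) (φ : BLip E)
    (A : HPoly k U →L[ℝ] ℝ) : Prop :=
  ∀ (f : BLip U) (π : Fin k → BLip X),
    A (HPoly.tensor (Fin.cons f fun i => resBLip U (π i))) = T.borelExt (zeroExt U φ f) π

open Classical in
/-- The linearization in the sense of `IsLinearization` (and `0` if there is none). -/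
def linearization (T : Current k X) (E : Set X) (U : Opens E) (φ : BLip E) :
    HPoly k U →L[ℝ] ℝ :=
  if h : ∃ A, T.IsLinearization E U φ A then h.choose else 0

end Current

end currents

/-- The subset `U` of `E ⊆ X` is precompact in `X`. -/
def PrecompactIn {X : Type u} [MetricSpace X] {E : Set X} (U : Opens E) : Prop :=
  IsCompact (closure (Subtype.val '' (U : Set E)))

end Polylip

end

open Polylip

noncomputable section

namespace Polylip

universe u v w

/-! ### Lipschitz constants and products of bounded Lipschitz functions -/

section lipOn

variable {Y : Type u} [MetricSpace Y]

/-! Everything rests on one estimate for weighted currents. For a $\|T\|$-integrable weight $g$ on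
$X$, carried by an isometrically embedded space $Z$, the functional $T(g\pi_0,\pi_1,\dots,\pi_k)$
depends only on the restrictions of the $\pi_i$ to $Z$ and is unchanged when constants are added to
$\pi_1,\dots,\pi_k$. The reason is strict locality (`borelExt_eq_zero`): $T(g,\pi)=0$ as soon as
some $\pi_i$, $i\ge1$, vanishes on $\{g\ne0\}$, with no neighbourhood required. McShane extension
from $Z$ to $X$ therefore gives a well-defined bounded functional `Current.lin` on the completed
tensor product over $Z$, and expanding along a representation gives $|\mathrm{lin}_g(p)|\le
\mathrm{Lip}_k(p;A)\int|g|\,d\|T\|$ whenever $g$ lives on $A$ (`enorm_lin_le`).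

The functional is countably additive in $g$. Cutting $g$ along the level sets of the pointwise norm,
and along a countable cover by neighbourhoods on which $\mathrm{Lip}_k$ is nearly that norm, turns
the crude estimate into $|\mathrm{lin}_g(p)|\le\int|g|\,\|\omega\|_x\,d\|T\|$
(`enorm_lin_le_lintegral_pn`). Hence `lin` sees only germs. A section $\omega$ over $E$ with
integrable norm is evaluated by summing $\mathrm{lin}_{g_i}(p_i)$ over local representatives $p_i$
and weights $g_i$ adding up to one where $\omega\neq0$. Two such sums are compared on the products
$g_ih_l$, and absolute convergence permits exchanging the order (`LocRep.hasSum_unique`). Lipschitz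
partitions of unity and Borel partitions are both admissible weights, so the sum in the theorem
always equals `Current.value`. The bound by $\int_E\|\omega|_E\|_x\,d\|T\|$ and linearity follow at
once.

Three further ingredients are needed. The least measure exists because the Radon measures satisfying
the mass bound are directed downwards: a Hahn decomposition and a Lipschitz approximation of its
indicator give the bound for $\mu\wedge\nu$, and Riesz representation yields the infimum
(`isLeast_mass`). Overlap-compatible families come from a shrinking argument on locally finite
covers, and globally Lipschitz partitions of unity from a decomposition into bands at the scales
$1/n$ (`exists_lipPartition`). Sequential continuity follows from Arzelà–Ascoli together with strict
locality on each simple tensor, and dominated convergence over the terms of a representation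
(`tendsto_lin_zero`).

Uniqueness of $\widehat T$ holds because every compactly supported form is a finite sum of forms
$\varphi q$ with $q$ a global homogeneous polylipschitz function. The partial sums of a
representation of $q$ give forms in the span of the image of $\bar\iota$, and the remainders
converge sequentially to zero. -/

theorem lipOn_nonneg (f : Y → ℝ) (A : Set Y) : 0 ≤ lipOn f A :=
  Real.iSup_nonneg fun _ => div_nonneg (abs_nonneg _) dist_nonneg

theorem lipOn_le {f : Y → ℝ} {A : Set Y} {C : ℝ} (hC : 0 ≤ C)
    (h : ∀ x ∈ A, ∀ y ∈ A, |f x - f y| ≤ C * dist x y) : lipOn f A ≤ C :=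
  Real.iSup_le (fun p => div_le_of_le_mul₀ dist_nonneg hC (h _ p.1.2 _ p.2.2)) hC

theorem BLip.abs_sub_le_lipOn (f : BLip Y) {A : Set Y} {x y : Y} (hx : x ∈ A) (hy : y ∈ A) :
    |f x - f y| ≤ lipOn f A * dist x y := by
  rcases (dist_nonneg (x := x) (y := y)).eq_or_lt with h | h
  · have := f.abs_sub_le_norm x y
    rw [← h] at this ⊢
    simpa using this
  · rw [← div_le_iff₀ h]
    refine le_ciSup (f := fun p : A × A => |f p.1 - f p.2| / dist (p.1 : Y) (p.2 : Y))
      ⟨‖f‖, ?_⟩ (⟨x, hx⟩, ⟨y, hy⟩)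
    rintro _ ⟨p, rfl⟩
    exact div_le_of_le_mul₀ dist_nonneg (norm_nonneg f) (f.abs_sub_le_norm _ _)

theorem BLip.lipOn_mono (f : BLip Y) {A B : Set Y} (h : A ⊆ B) : lipOn f A ≤ lipOn f B :=
  lipOn_le (lipOn_nonneg _ _) fun _ hx _ hy => f.abs_sub_le_lipOn (h hx) (h hy)

theorem BLip.lipOn_le_norm (f : BLip Y) (A : Set Y) : lipOn f A ≤ ‖f‖ :=
  lipOn_le (norm_nonneg _) fun _ _ _ _ => f.abs_sub_le_norm _ _

theorem BLip.continuous (f : BLip Y) : Continuous (f : Y → ℝ) := by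
  have : LipschitzWith (Real.toNNReal ‖f‖) (f : Y → ℝ) := by
    refine LipschitzWith.of_dist_le_mul fun x y => ?_
    rw [Real.coe_toNNReal _ (norm_nonneg f), Real.dist_eq]
    exact f.abs_sub_le_norm x y
  exact this.continuous

/-- A bounded Lipschitz function from explicit bounds. -/
def BLip.mk' (f : Y → ℝ) (C D : ℝ) (h₁ : ∀ x y, |f x - f y| ≤ C * dist x y)
    (h₂ : ∀ x, |f x| ≤ D) : BLip Y := ⟨f, ⟨C, h₁⟩, D, h₂⟩

@[simp] theorem BLip.mk'_apply (f : Y → ℝ) (C D : ℝ) (h₁ : ∀ x y, |f x - f y| ≤ C * dist x y)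
    (h₂ : ∀ x, |f x| ≤ D) (x : Y) : BLip.mk' f C D h₁ h₂ x = f x := rfl

theorem BLip.abs_mul_sub_le (φ f : BLip Y) (x y : Y) :
    |φ x * f x - φ y * f y| ≤ 2 * ‖φ‖ * ‖f‖ * dist x y := by
  have e : φ x * f x - φ y * f y = φ x * (f x - f y) + (φ x - φ y) * f y := by ring
  rw [e]
  refine (abs_add_le _ _).trans ?_
  rw [abs_mul, abs_mul]
  have h1 := mul_le_mul (φ.abs_le_norm x) (f.abs_sub_le_norm x y) (abs_nonneg _) (norm_nonneg _)
  have h2 := mul_le_mul (φ.abs_sub_le_norm x y) (f.abs_le_norm y) (abs_nonneg _)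
    (mul_nonneg (norm_nonneg _) dist_nonneg)
  linarith

/-- Multiplication by a bounded Lipschitz function. -/
def BLip.mul (φ : BLip Y) : BLip Y →L[ℝ] BLip Y :=
  LinearMap.mkContinuous
    { toFun := fun f => BLip.mk' (fun x => φ x * f x) (2 * ‖φ‖ * ‖f‖) (‖φ‖ * ‖f‖)
        (BLip.abs_mul_sub_le φ f) fun x => by
          rw [abs_mul]
          exact mul_le_mul (φ.abs_le_norm x) (f.abs_le_norm x) (abs_nonneg _) (norm_nonneg _)
      map_add' := fun _ _ => BLip.ext fun _ => mul_add _ _ _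
      map_smul' := fun _ _ => BLip.ext fun _ => mul_left_comm _ _ _ } (2 * ‖φ‖) fun f => by
    refine BLip.norm_le (by positivity) (BLip.abs_mul_sub_le φ f) fun x => ?_
    have h := mul_le_mul (φ.abs_le_norm x) (f.abs_le_norm x) (abs_nonneg _) (norm_nonneg _)
    change |φ x * f x| ≤ _
    rw [abs_mul]
    nlinarith [mul_nonneg (norm_nonneg φ) (norm_nonneg f)]

@[simp] theorem BLip.mul_apply (φ f : BLip Y) (x : Y) : φ.mul f x = φ x * f x := rfl

theorem BLip.norm_mul_le (φ f : BLip Y) : ‖φ.mul f‖ ≤ 2 * ‖φ‖ * ‖f‖ :=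
  (φ.mul.le_opNorm f).trans (mul_le_mul_of_nonneg_right
    (LinearMap.mkContinuous_norm_le _ (by positivity) _) (norm_nonneg _))

/-- The constant function `1`. -/
def BLip.one (Y : Type u) [MetricSpace Y] : BLip Y := BLip.mk' (fun _ => 1) 0 1 (by simp) (by simp)

@[simp] theorem BLip.one_apply (x : Y) : BLip.one Y x = 1 := rfl

/-- Multiplication of a compactly supported function by a bounded one. -/
def LipC.mul (f : LipC Y) : BLip Y →ₗ[ℝ] LipC Y where
  toFun g := ⟨g.mul f.1, HasCompactSupport.mul_left (f := (g : Y → ℝ)) f.2⟩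
  map_add' _ _ := Subtype.ext (BLip.ext fun _ => add_mul _ _ _)
  map_smul' _ _ := Subtype.ext (BLip.ext fun _ => mul_assoc _ _ _)

@[simp] theorem LipC.mul_apply (f : LipC Y) (g : BLip Y) (x : Y) :
    (LipC.mul f g).1 x = g x * f.1 x := rfl

theorem LipC.integrable [MeasurableSpace Y] [BorelSpace Y] (f : LipC Y) (μ : Measure Y)
    [IsFiniteMeasureOnCompacts μ] : Integrable (f.1 : Y → ℝ) μ :=
  f.1.continuous.integrable_of_hasCompactSupport f.2

end lipOn

/-! ### Density of compactly supported Lipschitz functions -/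

section density

variable {X : Type u} [MetricSpace X]

/-- The approximant is the infimal convolution of `f` with a multiple of the distance. The slope is
chosen so that moving by the modulus `δ` of uniform continuity already costs the bound of `f`; only
points within `δ` can then lower the infimum, and by at most `ε`. Nonnegativity places the
approximant between zero and `f`, which keeps the support compact. -/
theorem exists_lipC_of_nonneg {f : X → ℝ} (hf : Continuous f) (hc : HasCompactSupport f)
    (h0 : ∀ x, 0 ≤ f x) {ε : ℝ} (hε : 0 < ε) :
    ∃ g : LipC X, ∀ x, 0 ≤ g.1 x ∧ g.1 x ≤ f x ∧ f x ≤ g.1 x + ε := by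
  obtain ⟨δ, hδ, hd⟩ := Metric.uniformContinuous_iff.1
    (HasCompactSupport.uniformContinuous_of_continuous hc hf) ε hε
  obtain ⟨M, hM⟩ := hf.bounded_above_of_compact_support hc
  have hM' : ∀ x, f x ≤ |M| := fun x => (le_abs_self _).trans ((hM x).trans (le_abs_self M))
  set n : ℝ := |M| / δ with hn
  have hn0 : 0 ≤ n := div_nonneg (abs_nonneg _) hδ.le
  let g : X → ℝ := fun x => ⨅ y, (f y + n * dist x y)
  have hnn : ∀ x y, 0 ≤ f y + n * dist x y := fun x y =>
    add_nonneg (h0 y) (mul_nonneg hn0 dist_nonneg)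
  have hbd : ∀ x, BddBelow (Set.range fun y => f y + n * dist x y) := fun x =>
    ⟨0, by rintro _ ⟨y, rfl⟩; exact hnn x y⟩
  have g0 : ∀ x, 0 ≤ g x := fun x => Real.iInf_nonneg (hnn x)
  have gf : ∀ x, g x ≤ f x := fun x => (ciInf_le (hbd x) x).trans (by simp)
  have fg : ∀ x, f x ≤ g x + ε := by
    intro x
    have : Nonempty X := ⟨x⟩
    rw [← sub_le_iff_le_add]
    refine le_ciInf fun y => ?_
    rcases lt_or_ge (dist x y) δ with h | h
    · have := hd h
      rw [Real.dist_eq] at this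
      have := (abs_lt.1 this).2
      nlinarith [mul_nonneg hn0 (dist_nonneg (x := x) (y := y))]
    · have : |M| ≤ n * dist x y := by
        rw [hn, div_mul_eq_mul_div, le_div_iff₀ hδ]
        exact mul_le_mul_of_nonneg_left h (abs_nonneg _)
      linarith [hM' x, h0 y]
  have glip : ∀ x y, g x ≤ g y + n * dist x y := by
    intro x y
    have : Nonempty X := ⟨x⟩
    rw [← sub_le_iff_le_add]
    refine le_ciInf fun z => ?_
    rw [sub_le_iff_le_add]
    refine (ciInf_le (hbd x) z).trans ?_
    nlinarith [mul_le_mul_of_nonneg_left (dist_triangle x y z) hn0]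
  have gsupp : HasCompactSupport g := by
    refine hc.mono fun x hx => ?_
    rw [Function.mem_support] at hx ⊢
    intro h
    exact hx (le_antisymm (h ▸ gf x) (g0 x))
  refine ⟨⟨BLip.mk' g n |M| (fun x y => ?_) fun x => ?_, gsupp⟩, fun x => ⟨g0 x, gf x, fg x⟩⟩
  · rw [abs_le]
    have := glip x y
    have h2 := glip y x
    rw [dist_comm] at h2
    constructor <;> linarith
  · rw [abs_of_nonneg (g0 x)]
    exact (gf x).trans (hM' x)

variable [LocallyCompactSpace X] [MeasurableSpace X] [BorelSpace X]

/-- Continuous functions with compact support are dense in $L^1$. Positive and negative parts of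
such a function are approximated separately, since the infimal convolution needs a sign. The uniform
error lives on the compact support, hence the division by its measure plus one. -/
theorem exists_lipC_integral_le {μ : Measure X} [μ.Regular] {g : X → ℝ} (hg : Integrable g μ)
    {ε : ℝ} (hε : 0 < ε) : ∃ f : LipC X, ∫ x, |f.1 x - g x| ∂μ ≤ ε := by
  obtain ⟨h, hc, hle, hcont, hint⟩ := hg.exists_hasCompactSupport_integral_sub_le (half_pos hε)
  set K := tsupport h with hK
  set m : ℝ := μ.real K with hm
  have hm0 : 0 ≤ m := measureReal_nonneg
  have hcp : HasCompactSupport fun x => max (h x) 0 := hc.comp_left (g := fun t => max t 0) (by simp)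
  have hcn : HasCompactSupport fun x => max (-h x) 0 :=
    hc.comp_left (g := fun t => max (-t) 0) (by simp)
  have hε' : 0 < ε / 4 / (m + 1) := by positivity
  obtain ⟨p, hp⟩ := exists_lipC_of_nonneg (by fun_prop) hcp (fun x => le_max_right _ _) hε'
  obtain ⟨q, hq⟩ := exists_lipC_of_nonneg (by fun_prop) hcn (fun x => le_max_right _ _) hε'
  refine ⟨p - q, ?_⟩
  have hpq : ∀ x, (p - q).1 x = p.1 x - q.1 x := fun x => by
    have : (p - q).1 = p.1 + (-1 : ℝ) • q.1 := by simp [sub_eq_add_neg]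
    rw [this, BLip.add_apply, BLip.smul_apply]; ring
  have key : ∀ x, |(p - q).1 x - g x| ≤
      K.indicator (fun _ => ε / 2 / (m + 1)) x + ‖g x - h x‖ := by
    intro x
    have e : (p - q).1 x - g x = ((p - q).1 x - h x) - (g x - h x) := by ring
    rw [e]
    refine (abs_sub _ _).trans (add_le_add ?_ le_rfl)
    rw [hpq]
    have e2 : max (h x) 0 - max (-h x) 0 = h x := by
      rcases le_total (h x) 0 with h' | h'
      · rw [max_eq_right h', max_eq_left (by linarith)]; ring
      · rw [max_eq_left h', max_eq_right (by linarith)]; ring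
    obtain ⟨p0, p1, p2⟩ := hp x
    obtain ⟨q0, q1, q2⟩ := hq x
    by_cases hx : x ∈ K
    · rw [Set.indicator_of_mem hx, abs_le]
      have e3 : ε / 2 / (m + 1) = 2 * (ε / 4 / (m + 1)) := by ring
      constructor <;> linarith
    · rw [Set.indicator_of_notMem hx]
      have hx0 : h x = 0 := image_eq_zero_of_notMem_tsupport hx
      rw [hx0, max_self] at p1
      rw [hx0, neg_zero, max_self] at q1
      rw [hx0, le_antisymm p1 p0, le_antisymm q1 q0]
      simp
  have hi : Integrable (K.indicator fun _ => ε / 2 / (m + 1)) μ :=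
    (integrable_indicator_iff (isClosed_tsupport h).measurableSet).2
      (integrableOn_const (hs := hc.isCompact.measure_lt_top.ne))
  calc ∫ x, |(p - q).1 x - g x| ∂μ
      ≤ ∫ x, (K.indicator (fun _ => ε / 2 / (m + 1)) x + ‖g x - h x‖) ∂μ :=
        integral_mono (((LipC.integrable (p - q) μ).sub hg).abs) (hi.add (hg.sub hint).norm) key
    _ = m * (ε / 2 / (m + 1)) + ∫ x, ‖g x - h x‖ ∂μ := by
        have hn : Integrable (fun x => ‖g x - h x‖) μ := (hg.sub hint).norm
        rw [integral_add hi hn,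
          integral_indicator (isClosed_tsupport h).measurableSet, setIntegral_const, smul_eq_mul]
    _ ≤ ε / 2 + ε / 2 := by
        refine add_le_add ?_ hle
        rw [mul_div_assoc', div_le_iff₀ (by positivity)]
        nlinarith
    _ = ε := by ring

end density

/-! ### Existence of the mass measure -/

section mass

open scoped NNReal CompactlySupported

variable {X : Type u} [MetricSpace X] [MeasurableSpace X] [BorelSpace X] {k : ℕ}

theorem ofReal_integral_abs (f : LipC X) (μ : Measure X) [IsFiniteMeasureOnCompacts μ] :
    ENNReal.ofReal (∫ x, |f.1 x| ∂μ) = ∫⁻ x, ‖f.1 x‖ₑ ∂μ := by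
  simpa only [Real.norm_eq_abs] using
    ofReal_integral_norm_eq_lintegral_enorm (LipC.integrable f μ)

theorem massBound_iff {T : Current k X} {μ : Measure X} [IsFiniteMeasureOnCompacts μ] :
    T.MassBound μ ↔ ∀ (f : LipC X) (π : Fin k → BLip X),
      ‖T.toMap f π‖ₑ ≤ ENNReal.ofReal (∏ i, lipOn (π i) Set.univ) * ∫⁻ x, ‖f.1 x‖ₑ ∂μ := by
  refine forall₂_congr fun f π => ?_
  have h0 : 0 ≤ ∏ i, lipOn (π i : X → ℝ) Set.univ := Finset.prod_nonneg fun _ _ => lipOn_nonneg _ _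
  rw [← ofReal_integral_abs, ← ENNReal.ofReal_mul h0, ← ofReal_norm, Real.norm_eq_abs,
    ENNReal.ofReal_le_ofReal_iff
      (mul_nonneg h0 (integral_nonneg fun _ => abs_nonneg _))]

/-- A closed subset of `P` carries almost all the mass of `P`, and the thickened indicators of a
closed set are Lipschitz with integrals converging to its measure. -/
theorem lintegral_mul_indicator_sub_le {ρ : Measure X} [IsFiniteMeasure ρ] {P : Set X}
    (hP : MeasurableSet P) {ε : ℝ≥0∞} (hε : ε ≠ 0) :
    ∃ g : BLip X, (∀ x, 0 ≤ g x ∧ g x ≤ 1) ∧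
      ∫⁻ x, ‖g x - P.indicator (fun _ => 1) x‖ₑ ∂ρ ≤ ε := by
  have hε2 : ε / 2 ≠ 0 := by simpa using hε
  obtain ⟨F, hFP, hF, hlt⟩ := hP.exists_isClosed_lt_add (measure_ne_top ρ P) hε2
  have hdiff : ρ (P \ F) ≤ ε / 2 := by
    rw [measure_sdiff hFP hF.measurableSet.nullMeasurableSet (measure_ne_top _ _)]
    exact tsub_le_iff_left.2 hlt.le
  have δpos : ∀ n : ℕ, (0 : ℝ) < 1 / (n + 1) := fun n => Nat.one_div_pos_of_nat
  have hlim := tendsto_lintegral_thickenedIndicator_of_isClosed ρ hF δpos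
    tendsto_one_div_add_atTop_nhds_zero_nat
  have hev : ∀ᶠ n : ℕ in atTop, ∫⁻ x, thickenedIndicator (δpos n) F x ∂ρ < ρ F + ε / 2 :=
    hlim.eventually (gt_mem_nhds (ENNReal.lt_add_right (measure_ne_top _ _) hε2))
  obtain ⟨n, hn⟩ := hev.exists
  set t := thickenedIndicator (δpos n) F with ht
  have hlip := lipschitzWith_thickenedIndicator (δpos n) F
  have ht1 : ∀ x, t x ≤ 1 := fun x => thickenedIndicator_le_one _ F x
  have h1 : ∀ x y, |(t x : ℝ) - t y| ≤ ((Real.toNNReal (1 / (n + 1)))⁻¹ : ℝ≥0) * dist x y :=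
    fun x y => by
      have := hlip.dist_le_mul x y
      rwa [NNReal.dist_eq] at this
  have h2 : ∀ x, |(t x : ℝ)| ≤ 1 := fun x => by
    rw [abs_of_nonneg (NNReal.coe_nonneg (t x))]; exact_mod_cast ht1 x
  refine ⟨BLip.mk' (fun x => (t x : ℝ)) _ 1 h1 h2, fun x => ⟨(t x).2, ?_⟩, ?_⟩
  · exact_mod_cast ht1 x
  · have hpt : ∀ x, ‖BLip.mk' (fun x => (t x : ℝ)) _ 1 h1 h2 x - P.indicator (fun _ => 1) x‖ₑ ≤
        ((t x : ℝ≥0∞) - F.indicator 1 x) + (P \ F).indicator 1 x := by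
      intro x
      rw [BLip.mk'_apply]
      by_cases hxF : x ∈ F
      · have h1 : t x = 1 := thickenedIndicator_one (δpos n) F hxF
        simp [h1, hFP hxF]
      · by_cases hxP : x ∈ P
        · simp only [hxP, hxF, Set.indicator_of_mem, Set.indicator_of_notMem, not_false_eq_true,
            Set.mem_sdiff, and_self, tsub_zero, Pi.one_apply]
          refine le_trans ?_ (le_add_left le_rfl)
          rw [← ofReal_norm, Real.norm_eq_abs, ← ENNReal.ofReal_one]
          refine ENNReal.ofReal_le_ofReal (abs_le.2 ⟨?_, ?_⟩)
          · linarith [(t x).2]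
          · have : (t x : ℝ) ≤ 1 := by exact_mod_cast ht1 x
            linarith
        · simp [hxP, hxF]
    refine (lintegral_mono hpt).trans ?_
    rw [lintegral_add_right _ ((measurable_one.indicator (hP.diff hF.measurableSet))),
      lintegral_indicator_one (hP.diff hF.measurableSet),
      lintegral_sub (measurable_one.indicator hF.measurableSet)
        (by rw [lintegral_indicator_one hF.measurableSet]; exact measure_ne_top _ _)
        (ae_of_all _ fun x => ?_), lintegral_indicator_one hF.measurableSet]
    · calc _ ≤ ε / 2 + ε / 2 := add_le_add (tsub_le_iff_left.2 hn.le) hdiff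
        _ = ε := ENNReal.add_halves ε
    · by_cases hxF : x ∈ F
      · have h1 : t x = 1 := thickenedIndicator_one (δpos n) F hxF
        simp [h1, hxF]
      · simp [hxF]

/-- On the support of `f` both measures are finite, and a Hahn set `s` separates the region where
`ν` is the smaller one from the region where `μ` is. Splitting `f` as $gf+(1-g)f$ with `g` Lipschitz
and close to $\chi_s$, the first part is estimated by `ν` and the second by `μ`. The resulting
measure `ρ` lies below both, hence below the infimum. -/
theorem enorm_le_lintegral_inf {ℓ : LipC X →ₗ[ℝ] ℝ} {c : ℝ≥0∞} (hc : c ≠ ∞) {μ ν : Measure X}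
    [IsFiniteMeasureOnCompacts μ] [IsFiniteMeasureOnCompacts ν]
    (hμ : ∀ f, ‖ℓ f‖ₑ ≤ c * ∫⁻ x, ‖f.1 x‖ₑ ∂μ) (hν : ∀ f, ‖ℓ f‖ₑ ≤ c * ∫⁻ x, ‖f.1 x‖ₑ ∂ν)
    (f : LipC X) : ‖ℓ f‖ₑ ≤ c * ∫⁻ x, ‖f.1 x‖ₑ ∂(μ ⊓ ν) := by
  set K := tsupport (f.1 : X → ℝ) with hK
  have hKc : IsCompact K := f.2
  have hKm : MeasurableSet K := hKc.measurableSet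
  have fK : ∀ x ∉ K, f.1 x = 0 := fun x hx => image_eq_zero_of_notMem_tsupport hx
  have : IsFiniteMeasure (μ.restrict K) := ⟨by simpa using hKc.measure_lt_top⟩
  have : IsFiniteMeasure (ν.restrict K) := ⟨by simpa using hKc.measure_lt_top⟩
  have hres : ∀ (h : X → ℝ≥0∞) (η : Measure X), (∀ x ∉ K, h x = 0) →
      ∫⁻ x, h x ∂η = ∫⁻ x, h x ∂(η.restrict K) := fun h η h0 => by
    rw [← lintegral_indicator hKm]
    congr 1
    ext x
    by_cases hx : x ∈ K
    · simp [hx]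
    · simp [hx, h0 x hx]
  obtain ⟨s, hs, h1, h2⟩ := hahn_decomposition (μ.restrict K) (ν.restrict K)
  set ρ : Measure X := (ν.restrict K).restrict s + (μ.restrict K).restrict sᶜ with hρ
  have hρμ : ρ ≤ μ := by
    refine Measure.le_iff.2 fun t ht => ?_
    rw [hρ, Measure.add_apply, Measure.restrict_apply ht, Measure.restrict_apply ht]
    refine (add_le_add (h1 _ (ht.inter hs) Set.inter_subset_right) le_rfl).trans ?_
    rw [← Set.sdiff_eq, measure_inter_add_sdiff _ hs]
    exact Measure.restrict_apply_le _ _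
  have hρν : ρ ≤ ν := by
    refine Measure.le_iff.2 fun t ht => ?_
    rw [hρ, Measure.add_apply, Measure.restrict_apply ht, Measure.restrict_apply ht]
    refine (add_le_add le_rfl (h2 _ (ht.inter hs.compl) Set.inter_subset_right)).trans ?_
    rw [← Set.sdiff_eq, measure_inter_add_sdiff _ hs]
    exact Measure.restrict_apply_le _ _
  refine le_trans ?_ (mul_le_mul_right (lintegral_mono' (le_inf hρμ hρν) le_rfl) c)
  set M : ℝ≥0∞ := ENNReal.ofReal ‖f.1‖ with hM
  have fM : ∀ x, ‖f.1 x‖ₑ ≤ M := fun x => by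
    rw [← ofReal_norm]
    exact ENNReal.ofReal_le_ofReal (f.1.abs_le_norm x)
  refine ENNReal.le_of_forall_pos_le_add fun ε hε hfin => ?_
  -- The total error is `c * M` times the error in approximating the indicator of `s`; adding one
  -- avoids a division by zero.
  have hpos : (ε : ℝ≥0∞) / (c * M + 1) ≠ 0 := by
    refine (ENNReal.div_pos (by exact_mod_cast hε.ne') ?_).ne'
    exact ENNReal.add_ne_top.2 ⟨ENNReal.mul_ne_top hc ENNReal.ofReal_ne_top, ENNReal.one_ne_top⟩
  obtain ⟨g, hg, hgi⟩ := lintegral_mul_indicator_sub_le (ρ := μ.restrict K + ν.restrict K) hs hpos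
  rw [lintegral_add_measure] at hgi
  set I : X → ℝ≥0∞ := fun x => ‖g x - s.indicator (fun _ => 1) x‖ₑ with hI
  have hIm : Measurable I :=
    ((g.continuous.measurable.sub (measurable_const.indicator hs))).enorm
  have hfm : Measurable fun x => ‖f.1 x‖ₑ := f.1.continuous.measurable.enorm
  have b1 : ‖ℓ (LipC.mul f g)‖ₑ ≤
      c * (∫⁻ x in s, ‖f.1 x‖ₑ ∂(ν.restrict K) + M * ∫⁻ x, I x ∂(ν.restrict K)) := by
    refine (hν _).trans (mul_le_mul_right ?_ c)
    rw [hres _ ν fun x hx => by simp [fK x hx], ← lintegral_indicator hs,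
      ← lintegral_const_mul _ hIm, ← lintegral_add_left (hfm.indicator hs)]
    refine lintegral_mono fun x => ?_
    rw [LipC.mul_apply, enorm_mul]
    by_cases hx : x ∈ s
    · rw [Set.indicator_of_mem hx]
      refine le_trans ?_ (le_add_right le_rfl)
      refine mul_le_of_le_one_left' ?_
      rw [← ofReal_norm, Real.norm_eq_abs, abs_of_nonneg (hg x).1]
      exact ENNReal.ofReal_le_one.2 (hg x).2
    · simp only [hI, hx, Set.indicator_of_notMem, not_false_eq_true, sub_zero, zero_add]
      rw [mul_comm]
      exact mul_le_mul_left (fM x) _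
  have b2 : ‖ℓ (f - LipC.mul f g)‖ₑ ≤
      c * (∫⁻ x in sᶜ, ‖f.1 x‖ₑ ∂(μ.restrict K) + M * ∫⁻ x, I x ∂(μ.restrict K)) := by
    have hval : ∀ x, (f - LipC.mul f g).1 x = (1 - g x) * f.1 x := fun x => by
      have : (f - LipC.mul f g).1 = f.1 + (-1 : ℝ) • (LipC.mul f g).1 := by simp [sub_eq_add_neg]
      rw [this, BLip.add_apply, BLip.smul_apply, LipC.mul_apply]; ring
    refine (hμ _).trans (mul_le_mul_right ?_ c)
    simp_rw [hval]
    rw [hres _ μ fun x hx => by simp [fK x hx], ← lintegral_indicator hs.compl,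
      ← lintegral_const_mul _ hIm, ← lintegral_add_left (hfm.indicator hs.compl)]
    refine lintegral_mono fun x => ?_
    rw [enorm_mul]
    by_cases hx : x ∈ s
    · have e : ‖1 - g x‖ₑ = I x := by
        simp only [hI, hx, Set.indicator_of_mem]
        rw [← enorm_neg, neg_sub]
      rw [e, mul_comm]
      exact (mul_le_mul_left (fM x) _).trans (le_add_left le_rfl)
    · rw [Set.indicator_of_mem (by exact hx : x ∈ sᶜ)]
      refine le_trans ?_ (le_add_right le_rfl)
      refine mul_le_of_le_one_left' ?_
      rw [← ofReal_norm, Real.norm_eq_abs, abs_of_nonneg (by linarith [(hg x).2])]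
      exact ENNReal.ofReal_le_one.2 (by linarith [(hg x).1])
  calc ‖ℓ f‖ₑ = ‖ℓ (LipC.mul f g) + ℓ (f - LipC.mul f g)‖ₑ := by rw [← map_add]; simp
    _ ≤ ‖ℓ (LipC.mul f g)‖ₑ + ‖ℓ (f - LipC.mul f g)‖ₑ := enorm_add_le _ _
    _ ≤ _ := add_le_add b1 b2
    _ = c * ∫⁻ x, ‖f.1 x‖ₑ ∂ρ +
        c * M * (∫⁻ x, I x ∂(μ.restrict K) + ∫⁻ x, I x ∂(ν.restrict K)) := by
      rw [hρ, lintegral_add_measure]; ring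
    _ ≤ c * ∫⁻ x, ‖f.1 x‖ₑ ∂ρ + ε := by
      refine add_le_add le_rfl ((mul_le_mul_right hgi _).trans ?_)
      refine le_trans ?_ (ENNReal.mul_div_le (a := c * M + 1) (b := ε))
      exact mul_le_mul_left le_self_add _

theorem lintegral_cc_ne_top (f : C_c(X, ℝ≥0)) (μ : Measure X) [IsFiniteMeasureOnCompacts μ] :
    ∫⁻ x, f x ∂μ ≠ ∞ := by
  have h : Integrable (fun x => (f x : ℝ)) μ :=
    Continuous.integrable_of_hasCompactSupport (by fun_prop)
      (HasCompactSupport.comp_left f.hasCompactSupport rfl)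
  have := h.2
  simpa [HasFiniteIntegral] using this.ne

variable [LocallyCompactSpace X]

/-- Urysohn functions between a compact set and an open set compare the measures on open sets, by
inner regularity of `μ`; outer regularity of `ν` then passes to arbitrary sets. -/
theorem measure_le_of_lintegral_le {μ ν : Measure X} [μ.Regular] [ν.OuterRegular]
    (h : ∀ f : C_c(X, ℝ≥0), ∫⁻ x, f x ∂μ ≤ ∫⁻ x, f x ∂ν) : μ ≤ ν := by
  have hU : ∀ U : Set X, IsOpen U → μ U ≤ ν U := by
    intro U hU
    rw [hU.measure_eq_iSup_isCompact]
    refine iSup₂_le fun K hKU => iSup_le fun hK => ?_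
    obtain ⟨f, hf1, hf2, hf3⟩ := exists_continuousMap_one_of_isCompact_subset_isOpen hK hU hKU
    have hcs : HasCompactSupport fun x => (f x).toNNReal :=
      HasCompactSupport.comp_left (g := Real.toNNReal) hf2 (by simp)
    let F : C_c(X, ℝ≥0) := ⟨⟨fun x => (f x).toNNReal, by fun_prop⟩, hcs⟩
    calc μ K = ∫⁻ x, K.indicator 1 x ∂μ := (lintegral_indicator_one hK.measurableSet).symm
      _ ≤ ∫⁻ x, F x ∂μ := by
        refine lintegral_mono fun x => ?_
        refine Set.indicator_le (g := fun x => (F x : ℝ≥0∞)) (fun x hx => ?_) x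
        have h1 : f x = 1 := hf1 hx
        change (1 : ℝ≥0∞) ≤ ((f x).toNNReal : ℝ≥0∞)
        rw [h1]; simp
      _ ≤ ∫⁻ x, F x ∂ν := h F
      _ ≤ ∫⁻ x, U.indicator 1 x ∂ν := by
        refine lintegral_mono fun x => ?_
        change ((f x).toNNReal : ℝ≥0∞) ≤ _
        by_cases hx : x ∈ U
        · rw [Set.indicator_of_mem hx]
          have h1 := (hf3.2 x).2
          simpa using h1
        · have : f x = 0 := image_eq_zero_of_notMem_tsupport fun h' => hx (hf3.1 h')
          simp [this]
      _ = ν U := lintegral_indicator_one hU.measurableSet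
  intro s
  rw [Set.measure_eq_iInf_isOpen s ν]
  exact le_iInf₂ fun U hsU => le_iInf fun hUo => (measure_mono hsU).trans (hU U hUo)

/-- The nonnegative function `|f|`, as a continuous function with compact support. -/
def LipC.nnabs (f : LipC X) : C_c(X, ℝ≥0) :=
  ⟨⟨fun x => ‖f.1 x‖₊, f.1.continuous.nnnorm⟩, HasCompactSupport.comp_left (g := fun t => ‖t‖₊)
    f.2 (by simp)⟩

/-- An additive functional on `C_c(X, ℝ≥0)` which is given by integrals is represented by a regular
measure. -/
theorem exists_regular_of_additive (L : C_c(X, ℝ≥0) → ℝ≥0∞) (h0 : ∀ f, L f ≠ ∞)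
    (hadd : ∀ f g, L (f + g) = L f + L g) (hsmul : ∀ (a : ℝ≥0) f, L (a • f) = a * L f) :
    ∃ m : Measure X, m.Regular ∧ ∀ f, ∫⁻ x, f x ∂m = L f := by
  let Λ : C_c(X, ℝ≥0) →ₗ[ℝ≥0] ℝ≥0 :=
    { toFun := fun f => (L f).toNNReal
      map_add' := fun f g => by rw [hadd, ENNReal.toNNReal_add (h0 f) (h0 g)]
      map_smul' := fun a f => by rw [hsmul, ENNReal.toNNReal_mul]; simp }
  refine ⟨NNRealRMK.rieszMeasure Λ, NNRealRMK.rieszMeasure_regular Λ, fun f => ?_⟩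
  exact (NNRealRMK.lintegral_rieszMeasure Λ f).trans (ENNReal.coe_toNNReal (h0 f))

/-- The competitors are directed downwards, and along a directed family the infimum of the integrals
of $C_c$ functions is still additive. The Riesz measure of this infimum inherits the mass bound,
since a finite factor commutes with the infimum, and lies below every competitor by regularity. -/
theorem isLeast_mass {T : Current k X} (hT : T.LocallyFiniteMass) :
    IsLeast {μ : Measure X | μ.Regular ∧ T.MassBound μ} T.mass := by
  set S := {μ : Measure X | μ.Regular ∧ T.MassBound μ} with hS
  -- `T.mass` is an infimum in the lattice of all measures, so it is identified with the least
  -- competitor as soon as there is one.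
  suffices h : ∃ m, IsLeast S m by
    obtain ⟨m, hm⟩ := h
    have : T.mass = m := hm.isGLB.sInf_eq
    rwa [this]
  obtain ⟨μ₀, hμ₀⟩ := hT
  have hadd' : ∀ (η : Measure X) (f g : C_c(X, ℝ≥0)),
      ∫⁻ x, (f + g) x ∂η = ∫⁻ x, f x ∂η + ∫⁻ x, g x ∂η := fun η f g => by
    rw [← lintegral_add_left (by fun_prop)]
    simp
  have hsmul' : ∀ (η : Measure X) (a : ℝ≥0) (f : C_c(X, ℝ≥0)),
      ∫⁻ x, (a • f) x ∂η = a * ∫⁻ x, f x ∂η := fun η a f => by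
    rw [← lintegral_const_mul _ (by fun_prop)]
    simp
  have hfin : ∀ μ ∈ S, IsFiniteMeasureOnCompacts μ := fun μ hμ => by
    have := hμ.1; infer_instance
  have hdir : ∀ μ ∈ S, ∀ ν ∈ S, ∃ ρ ∈ S, ρ ≤ μ ∧ ρ ≤ ν := by
    intro μ hμ ν hν
    have := hμ.1
    have := hν.1
    have : IsFiniteMeasureOnCompacts (μ ⊓ ν) :=
      ⟨fun K hK => (Measure.le_iff'.1 inf_le_left K).trans_lt hK.measure_lt_top⟩
    -- Regularity of `μ ⊓ ν` is not checked; it is replaced by the regular measure with the same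
    -- integrals of $C_c$ functions.
    obtain ⟨ρ, hρ, hint⟩ := exists_regular_of_additive (fun f : C_c(X, ℝ≥0) => ∫⁻ x, f x ∂(μ ⊓ ν))
      (fun f => lintegral_cc_ne_top f _) (hadd' _) (hsmul' _)
    refine ⟨ρ, ⟨hρ, massBound_iff.2 fun f π => ?_⟩,
      measure_le_of_lintegral_le fun f => ?_, measure_le_of_lintegral_le fun f => ?_⟩
    · rw [show ∫⁻ x, ‖f.1 x‖ₑ ∂ρ = ∫⁻ x, ‖f.1 x‖ₑ ∂(μ ⊓ ν) from hint (LipC.nnabs f)]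
      let ℓ : LipC X →ₗ[ℝ] ℝ :=
        { toFun := fun f => T.toMap f π
          map_add' := fun f g => by simp
          map_smul' := fun a f => by simp }
      exact enorm_le_lintegral_inf (ℓ := ℓ) ENNReal.ofReal_ne_top
        (fun f => massBound_iff.1 hμ.2 f π) (fun f => massBound_iff.1 hν.2 f π) f
    · rw [hint]; exact lintegral_mono' inf_le_left le_rfl
    · rw [hint]; exact lintegral_mono' inf_le_right le_rfl
  have : Nonempty S := ⟨⟨μ₀, hμ₀⟩⟩
  obtain ⟨m, hm, hint⟩ := exists_regular_of_additive
    (fun f : C_c(X, ℝ≥0) => ⨅ μ : S, ∫⁻ x, f x ∂μ.1)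
    (fun f => by
      have := hfin μ₀ hμ₀
      exact ((iInf_le _ ⟨μ₀, hμ₀⟩).trans_lt (lintegral_cc_ne_top f μ₀).lt_top).ne)
    (fun f g => by
      simp_rw [hadd']
      -- Additivity of the infimum is where directedness enters: nearly optimal measures for `f` and
      -- for `g` are replaced by a common smaller one.
      refine (ENNReal.iInf_add_iInf fun μ ν => ?_).symm
      obtain ⟨ρ, hρ, h1, h2⟩ := hdir μ μ.2 ν ν.2
      exact ⟨⟨ρ, hρ⟩, add_le_add (lintegral_mono' h1 le_rfl) (lintegral_mono' h2 le_rfl)⟩)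
    (fun a f => by
      simp_rw [hsmul']
      rw [ENNReal.mul_iInf fun h => absurd h ENNReal.coe_ne_top])
  refine ⟨m, ⟨hm, massBound_iff.2 fun f π => ?_⟩, fun μ hμ => ?_⟩
  · rw [show ∫⁻ x, ‖f.1 x‖ₑ ∂m = ⨅ μ : S, ∫⁻ x, ‖f.1 x‖ₑ ∂μ.1 from hint (LipC.nnabs f),
      ENNReal.mul_iInf fun h => absurd h ENNReal.ofReal_ne_top]
    refine le_iInf fun μ => ?_
    have := hfin μ μ.2
    exact massBound_iff.1 μ.2.2 f π
  · have := hμ.1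
    refine measure_le_of_lintegral_le fun f => ?_
    rw [hint]
    exact iInf_le (fun μ : S => ∫⁻ x, f x ∂μ.1) ⟨μ, hμ⟩

end mass

/-! ### The extension of a current to integrable functions -/

section borelExt

variable {X : Type u} [MetricSpace X] [LocallyCompactSpace X] [MeasurableSpace X] [BorelSpace X]
  {k : ℕ} {T : Current k X}

theorem Current.LocallyFiniteMass.regular (hT : T.LocallyFiniteMass) : T.mass.Regular :=
  (isLeast_mass hT).1.1

theorem Current.LocallyFiniteMass.massBound (hT : T.LocallyFiniteMass) : T.MassBound T.mass :=
  (isLeast_mass hT).1.2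

/-- The product of the global Lipschitz constants. -/
def lipProd (π : Fin k → BLip X) : ℝ := ∏ i, lipOn (π i : X → ℝ) Set.univ

omit [LocallyCompactSpace X] [MeasurableSpace X] [BorelSpace X] in
theorem lipProd_nonneg (π : Fin k → BLip X) : 0 ≤ lipProd π :=
  Finset.prod_nonneg fun _ _ => lipOn_nonneg _ _

theorem Current.LocallyFiniteMass.abs_sub_le (hT : T.LocallyFiniteMass) (f g : LipC X)
    (π : Fin k → BLip X) :
    |T.toMap f π - T.toMap g π| ≤ lipProd π * ∫ x, |f.1 x - g.1 x| ∂T.mass := by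
  have := hT.massBound (f - g) π
  rw [map_sub] at this
  have e : ∀ x, (f - g).1 x = f.1 x - g.1 x := fun x => by
    have : (f - g).1 = f.1 + (-1 : ℝ) • g.1 := by simp [sub_eq_add_neg]
    rw [this, BLip.add_apply, BLip.smul_apply]; ring
  simp_rw [e] at this
  exact this

/-- Density of $\mathrm{LIP}_c$ in $L^1$ makes the filter in the definition nontrivial, and the mass
bound makes the values of `T` Cauchy along it. The limit therefore exists, and the inequality passes
to it. The algebraic properties of `borelExt` below are all deduced from this inequality by
approximation. -/
theorem Current.LocallyFiniteMass.abs_sub_borelExt_le (hT : T.LocallyFiniteMass) {g : X → ℝ}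
    (hg : Integrable g T.mass) (f : LipC X) (π : Fin k → BLip X) :
    |T.toMap f π - T.borelExt g π| ≤ lipProd π * ∫ x, |f.1 x - g x| ∂T.mass := by
  have := hT.regular
  set μ := T.mass with hμ
  set F : Filter (LipC X) := comap (fun h : LipC X => ∫⁻ x, ‖h.1 x - g x‖ₑ ∂μ) (𝓝 0) with hF
  have hint : ∀ h : LipC X, Integrable (fun x => h.1 x - g x) μ := fun h =>
    (LipC.integrable h μ).sub hg
  have hreal : ∀ h : LipC X, ∫⁻ x, ‖h.1 x - g x‖ₑ ∂μ = ENNReal.ofReal (∫ x, |h.1 x - g x| ∂μ) :=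
    fun h => (ofReal_integral_norm_eq_lintegral_enorm (hint h)).symm
  have hlim : Tendsto (fun h : LipC X => ∫ x, |h.1 x - g x| ∂μ) F (𝓝 0) := by
    have h1 : Tendsto (fun h : LipC X => ∫⁻ x, ‖h.1 x - g x‖ₑ ∂μ) F (𝓝 0) := tendsto_comap
    have h2 := (ENNReal.tendsto_toReal ENNReal.zero_ne_top).comp h1
    refine h2.congr fun h => ?_
    simp only [Function.comp, hreal]
    exact ENNReal.toReal_ofReal (integral_nonneg fun _ => abs_nonneg _)
  have hne : F.NeBot := by
    refine comap_neBot fun t ht => ?_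
    obtain ⟨ε, hε, hεt⟩ := ENNReal.nhds_zero_basis.mem_iff.1 ht
    obtain ⟨r, hr, hrε⟩ := ENNReal.lt_iff_exists_nnreal_btwn.1 hε
    have hr0 : (0 : ℝ) < r := by exact_mod_cast hr
    obtain ⟨h, hh⟩ := exists_lipC_integral_le hg hr0
    refine ⟨h, hεt ?_⟩
    change ∫⁻ x, ‖h.1 x - g x‖ₑ ∂μ < ε
    rw [hreal]
    exact (ENNReal.ofReal_le_ofReal hh).trans_lt (by simpa using hrε)
  have htri : ∀ h h' : LipC X, ∫ x, |h.1 x - h'.1 x| ∂μ ≤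
      ∫ x, |h.1 x - g x| ∂μ + ∫ x, |h'.1 x - g x| ∂μ := fun h h' => by
    rw [← integral_add (hint h).abs (hint h').abs]
    refine integral_mono (((LipC.integrable h μ).sub (LipC.integrable h' μ)).abs)
      ((hint h).abs.add (hint h').abs) fun x => ?_
    have e : h.1 x - h'.1 x = (h.1 x - g x) - (h'.1 x - g x) := by ring
    change |h.1 x - h'.1 x| ≤ _
    rw [e]
    exact abs_sub _ _
  have hcau : Cauchy (map (fun h => T.toMap h π) F) := by
    refine Metric.cauchy_iff.2 ⟨hne.map _, fun ε hε => ?_⟩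
    have hL := lipProd_nonneg π
    set δ := ε / (2 * (lipProd π + 1)) with hδ
    have hδ0 : 0 < δ := by positivity
    have hs : {h : LipC X | ∫ x, |h.1 x - g x| ∂μ < δ} ∈ F := hlim.eventually (gt_mem_nhds hδ0)
    refine ⟨_, image_mem_map hs, ?_⟩
    rintro _ ⟨h, hh, rfl⟩ _ ⟨h', hh', rfl⟩
    simp only [Set.mem_ofPred_eq] at hh hh'
    rw [Real.dist_eq]
    calc _ ≤ lipProd π * ∫ x, |h.1 x - h'.1 x| ∂μ := hT.abs_sub_le h h' π
      _ ≤ lipProd π * (δ + δ) := mul_le_mul_of_nonneg_left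
        ((htri h h').trans (add_le_add hh.le hh'.le)) hL
      _ < (lipProd π + 1) * (δ + δ) := by nlinarith
      _ = ε := by rw [hδ]; field_simp; ring
  obtain ⟨c, hc⟩ := CompleteSpace.complete hcau
  have hB : Tendsto (fun h => T.toMap h π) F (𝓝 (T.borelExt g π)) :=
    tendsto_nhds_limUnder ⟨c, hc⟩
  have h1 : Tendsto (fun h => |T.toMap f π - T.toMap h π|) F (𝓝 |T.toMap f π - T.borelExt g π|) :=
    (tendsto_const_nhds.sub hB).abs
  have h2 : Tendsto (fun h : LipC X => lipProd π * (∫ x, |f.1 x - g x| ∂μ +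
      ∫ x, |h.1 x - g x| ∂μ)) F (𝓝 (lipProd π * (∫ x, |f.1 x - g x| ∂μ + 0))) :=
    tendsto_const_nhds.mul (tendsto_const_nhds.add hlim)
  rw [add_zero] at h2
  exact le_of_tendsto_of_tendsto' h1 h2 fun h => (hT.abs_sub_le f h π).trans
    (mul_le_mul_of_nonneg_left (htri f h) (lipProd_nonneg π))

theorem eq_of_forall_abs_sub_le {a b C : ℝ} (h : ∀ ε > 0, |a - b| ≤ C * ε) : a = b := by
  by_contra hab
  have h0 : 0 < |a - b| := abs_pos.2 (sub_ne_zero.2 hab)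
  have h1 := h (|a - b| / (2 * (|C| + 1))) (by positivity)
  have h2 : C * (|a - b| / (2 * (|C| + 1))) ≤ (|C| + 1) * (|a - b| / (2 * (|C| + 1))) :=
    mul_le_mul_of_nonneg_right (by linarith [le_abs_self C]) (by positivity)
  have h3 : (|C| + 1) * (|a - b| / (2 * (|C| + 1))) = |a - b| / 2 := by field_simp
  linarith

variable (hT : T.LocallyFiniteMass)
include hT

theorem Current.LocallyFiniteMass.borelExt_coe (f : LipC X) (π : Fin k → BLip X) :
    T.borelExt (f.1 : X → ℝ) π = T.toMap f π := by
  have := hT.regular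
  have h := hT.abs_sub_borelExt_le (LipC.integrable f T.mass) f π
  simp only [sub_self, abs_zero, integral_zero, mul_zero] at h
  exact (sub_eq_zero.1 (abs_nonpos_iff.1 h)).symm

theorem Current.LocallyFiniteMass.abs_borelExt_le {g : X → ℝ} (hg : Integrable g T.mass)
    (π : Fin k → BLip X) : |T.borelExt g π| ≤ lipProd π * ∫ x, |g x| ∂T.mass := by
  have h := hT.abs_sub_borelExt_le hg 0 π
  simpa using h

theorem Current.LocallyFiniteMass.borelExt_add {g h : X → ℝ} (hg : Integrable g T.mass)
    (hh : Integrable h T.mass) (π : Fin k → BLip X) :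
    T.borelExt (fun x => g x + h x) π = T.borelExt g π + T.borelExt h π := by
  have := hT.regular
  refine eq_of_forall_abs_sub_le (C := lipProd π * 4) fun ε hε => ?_
  obtain ⟨p, hp⟩ := exists_lipC_integral_le hg hε
  obtain ⟨q, hq⟩ := exists_lipC_integral_le hh hε
  have h1 := hT.abs_sub_borelExt_le hg p π
  have h2 := hT.abs_sub_borelExt_le hh q π
  have h3 := hT.abs_sub_borelExt_le (hg.add hh) (p + q) π
  have h4 : ∫ x, |(p + q).1 x - (g + h) x| ∂T.mass ≤ ε + ε := by
    refine le_trans ?_ (add_le_add hp hq)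
    have ip := ((LipC.integrable p T.mass).sub hg).abs
    have iq := ((LipC.integrable q T.mass).sub hh).abs
    refine (integral_mono (((LipC.integrable (p + q) T.mass).sub (hg.add hh)).abs)
      (ip.add iq) fun x => ?_).trans (integral_add ip iq).le
    change |p.1 x + q.1 x - (g x + h x)| ≤ |p.1 x - g x| + |q.1 x - h x|
    rw [add_sub_add_comm]
    exact abs_add_le _ _
  rw [map_add, add_apply] at h3
  have hL := lipProd_nonneg π
  have e1 := mul_le_mul_of_nonneg_left hp hL
  have e2 := mul_le_mul_of_nonneg_left hq hL
  have e3 := mul_le_mul_of_nonneg_left h4 hL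
  have h3' : |T.toMap p π + T.toMap q π - T.borelExt (fun x => g x + h x) π| ≤ _ := h3
  rw [abs_le] at *
  constructor <;> linarith

theorem Current.LocallyFiniteMass.borelExt_smul (a : ℝ) {g : X → ℝ} (hg : Integrable g T.mass)
    (π : Fin k → BLip X) : T.borelExt (fun x => a * g x) π = a * T.borelExt g π := by
  have := hT.regular
  refine eq_of_forall_abs_sub_le (C := lipProd π * (2 * |a|)) fun ε hε => ?_
  obtain ⟨p, hp⟩ := exists_lipC_integral_le hg hε
  have h1 := hT.abs_sub_borelExt_le hg p π
  have h3 := hT.abs_sub_borelExt_le (hg.const_mul a) (a • p) π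
  have h4 : ∫ x, |(a • p).1 x - a * g x| ∂T.mass ≤ |a| * ε := by
    refine le_trans (le_of_eq ?_) (mul_le_mul_of_nonneg_left hp (abs_nonneg a))
    rw [← integral_const_mul]
    congr 1
    ext x
    rw [← abs_mul, mul_sub]
    rfl
  rw [map_smul, smul_apply, smul_eq_mul] at h3
  have hL := lipProd_nonneg π
  have e1 := mul_le_mul_of_nonneg_left hp hL
  have e3 := mul_le_mul_of_nonneg_left h4 hL
  have e5 := mul_le_mul_of_nonneg_left (h1.trans e1) (abs_nonneg a)
  rw [← abs_mul, mul_sub] at e5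
  rw [abs_le] at *
  constructor <;> nlinarith

theorem Current.LocallyFiniteMass.borelExt_sub {g h : X → ℝ} (hg : Integrable g T.mass)
    (hh : Integrable h T.mass) (π : Fin k → BLip X) :
    T.borelExt (fun x => g x - h x) π = T.borelExt g π - T.borelExt h π := by
  have e := hT.borelExt_add hg (hh.const_mul (-1)) π
  rw [hT.borelExt_smul _ hh] at e
  have e2 : (fun x => g x - h x) = fun x => g x + -1 * h x := by
    ext x; ring
  rw [e2, e]; ring

theorem Current.LocallyFiniteMass.borelExt_update_add {g : X → ℝ} (hg : Integrable g T.mass)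
    (π : Fin k → BLip X) (i : Fin k) (a b : BLip X) :
    T.borelExt g (Function.update π i (a + b)) =
      T.borelExt g (Function.update π i a) + T.borelExt g (Function.update π i b) := by
  have := hT.regular
  refine eq_of_forall_abs_sub_le (C := lipProd (Function.update π i (a + b)) +
    lipProd (Function.update π i a) + lipProd (Function.update π i b)) fun ε hε => ?_
  obtain ⟨p, hp⟩ := exists_lipC_integral_le hg hε
  have h1 := (hT.abs_sub_borelExt_le hg p (Function.update π i (a + b))).trans
    (mul_le_mul_of_nonneg_left hp (lipProd_nonneg _))
  have h2 := (hT.abs_sub_borelExt_le hg p (Function.update π i a)).trans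
    (mul_le_mul_of_nonneg_left hp (lipProd_nonneg _))
  have h3 := (hT.abs_sub_borelExt_le hg p (Function.update π i b)).trans
    (mul_le_mul_of_nonneg_left hp (lipProd_nonneg _))
  rw [MultilinearMap.map_update_add] at h1
  rw [abs_le] at *
  constructor <;> linarith

theorem Current.LocallyFiniteMass.borelExt_update_smul {g : X → ℝ} (hg : Integrable g T.mass)
    (π : Fin k → BLip X) (i : Fin k) (c : ℝ) (a : BLip X) :
    T.borelExt g (Function.update π i (c • a)) = c * T.borelExt g (Function.update π i a) := by
  have := hT.regular
  refine eq_of_forall_abs_sub_le (C := lipProd (Function.update π i (c • a)) +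
    |c| * lipProd (Function.update π i a)) fun ε hε => ?_
  obtain ⟨p, hp⟩ := exists_lipC_integral_le hg hε
  have h1 := (hT.abs_sub_borelExt_le hg p (Function.update π i (c • a))).trans
    (mul_le_mul_of_nonneg_left hp (lipProd_nonneg _))
  have h2 := (hT.abs_sub_borelExt_le hg p (Function.update π i a)).trans
    (mul_le_mul_of_nonneg_left hp (lipProd_nonneg _))
  have h3 := mul_le_mul_of_nonneg_left h2 (abs_nonneg c)
  rw [← abs_mul, mul_sub] at h3
  rw [MultilinearMap.map_update_smul, smul_eq_mul] at h1
  rw [abs_le] at *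
  constructor <;> nlinarith

/-- The Lipschitz constants are bounded along the sequence, so replacing `g` by a nearby function in
$\mathrm{LIP}_c$ costs a small amount uniformly in `n`; sequential continuity of `T` handles the
fixed replacement. -/
theorem Current.LocallyFiniteMass.tendsto_borelExt {g : X → ℝ} (hg : Integrable g T.mass)
    {π : ℕ → Fin k → BLip X} {π₀ : Fin k → BLip X} (hπ : ∀ i, BLip.SeqConv (fun n => π n i) (π₀ i)) :
    Tendsto (fun n => T.borelExt g (π n)) atTop (𝓝 (T.borelExt g π₀)) := by
  have := hT.regular
  choose C hC using fun i => (hπ i).1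
  set L := ∏ i, C i with hL
  have hCn : ∀ n, lipProd (π n) ≤ L := fun n =>
    Finset.prod_le_prod (fun _ _ => lipOn_nonneg _ _) fun i _ => hC i n
  have hL0 : 0 ≤ L := (lipProd_nonneg _).trans (hCn 0)
  rw [Metric.tendsto_atTop]
  intro ε hε
  set δ := ε / (2 * (L + lipProd π₀ + 1)) with hδ
  have hp0 := lipProd_nonneg π₀
  have hδ0 : 0 < δ := by positivity
  obtain ⟨p, hp⟩ := exists_lipC_integral_le hg hδ0
  have hconst : LipC.SeqConv (fun _ => p) p := by
    refine ⟨⟨_, fun _ => le_rfl⟩, ?_, fun u hu => Eventually.of_forall fun _ _ => refl_mem_uniformity hu⟩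
    simp only [Set.iUnion_const]
    rw [(isClosed_tsupport _).closure_eq]
    exact p.2
  have ht := T.seqCont (fun _ => p) p π π₀ hconst hπ
  obtain ⟨N, hN⟩ := Metric.tendsto_atTop.1 ht (ε / 2) (half_pos hε)
  refine ⟨N, fun n hn => ?_⟩
  have h1 := (hT.abs_sub_borelExt_le hg p (π n)).trans
    ((mul_le_mul_of_nonneg_left hp (lipProd_nonneg _)).trans
      (mul_le_mul_of_nonneg_right (hCn n) hδ0.le))
  have h2 := (hT.abs_sub_borelExt_le hg p π₀).trans (mul_le_mul_of_nonneg_left hp hp0)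
  have h3 := hN n hn
  have h4 : (L + lipProd π₀) * δ < ε / 2 := by
    have : (L + lipProd π₀ + 1) * δ = ε / 2 := by rw [hδ]; field_simp
    nlinarith
  rw [Real.dist_eq] at h3 ⊢
  have e := abs_lt.1 h3
  rw [abs_le] at h1 h2
  rw [abs_lt]
  constructor <;> nlinarith [e.1, e.2]

end borelExt

/-! ### Extension of Lipschitz functions and strict locality -/

section locality

variable {X : Type u} [MetricSpace X]

/-- McShane extension, followed by truncation at `±M`, which does not increase the Lipschitz
constant. -/
theorem exists_blip_extension (s : Set X) (h : X → ℝ) {C M : ℝ} (hC : 0 ≤ C) (hM : 0 ≤ M)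
    (h₁ : ∀ x ∈ s, ∀ y ∈ s, |h x - h y| ≤ C * dist x y) (h₂ : ∀ x ∈ s, |h x| ≤ M) :
    ∃ F : BLip X, (∀ x ∈ s, F x = h x) ∧ (∀ x y, |F x - F y| ≤ C * dist x y) ∧
      ∀ x, |F x| ≤ M := by
  have hl : LipschitzOnWith (Real.toNNReal C) h s := by
    refine LipschitzOnWith.of_dist_le_mul fun x hx y hy => ?_
    rw [Real.coe_toNNReal _ hC, Real.dist_eq]
    exact h₁ x hx y hy
  obtain ⟨g, hg, hgs⟩ := hl.extend_real
  have c1 : ∀ x y, |max (-M) (min M (g x)) - max (-M) (min M (g y))| ≤ C * dist x y := by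
    intro x y
    have h3 : |g x - g y| ≤ C * dist x y := by
      have := hg.dist_le_mul x y
      rwa [Real.coe_toNNReal _ hC, Real.dist_eq] at this
    refine le_trans ?_ h3
    refine (abs_max_sub_max_le_max _ _ _ _).trans (max_le (by simp) ?_)
    exact (abs_min_sub_min_le_max _ _ _ _).trans (max_le (by simp) le_rfl)
  have c2 : ∀ x, |max (-M) (min M (g x))| ≤ M := fun x =>
    abs_le.2 ⟨le_max_left _ _, max_le (by linarith) (min_le_left _ _)⟩
  refine ⟨BLip.mk' _ C M c1 c2, fun x hx => ?_, c1, c2⟩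
  have := abs_le.1 (h₂ x hx)
  rw [BLip.mk'_apply, ← hgs hx, min_eq_right this.2, max_eq_right this.1]

theorem BLip.exists_eqOn_lipOn_le (f : BLip X) (A : Set X) :
    ∃ F : BLip X, (∀ x ∈ A, F x = f x) ∧ lipOn (F : X → ℝ) Set.univ ≤ lipOn (f : X → ℝ) A := by
  obtain ⟨F, h1, h2, -⟩ := exists_blip_extension A f (lipOn_nonneg f A) (norm_nonneg f)
    (fun x hx y hy => f.abs_sub_le_lipOn hx hy) fun x _ => f.abs_le_norm x
  exact ⟨F, h1, lipOn_le (lipOn_nonneg _ _) fun x _ y _ => h2 x y⟩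

/-- Truncation: `t ↦ t - max (-ε) (min ε t)`, composed with a Lipschitz function. -/
def BLip.shrink (ε : ℝ) (f : BLip X) : BLip X :=
  BLip.mk' (fun x => f x - max (-ε) (min ε (f x))) (2 * ‖f‖) (2 * ‖f‖ + |ε|) (fun x y => by
    have h1 := f.abs_sub_le_norm x y
    have h2 : |max (-ε) (min ε (f x)) - max (-ε) (min ε (f y))| ≤ |f x - f y| :=
      (abs_max_sub_max_le_max _ _ _ _).trans (max_le (by simp)
        ((abs_min_sub_min_le_max _ _ _ _).trans (max_le (by simp) le_rfl)))
    rw [sub_sub_sub_comm]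
    refine (abs_sub _ _).trans ?_
    linarith) fun x => by
    have h1 := f.abs_le_norm x
    refine (abs_sub _ _).trans ?_
    have h2 : |max (-ε) (min ε (f x))| ≤ |ε| := by
      rw [abs_le]
      constructor
      · exact (neg_le_neg (le_abs_self ε)).trans (le_max_left _ _)
      · exact max_le (neg_le_abs ε) ((min_le_left _ _).trans (le_abs_self ε))
    linarith [norm_nonneg f]

theorem BLip.shrink_apply (ε : ℝ) (f : BLip X) (x : X) :
    BLip.shrink ε f x = f x - max (-ε) (min ε (f x)) := rfl

theorem BLip.seqConv_shrink (f : BLip X) :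
    BLip.SeqConv (fun n : ℕ => BLip.shrink (1 / ((n : ℝ) + 1)) f) f := by
  refine ⟨⟨2 * ‖f‖, fun n => lipOn_le (by positivity) fun x _ y _ => ?_⟩, fun K _ => ?_⟩
  · have h1 := f.abs_sub_le_norm x y
    set ε : ℝ := 1 / ((n : ℝ) + 1)
    have h2 : |max (-ε) (min ε (f x)) - max (-ε) (min ε (f y))| ≤ |f x - f y| :=
      (abs_max_sub_max_le_max _ _ _ _).trans (max_le (by simp)
        ((abs_min_sub_min_le_max _ _ _ _).trans (max_le (by simp) le_rfl)))
    rw [BLip.shrink_apply, BLip.shrink_apply, sub_sub_sub_comm]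
    refine (abs_sub _ _).trans ?_
    linarith
  · rw [Metric.tendstoUniformlyOn_iff]
    intro ε hε
    filter_upwards [tendsto_one_div_add_atTop_nhds_zero_nat.eventually (gt_mem_nhds hε)] with n hn
      x _
    have hp : (0 : ℝ) < 1 / ((n : ℝ) + 1) := Nat.one_div_pos_of_nat
    rw [Real.dist_eq, BLip.shrink_apply, sub_sub_cancel]
    refine lt_of_le_of_lt (abs_le.2 ⟨le_max_left _ _, max_le (by linarith) (min_le_left _ _)⟩) hn

variable [LocallyCompactSpace X] [MeasurableSpace X] [BorelSpace X] {k : ℕ} {T : Current k X}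
  (hT : T.LocallyFiniteMass)
include hT

/-- This upgrades locality from neighbourhoods to the bare zero set of `π i`. A shrunk copy of `π i`
vanishes on the open set where $|\pi_i|<\varepsilon$, and cutoffs of `f` supported inside that set
converge in $L^1$ to $\chi_Af$; axiomatic locality kills each of them. The shrinking is then undone
by sequential continuity. -/
theorem Current.LocallyFiniteMass.borelExt_indicator_zeroSet (f : LipC X) (π : Fin k → BLip X)
    (i : Fin k) : T.borelExt ({x | π i x = 0}.indicator (f.1 : X → ℝ)) π = 0 := by
  have := hT.regular
  set A := {x | π i x = 0} with hA
  have hAm : MeasurableSet A := (isClosed_eq (π i).continuous continuous_const).measurableSet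
  have hfi := LipC.integrable f T.mass
  have hgi : Integrable (A.indicator (f.1 : X → ℝ)) T.mass := hfi.indicator hAm
  -- Equal to one on the zero set of `π i` and vanishing where $|\pi_i|\ge 1/(m+1)$.
  let c : ℕ → BLip X := fun m => BLip.mk' (fun x => max 0 (1 - (m + 1) * |π i x|))
    ((m + 1) * ‖π i‖) 1 (fun x y => by
      refine (abs_max_sub_max_le_max _ _ _ _).trans (max_le (by simp; positivity) ?_)
      rw [sub_sub_sub_cancel_left, ← mul_sub, abs_mul, abs_of_nonneg (by positivity), mul_assoc]
      refine mul_le_mul_of_nonneg_left ?_ (by positivity)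
      refine (abs_abs_sub_abs_le _ _).trans ?_
      rw [abs_sub_comm]
      exact (π i).abs_sub_le_norm x y) fun x => by
      rw [abs_of_nonneg (le_max_left _ _)]
      exact max_le zero_le_one (by
        have : 0 ≤ ((m : ℝ) + 1) * |π i x| := by positivity
        linarith)
  have c0 : ∀ m x, 0 ≤ c m x := fun m x => le_max_left _ _
  have c1 : ∀ m x, c m x ≤ 1 := fun m x => max_le zero_le_one (by
        have : 0 ≤ ((m : ℝ) + 1) * |π i x| := by positivity
        linarith)
  have hdom : Tendsto (fun m => ∫ x, |(LipC.mul f (c m)).1 x - A.indicator (f.1 : X → ℝ) x| ∂T.mass)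
      atTop (𝓝 (∫ _, (0 : ℝ) ∂T.mass)) := by
    refine tendsto_integral_of_dominated_convergence (fun x => 2 * |f.1 x|)
      (fun m => ((LipC.integrable _ _).sub hgi).abs.1) (hfi.abs.const_mul 2)
      (fun m => ae_of_all _ fun x => ?_) (ae_of_all _ fun x => ?_)
    · rw [Real.norm_eq_abs, abs_abs]
      refine (abs_sub _ _).trans ?_
      rw [two_mul]
      refine add_le_add ?_ ?_
      · rw [LipC.mul_apply, abs_mul, abs_of_nonneg (c0 m x)]
        exact mul_le_of_le_one_left (abs_nonneg _) (c1 m x)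
      · by_cases hx : x ∈ A
        · rw [Set.indicator_of_mem hx]
        · rw [Set.indicator_of_notMem hx]; simp
    · refine tendsto_const_nhds.congr' ?_
      by_cases hx : x ∈ A
      · refine Eventually.of_forall fun m => ?_
        have hx' : π i x = 0 := hx
        simp [Set.indicator_of_mem hx, c, hx']
      · have hx' : 0 < |π i x| := abs_pos.2 hx
        obtain ⟨N, hN⟩ := exists_nat_gt (1 / |π i x|)
        filter_upwards [eventually_ge_atTop N] with m hm
        have hm' : (N : ℝ) ≤ m := by exact_mod_cast hm
        rw [div_lt_iff₀ hx'] at hN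
        have : c m x = 0 := max_eq_left (by nlinarith)
        rw [LipC.mul_apply, this, Set.indicator_of_notMem hx]
        simp
  rw [integral_zero] at hdom
  have hshr : ∀ n : ℕ, T.borelExt (A.indicator (f.1 : X → ℝ))
      (Function.update π i (BLip.shrink (1 / ((n : ℝ) + 1)) (π i))) = 0 := by
    intro n
    set ε : ℝ := 1 / ((n : ℝ) + 1) with hε
    have hε0 : 0 < ε := Nat.one_div_pos_of_nat
    set π' := Function.update π i (BLip.shrink ε (π i)) with hπ'
    -- For `m ≥ n + 1` the closed set where $|\pi_i|\le 1/(m+1)$ lies in the open set where the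
    -- shrunk function vanishes.
    have hev : ∀ m : ℕ, n + 1 ≤ m → T.toMap (LipC.mul f (c m)) π' = 0 := by
      intro m hm
      refine T.locality _ _ ⟨i, {x | |π i x| < ε}, 0,
        isOpen_lt (π i).continuous.abs continuous_const, ?_, fun x hx => ?_⟩
      · have hcl : IsClosed {x | |π i x| ≤ 1 / ((m : ℝ) + 1)} :=
          isClosed_le (π i).continuous.abs continuous_const
        refine (closure_minimal ?_ hcl).trans fun x hx => ?_
        · intro x hx
          rw [Function.mem_support, LipC.mul_apply] at hx
          have h1 : c m x ≠ 0 := left_ne_zero_of_mul hx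
          simp only [Set.mem_ofPred_eq]
          rw [le_div_iff₀ (by positivity)]
          by_contra h2
          exact h1 (max_eq_left (by nlinarith))
        · simp only [Set.mem_ofPred_eq] at hx ⊢
          refine lt_of_le_of_lt hx ?_
          have hm' : (n : ℝ) + 1 ≤ m := by exact_mod_cast hm
          exact one_div_lt_one_div_of_lt (by positivity) (by linarith)
      · have hx' := abs_lt.1 (show |π i x| < ε from hx)
        rw [hπ', Function.update_self, BLip.shrink_apply, min_eq_right hx'.2.le,
          max_eq_right hx'.1.le, sub_self]
    have hle : ∀ m : ℕ, n + 1 ≤ m → |T.borelExt (A.indicator (f.1 : X → ℝ)) π'| ≤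
        lipProd π' * ∫ x, |(LipC.mul f (c m)).1 x - A.indicator (f.1 : X → ℝ) x| ∂T.mass := by
      intro m hm
      have := hT.abs_sub_borelExt_le hgi (LipC.mul f (c m)) π'
      rwa [hev m hm, zero_sub, abs_neg] at this
    have hl := hdom.const_mul (lipProd π')
    rw [mul_zero] at hl
    exact abs_nonpos_iff.1 (ge_of_tendsto hl ((eventually_ge_atTop (n + 1)).mono hle))
  have hconv := hT.tendsto_borelExt hgi (π := fun n : ℕ =>
    Function.update π i (BLip.shrink (1 / ((n : ℝ) + 1)) (π i))) (π₀ := π) fun j => by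
      rcases eq_or_ne j i with rfl | hj
      · simpa using BLip.seqConv_shrink (π j)
      · simp only [Function.update_of_ne hj]
        exact ⟨⟨_, fun _ => le_rfl⟩, fun K _ u hu =>
          Eventually.of_forall fun _ _ _ => refl_mem_uniformity hu⟩
  simp_rw [hshr] at hconv
  exact tendsto_nhds_unique hconv tendsto_const_nhds

/-- Cutting an $L^1$-approximation of `g` down to the zero set of `π i` only improves it, because
`g` vanishes elsewhere; the truncated approximations contribute nothing. -/
theorem Current.LocallyFiniteMass.borelExt_eq_zero {g : X → ℝ} (hg : Integrable g T.mass)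
    {π : Fin k → BLip X} {i : Fin k} (h : ∀ x, g x ≠ 0 → π i x = 0) : T.borelExt g π = 0 := by
  have := hT.regular
  set A := {x | π i x = 0} with hA
  have hAm : MeasurableSet A := (isClosed_eq (π i).continuous continuous_const).measurableSet
  refine eq_of_forall_abs_sub_le (C := lipProd π) fun ε hε => ?_
  obtain ⟨f, hf⟩ := exists_lipC_integral_le hg hε
  have hfi : Integrable (A.indicator (f.1 : X → ℝ)) T.mass := (LipC.integrable f T.mass).indicator hAm
  have e := hT.borelExt_sub hg hfi π
  rw [hT.borelExt_indicator_zeroSet f π i] at e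
  rw [← e]
  refine (hT.abs_borelExt_le (hg.sub hfi) π).trans (mul_le_mul_of_nonneg_left ?_ (lipProd_nonneg _))
  refine le_trans (integral_mono (hg.sub hfi).abs
    ((LipC.integrable f T.mass).sub hg).abs fun x => ?_) hf
  change |g x - A.indicator (f.1 : X → ℝ) x| ≤ |f.1 x - g x|
  by_cases hx : x ∈ A
  · rw [Set.indicator_of_mem hx, abs_sub_comm]
  · have : g x = 0 := by
      by_contra h'
      exact hx (h x h')
    rw [Set.indicator_of_notMem hx, this]
    simp

theorem Current.LocallyFiniteMass.borelExt_update_congr {g : X → ℝ} (hg : Integrable g T.mass)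
    (π : Fin k → BLip X) (i : Fin k) {a b : BLip X} (h : ∀ x, g x ≠ 0 → a x = b x) :
    T.borelExt g (Function.update π i a) = T.borelExt g (Function.update π i b) := by
  have e := hT.borelExt_update_add hg π i b (a - b)
  rw [add_sub_cancel] at e
  rw [e, add_eq_left]
  refine hT.borelExt_eq_zero hg (i := i) fun x hx => ?_
  rw [Function.update_self]
  change a x - b x = 0
  rw [h x hx, sub_self]

theorem Current.LocallyFiniteMass.borelExt_congr {g : X → ℝ} (hg : Integrable g T.mass)
    {π π' : Fin k → BLip X} (h : ∀ i x, g x ≠ 0 → π i x = π' i x) :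
    T.borelExt g π = T.borelExt g π' := by
  classical
  have key : ∀ s : Finset (Fin k), T.borelExt g (s.piecewise π' π) = T.borelExt g π := by
    intro s
    induction s using Finset.induction_on with
    | empty => simp
    | insert j s hj ih =>
      rw [Finset.piecewise_insert, ← ih]
      conv_rhs => rw [← Function.update_eq_self j (s.piecewise π' π)]
      refine hT.borelExt_update_congr hg _ j fun x hx => ?_
      rw [Finset.piecewise_eq_of_notMem _ _ _ hj, h j x hx]
  simpa using (key Finset.univ).symm

/-- By strict locality each `π i` may be replaced by an extension of its restriction to `A` whose
global Lipschitz constant is at most that of the restriction. This is what brings the Lipschitz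
constants on small sets into the mass bound. -/
theorem Current.LocallyFiniteMass.abs_borelExt_le_lipOn {g : X → ℝ} (hg : Integrable g T.mass)
    (π : Fin k → BLip X) {A : Set X} (hA : ∀ x, g x ≠ 0 → x ∈ A) :
    |T.borelExt g π| ≤ (∏ i, lipOn (π i : X → ℝ) A) * ∫ x, |g x| ∂T.mass := by
  choose F hF1 hF2 using fun i => (π i).exists_eqOn_lipOn_le A
  rw [hT.borelExt_congr hg (π' := F) fun i x hx => (hF1 i x (hA x hx)).symm]
  refine (hT.abs_borelExt_le hg F).trans (mul_le_mul_of_nonneg_right ?_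
    (integral_nonneg fun _ => abs_nonneg _))
  exact Finset.prod_le_prod (fun _ _ => lipOn_nonneg _ _) fun i _ => hF2 i

end locality

/-! ### Representations of homogeneous polylipschitz functions -/

section representation

variable {k : ℕ} {Y : Type u} [MetricSpace Y]

theorem homKer_zero : homKer k Y 0 = ⊥ := if_pos rfl

theorem homKer_succ (i : Fin k) : homKer k Y i.succ = BLip.const Y := if_neg (Fin.succ_ne_zero i)

/-- The factor two leaves room because the infimum in the quotient norm need not be attained. If the
quotient norm is zero this room disappears, and closedness of the kernel is needed: for the
constants it holds because the oscillation of `f` is that of representatives of arbitrarily small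
norm. -/
theorem HomFactor.exists_lift_norm_le (i : Fin (k + 1)) (q : HomFactor k Y i) :
    ∃ f : BLip Y, (homKer k Y i).mkQL f = q ∧ ‖f‖ ≤ 2 * ‖q‖ := by
  rcases (norm_nonneg q).eq_or_lt with h | h
  · obtain ⟨f, hf⟩ := Submodule.Quotient.mk_surjective _ q
    have key : f ∈ homKer k Y i := by
      have hm : ∀ ε > 0, ∃ m : BLip Y, m - f ∈ homKer k Y i ∧ ‖m‖ < ε := by
        intro ε hε
        obtain ⟨m, hm, hlt⟩ := Submodule.Quotient.norm_mk_lt q hε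
        rw [← h, zero_add] at hlt
        refine ⟨m, ?_, hlt⟩
        rw [← hf] at hm
        exact (Submodule.Quotient.eq _).1 hm
      refine Fin.cases ?_ (fun i => ?_) i (motive := fun i =>
        (∀ ε > 0, ∃ m : BLip Y, m - f ∈ homKer k Y i ∧ ‖m‖ < ε) → f ∈ homKer k Y i) hm
      · intro hm
        rw [homKer_zero] at hm ⊢
        rw [Submodule.mem_bot, ← norm_le_zero_iff]
        refine le_of_forall_pos_le_add fun ε hε => ?_
        obtain ⟨m, h1, h2⟩ := hm ε hε
        rw [Submodule.mem_bot, sub_eq_zero] at h1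
        rw [zero_add, ← h1]
        exact h2.le
      · intro hm
        rw [homKer_succ] at hm ⊢
        have hd : ∀ x y, f x = f y := by
          intro x y
          refine eq_of_forall_abs_sub_le (C := dist x y) fun ε hε => ?_
          obtain ⟨m, ⟨c, hc⟩, h2⟩ := hm ε hε
          have e : f x - f y = m x - m y := by
            have h3 : m x - f x = c := hc x
            have h4 : m y - f y = c := hc y
            linarith
          rw [e, mul_comm]
          exact (m.abs_sub_le_norm x y).trans (mul_le_mul_of_nonneg_right h2.le dist_nonneg)
        rcases isEmpty_or_nonempty Y with hY | ⟨⟨y⟩⟩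
        · exact ⟨0, fun x => isEmptyElim x⟩
        · exact ⟨f y, fun x => hd x y⟩
    refine ⟨0, ?_, by simp [← h]⟩
    rw [map_zero, ← hf]
    exact ((Submodule.Quotient.mk_eq_zero _).2 key).symm
  · obtain ⟨m, hm, hlt⟩ := Submodule.Quotient.norm_mk_lt q h
    exact ⟨m, hm, by linarith⟩

theorem uniformContinuousConstSMul_of_normedSpace (E : Type*) [SeminormedAddCommGroup E]
    [NormedSpace ℝ E] : UniformContinuousConstSMul ℝ E := inferInstance

local instance : UniformContinuousConstSMul ℝ (⨂[ℝ] i : Fin (k + 1), HomFactor k Y i) :=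
  uniformContinuousConstSMul_of_normedSpace (⨂[ℝ] i : Fin (k + 1), HomFactor k Y i)

/-- The simple tensors, as a multilinear map. -/
def HPoly.tensorM (k : ℕ) (Y : Type u) [MetricSpace Y] :
    MultilinearMap ℝ (fun _ : Fin (k + 1) => BLip Y) (HPoly k Y) :=
  (UniformSpace.Completion.toComplL (𝕜 := ℝ)
    (E := ⨂[ℝ] i, HomFactor k Y i)).toLinearMap.compMultilinearMap
    ((PiTensorProduct.tprod ℝ).compLinearMap fun i => (homKer k Y i).mkQL.toLinearMap)

theorem HPoly.tensorM_apply (f : Fin (k + 1) → BLip Y) : HPoly.tensorM k Y f = HPoly.tensor f := rfl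

theorem HPoly.norm_tensor_le (f : Fin (k + 1) → BLip Y) : ‖HPoly.tensor f‖ ≤ ∏ i, ‖f i‖ := by
  unfold HPoly.tensor
  rw [UniformSpace.Completion.norm_coe]
  refine (PiTensorProduct.projectiveSeminorm_tprod_le _).trans
    (Finset.prod_le_prod (fun _ _ => norm_nonneg _) fun i _ => ?_)
  exact Submodule.Quotient.norm_mk_le _ _

theorem Poly.norm_tensor_le (f : Fin (k + 1) → BLip Y) : ‖Poly.tensor f‖ ≤ ∏ i, ‖f i‖ := by
  unfold Poly.tensor
  rw [UniformSpace.Completion.norm_coe]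
  exact PiTensorProduct.projectiveSeminorm_tprod_le _

theorem Poly.toHom_tensor (f : Fin (k + 1) → BLip Y) :
    Poly.toHom k Y (Poly.tensor f) = HPoly.tensor f := by
  simp only [Poly.toHom, Poly.tensor, HPoly.tensor, ContinuousLinearMap.completion_apply_coe,
    PiTensorProduct.mapL_apply, PiTensorProduct.map_tprod]
  rfl

/-- Absolute summability of the products of norms makes the series of simple tensors converge
already before the quotient, so no separate preimage has to be carried along. -/
theorem HPoly.represents_iff {r : ℕ → Fin (k + 1) → BLip Y} {p : HPoly k Y} :
    HPoly.Represents r p ↔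
      (Summable fun j => ∏ i, ‖r j i‖) ∧ HasSum (fun j => HPoly.tensor (r j)) p := by
  constructor
  · rintro ⟨q, rfl, h1, h2⟩
    refine ⟨h1, ?_⟩
    simpa only [Poly.toHom_tensor] using h2.mapL (Poly.toHom k Y)
  · rintro ⟨h1, h2⟩
    have hs : Summable fun j => Poly.tensor (r j) :=
      Summable.of_norm_bounded h1 fun j => Poly.norm_tensor_le _
    refine ⟨_, ?_, h1, hs.hasSum⟩
    have h3 := hs.hasSum.mapL (Poly.toHom k Y)
    simp only [Poly.toHom_tensor] at h3
    exact h3.unique h2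

theorem HPoly.tensor_zero : HPoly.tensor (0 : Fin (k + 1) → BLip Y) = 0 := HPoly.tensor_eq_zero rfl

/-- Reindexing of a countable family of tuples by the natural numbers. -/
def reindex {ι : Type*} [Encodable ι] (r : ι → Fin (k + 1) → BLip Y) : ℕ → Fin (k + 1) → BLip Y :=
  Function.extend Encodable.encode r 0

theorem reindex_encode {ι : Type*} [Encodable ι] (r : ι → Fin (k + 1) → BLip Y) (a : ι) :
    reindex r (Encodable.encode a) = r a := Encodable.encode_injective.extend_apply _ _ _

theorem reindex_of_notMem {ι : Type*} [Encodable ι] (r : ι → Fin (k + 1) → BLip Y) {n : ℕ}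
    (h : n ∉ Set.range (Encodable.encode : ι → ℕ)) : reindex r n = 0 :=
  Function.extend_apply' _ _ _ h

theorem HPoly.represents_reindex {ι : Type*} [Encodable ι] {r : ι → Fin (k + 1) → BLip Y}
    {p : HPoly k Y} (h1 : Summable fun j => ∏ i, ‖r j i‖)
    (h2 : HasSum (fun j => HPoly.tensor (r j)) p) : HPoly.Represents (reindex r) p := by
  have e1 : (fun j => ∏ i, ‖reindex r j i‖) ∘ Encodable.encode = fun j => ∏ i, ‖r j i‖ := by
    funext j
    simp only [Function.comp_apply, reindex_encode]
  have e2 : (fun j => HPoly.tensor (reindex r j)) ∘ Encodable.encode =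
      fun j => HPoly.tensor (r j) := by
    funext j
    simp only [Function.comp_apply, reindex_encode]
  rw [← e1] at h1
  rw [← e2] at h2
  refine HPoly.represents_iff.2 ⟨?_, ?_⟩
  · refine ((Encodable.encode_injective (α := ι)).summable_iff fun n hn => ?_).1 h1
    simp [reindex_of_notMem r hn]
  · refine ((Encodable.encode_injective (α := ι)).hasSum_iff fun n hn => ?_).1 h2
    rw [reindex_of_notMem r hn, HPoly.tensor_zero]

/-- The projective norm is an infimum over finite expressions. Lifting each of the `k + 1` factors
at most doubles its norm, whence the power of two; the scalar coefficient is absorbed into the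
zeroth factor. -/
theorem exists_tensor_representation (x : ⨂[ℝ] i, HomFactor k Y i) {c : ℝ} (hc : ‖x‖ < c) :
    ∃ (n : ℕ) (r : Fin n → Fin (k + 1) → BLip Y), ∑ j, HPoly.tensor (r j) = (x : HPoly k Y) ∧
      ∑ j, ∏ i, ‖r j i‖ ≤ 2 ^ (k + 1) * c := by
  rw [PiTensorProduct.norm_def] at hc
  obtain ⟨⟨p, hp⟩, hlt⟩ := exists_lt_of_ciInf_lt hc
  rw [PiTensorProduct.mem_lifts_iff] at hp
  set l := p.toList with hl
  choose L hL1 hL2 using fun (i : Fin (k + 1)) (q : HomFactor k Y i) =>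
    HomFactor.exists_lift_norm_le i q
  let r0 : ℝ × (∀ i, HomFactor k Y i) → Fin (k + 1) → BLip Y := fun a =>
    Function.update (fun i => L i (a.2 i)) 0 (a.1 • L 0 (a.2 0))
  have hr : ∀ a, HPoly.tensor (r0 a) = ((a.1 • ⨂ₜ[ℝ] i, a.2 i : ⨂[ℝ] i, HomFactor k Y i) :
      HPoly k Y) := by
    intro a
    rw [← HPoly.tensorM_apply, MultilinearMap.map_update_smul, Function.update_eq_self,
      HPoly.tensorM_apply, HPoly.tensor, UniformSpace.Completion.coe_smul]
    simp_rw [hL1]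
  have hn : ∀ a, ∏ i, ‖r0 a i‖ ≤ 2 ^ (k + 1) * (‖a.1‖ * ∏ i, ‖a.2 i‖) := by
    intro a
    have e : ∀ j : Fin k, r0 a j.succ = L j.succ (a.2 j.succ) := fun j =>
      Function.update_of_ne (Fin.succ_ne_zero j) _ _
    have e0 : r0 a 0 = a.1 • L 0 (a.2 0) := Function.update_self _ _ _
    rw [Fin.prod_univ_succ, Fin.prod_univ_succ, e0, norm_smul]
    simp_rw [e]
    have h1 : ∏ j : Fin k, ‖L j.succ (a.2 j.succ)‖ ≤ 2 ^ k * ∏ j : Fin k, ‖a.2 j.succ‖ := by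
      refine (Finset.prod_le_prod (fun _ _ => norm_nonneg _) fun j _ => hL2 _ _).trans ?_
      rw [Finset.prod_mul_distrib]; simp
    calc ‖a.1‖ * ‖L 0 (a.2 0)‖ * ∏ j : Fin k, ‖L j.succ (a.2 j.succ)‖
        ≤ ‖a.1‖ * (2 * ‖a.2 0‖) * (2 ^ k * ∏ j : Fin k, ‖a.2 j.succ‖) :=
          mul_le_mul (mul_le_mul_of_nonneg_left (hL2 _ _) (norm_nonneg _)) h1
            (Finset.prod_nonneg fun _ _ => norm_nonneg _) (by positivity)
      _ = _ := by rw [pow_succ]; ring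
  have hcoe : ∀ l : List (ℝ × (∀ i, HomFactor k Y i)),
      (((l.map fun x => x.1 • ⨂ₜ[ℝ] i, x.2 i).sum : ⨂[ℝ] i, HomFactor k Y i) : HPoly k Y) =
        ∑ j : Fin l.length, HPoly.tensor (r0 (l.get j)) := by
    intro l
    induction l with
    | nil => simp [UniformSpace.Completion.coe_zero]
    | cons a l ih =>
      rw [List.map_cons, List.sum_cons, UniformSpace.Completion.coe_add, ih]
      simp only [List.length_cons]
      rw [Fin.sum_univ_succ, ← hr]
      rfl
  have hsum : ∀ l : List (ℝ × (∀ i, HomFactor k Y i)),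
      ∑ j : Fin l.length, ∏ i, ‖r0 (l.get j) i‖ ≤
        2 ^ (k + 1) * (l.map fun p => ‖p.1‖ * ∏ i, ‖p.2 i‖).sum := by
    intro l
    induction l with
    | nil => simp
    | cons a l ih =>
      rw [List.map_cons, List.sum_cons, mul_add]
      simp only [List.length_cons]
      rw [Fin.sum_univ_succ]
      exact add_le_add (hn a) ih
  refine ⟨l.length, fun j => r0 (l.get j), ?_, (hsum l).trans
    (mul_le_mul_of_nonneg_left hlt.le (by positivity))⟩
  rw [← hcoe, hp]

/-- An element of the completion is a series of algebraic tensors whose norms decay geometrically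
after the first term. Each is a finite sum of simple tensors, and the finite families are strung
together into one sequence. -/
theorem HPoly.exists_represents (p : HPoly k Y) : ∃ r, HPoly.Represents r p := by
  have hmem : p ∈ closure ((UniformSpace.Completion.toComplL (𝕜 := ℝ)
      (E := ⨂[ℝ] i, HomFactor k Y i)).range.toAddSubgroup : Set (HPoly k Y)) := by
    have : ((UniformSpace.Completion.toComplL (𝕜 := ℝ)
      (E := ⨂[ℝ] i, HomFactor k Y i)).range.toAddSubgroup : Set (HPoly k Y)) =
        Set.range ((↑) : (⨂[ℝ] i, HomFactor k Y i) → HPoly k Y) := rfl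
    rw [this]
    exact UniformSpace.Completion.denseRange_coe p
  obtain ⟨v, hv, hmemv, h0, hb⟩ := controlled_sum_of_mem_closure hmem
    (b := fun n => (1 / 2) ^ n) fun n => by positivity
  have hmemv' : ∀ n, ∃ x : ⨂[ℝ] i, HomFactor k Y i, (x : HPoly k Y) = v n := hmemv
  choose x hx using hmemv'
  have hvs : Summable fun n => ‖v n‖ := by
    refine (summable_nat_add_iff 1).1 (Summable.of_nonneg_of_le (fun n => norm_nonneg _)
      (fun n => (hb (n + 1) n.succ_pos).le) ?_)
    exact (summable_nat_add_iff 1).2 summable_geometric_two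
  have hvp : HasSum v p := by
    have h1 := hvs.of_norm.hasSum
    have h2 := h1.tendsto_sum_nat.comp (tendsto_add_atTop_nat 1)
    rwa [tendsto_nhds_unique h2 hv] at h1
  -- The slack `(1 / 2) ^ n` provides the strict inequality required even when `v n = 0`, and it is
  -- summable.
  choose N r hr1 hr2 using fun n => exists_tensor_representation (x n)
    (c := ‖v n‖ + (1 / 2) ^ n) (by
      rw [← hx n, UniformSpace.Completion.norm_coe]
      linarith [show (0 : ℝ) < (1 / 2) ^ n by positivity])
  let R : (Σ n, Fin (N n)) → Fin (k + 1) → BLip Y := fun a => r a.1 a.2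
  have hRs : Summable fun a => ∏ i, ‖R a i‖ := by
    refine (summable_sigma_of_nonneg fun _ => Finset.prod_nonneg fun _ _ => norm_nonneg _).2
      ⟨fun n => Summable.of_finite, ?_⟩
    refine Summable.of_nonneg_of_le (fun n => tsum_nonneg fun _ =>
      Finset.prod_nonneg fun _ _ => norm_nonneg _) (fun n => ?_)
      ((hvs.add summable_geometric_two).mul_left (2 ^ (k + 1)))
    rw [tsum_fintype]
    exact hr2 n
  have hRt : Summable fun a => HPoly.tensor (R a) :=
    Summable.of_norm_bounded hRs fun a => HPoly.norm_tensor_le _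
  refine ⟨reindex R, HPoly.represents_reindex hRs ?_⟩
  have h1 := hRt.hasSum.sigma fun n => hasSum_fintype _
  have h2 : (fun n => ∑ j : Fin (N n), HPoly.tensor (R ⟨n, j⟩)) = v := by
    funext n
    rw [← hx n]
    exact hr1 n
  rw [h2] at h1
  rw [hvp.unique h1]
  exact hRt.hasSum

theorem HPoly.clm_ext {F : Type*} [AddCommMonoid F] [Module ℝ F] [TopologicalSpace F] [T2Space F]
    {A B : HPoly k Y →L[ℝ] F}
    (h : ∀ f, A (HPoly.tensor f) = B (HPoly.tensor f)) : A = B := by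
  refine ContinuousLinearMap.ext fun p => ?_
  obtain ⟨r, hr⟩ := HPoly.exists_represents p
  have h1 := (HPoly.represents_iff.1 hr).2
  have h2 := h1.mapL A
  simp_rw [h] at h2
  exact h2.unique (h1.mapL B)

/-- A bounded multilinear functional which is invariant under adding constants in all but the first
slot factors through the homogeneous polylipschitz functions. -/
theorem HPoly.exists_functional (N : (Fin (k + 1) → BLip Y) → ℝ)
    (hadd : ∀ f i a b, N (Function.update f i (a + b)) =
      N (Function.update f i a) + N (Function.update f i b))
    (hsmul : ∀ f i (c : ℝ) a, N (Function.update f i (c • a)) = c * N (Function.update f i a))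
    (hinv : ∀ f f', (∀ i, (homKer k Y i).mkQL (f i) = (homKer k Y i).mkQL (f' i)) → N f = N f')
    {C : ℝ} (hC : ∀ f, |N f| ≤ C * ∏ i, ‖f i‖) :
    ∃ A : HPoly k Y →L[ℝ] ℝ, ∀ f, A (HPoly.tensor f) = N f := by
  choose L hL1 hL2 using fun (i : Fin (k + 1)) (q : HomFactor k Y i) =>
    HomFactor.exists_lift_norm_le i q
  have hupd : ∀ (q : ∀ i, HomFactor k Y i) (i : Fin (k + 1)) (x : HomFactor k Y i) (f : BLip Y),
      (homKer k Y i).mkQL f = x →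
      N (fun j => L j (Function.update q i x j)) = N (Function.update (fun j => L j (q j)) i f) := by
    intro q i x f hf
    refine hinv _ _ fun j => ?_
    rw [hL1]
    rcases eq_or_ne j i with rfl | hj
    · rw [Function.update_self, Function.update_self, hf]
    · rw [Function.update_of_ne hj, Function.update_of_ne hj, hL1]
  -- The chosen lifts `L` are not linear. `M` is multilinear nevertheless, since by `hinv` the value
  -- of `N` does not depend on the lift.
  let M : MultilinearMap ℝ (HomFactor k Y) ℝ :=
    { toFun := fun q => N fun i => L i (q i)
      map_update_add' := fun {inst} q i x y => by
        have : inst = instDecidableEqFin (k + 1) := Subsingleton.elim _ _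
        subst this
        rw [hupd q i (x + y) (L i x + L i y) (by rw [map_add, hL1, hL1]), hadd,
          hupd q i x _ (hL1 i x), hupd q i y _ (hL1 i y)]
      map_update_smul' := fun {inst} q i c x => by
        have : inst = instDecidableEqFin (k + 1) := Subsingleton.elim _ _
        subst this
        rw [hupd q i (c • x) (c • L i x) (by rw [map_smul, hL1]), hsmul,
          hupd q i x _ (hL1 i x), smul_eq_mul] }
  have hM : ∀ q, ‖M q‖ ≤ |C| * 2 ^ (k + 1) * ∏ i, ‖q i‖ := by
    intro q
    refine (hC _).trans ?_
    rw [mul_assoc]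
    refine mul_le_mul (le_abs_self C) ?_ (Finset.prod_nonneg fun _ _ => norm_nonneg _) (abs_nonneg _)
    refine (Finset.prod_le_prod (fun _ _ => norm_nonneg _) fun i _ => hL2 i (q i)).trans ?_
    rw [Finset.prod_mul_distrib]; simp
  let A₀ := PiTensorProduct.liftIsometry ℝ (HomFactor k Y) ℝ (M.mkContinuous _ hM)
  refine ⟨A₀.extend UniformSpace.Completion.toComplL, fun f => ?_⟩
  have h1 : HPoly.tensor f = (UniformSpace.Completion.toComplL (𝕜 := ℝ)
    (E := ⨂[ℝ] i, HomFactor k Y i)) (⨂ₜ[ℝ] i, (homKer k Y i).mkQL (f i)) := rfl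
  rw [h1, ContinuousLinearMap.extend_eq _ UniformSpace.Completion.denseRange_coe
    (UniformSpace.Completion.isUniformInducing_coe _), PiTensorProduct.liftIsometry_apply_apply]
  refine (PiTensorProduct.lift.tprod _).trans ?_
  exact hinv _ _ fun i => hL1 _ _

end representation

/-! ### Linearization of a weighted current on a subset -/

section linearization

variable {X : Type u} [MetricSpace X] {Z : Type u} [MetricSpace Z] {Z' : Type u} [MetricSpace Z']
  {j : Z → X} {j' : Z' → X}

theorem BLip.exists_comp_eq (hj : Isometry j) (f : BLip Z) :
    ∃ F : BLip X, BLip.comp j hj.lipschitz F = f ∧ ‖F‖ ≤ ‖f‖ := by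
  have he : ∀ z, Function.extend j f 0 (j z) = f z := hj.injective.extend_apply _ _
  obtain ⟨F, h1, h2, h3⟩ := exists_blip_extension (Set.range j) (Function.extend j f 0)
    (norm_nonneg f) (norm_nonneg f) (by
      rintro _ ⟨z, rfl⟩ _ ⟨z', rfl⟩
      rw [he, he, hj.dist_eq]
      exact f.abs_sub_le_norm z z') (by
      rintro _ ⟨z, rfl⟩
      rw [he]
      exact f.abs_le_norm z)
  refine ⟨F, BLip.ext fun z => ?_, BLip.norm_le (norm_nonneg f) h2 h3⟩
  rw [BLip.comp_apply, h1 _ ⟨z, rfl⟩, he]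

theorem lipOn_image_le (hj : Isometry j) (F : BLip X) (A : Set Z) :
    lipOn (F : X → ℝ) (j '' A) ≤ lipOn (BLip.comp j hj.lipschitz F : Z → ℝ) A := by
  refine lipOn_le (lipOn_nonneg _ _) ?_
  rintro _ ⟨z, hz, rfl⟩ _ ⟨z', hz', rfl⟩
  rw [hj.dist_eq]
  exact (BLip.comp j hj.lipschitz F).abs_sub_le_lipOn hz hz'

theorem integrable_mul_blip [MeasurableSpace X] [BorelSpace X] {μ : Measure X} {g : X → ℝ}
    (hg : Integrable g μ) (F : BLip X) : Integrable (fun x => g x * F x) μ :=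
  hg.mul_bdd (c := ‖F‖) F.continuous.aestronglyMeasurable (ae_of_all _ fun x => F.abs_le_norm x)

variable {k : ℕ} [MeasurableSpace X] [BorelSpace X]

open Classical in
/-- The continuous linear functional on the homogeneous polylipschitz functions on `Z` which sends
`(π₀ ∘ j) ⊗ [π₁ ∘ j] ⊗ ⋯ ⊗ [π_k ∘ j]` to `T(g π₀, π₁, …, π_k)`. -/
def Current.lin (T : Current k X) (hj : Isometry j) (g : X → ℝ) : HPoly k Z →L[ℝ] ℝ :=
  if h : ∃ A : HPoly k Z →L[ℝ] ℝ, ∀ F : Fin (k + 1) → BLip X,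
    A (HPoly.tensor fun i => BLip.comp j hj.lipschitz (F i)) =
      T.borelExt (fun x => g x * F 0 x) (Fin.tail F) then h.choose else 0

/-- `g` is integrable with respect to the mass measure and vanishes outside the range of `j`. -/
def Current.IsWeight (T : Current k X) (j : Z → X) (g : X → ℝ) : Prop :=
  Integrable g T.mass ∧ ∀ x, g x ≠ 0 → x ∈ Set.range j

omit [MetricSpace Z] in
theorem Current.IsWeight.add {T : Current k X} {g h : X → ℝ} (hg : T.IsWeight j g)
    (hh : T.IsWeight j h) : T.IsWeight j fun x => g x + h x := by
  refine ⟨hg.1.add hh.1, fun x hx => ?_⟩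
  by_contra hn
  have h1 : g x = 0 := by
    by_contra h'
    exact hn (hg.2 x h')
  have h2 : h x = 0 := by
    by_contra h'
    exact hn (hh.2 x h')
  exact hx (by simp only [h1, h2, add_zero])

omit [MetricSpace Z] in
theorem Current.IsWeight.const_mul {T : Current k X} {g : X → ℝ} (hg : T.IsWeight j g) (a : ℝ) :
    T.IsWeight j fun x => a * g x :=
  ⟨hg.1.const_mul a, fun x hx => hg.2 x (right_ne_zero_of_mul hx)⟩

omit [MetricSpace Z] in
theorem Current.IsWeight.sub {T : Current k X} {g h : X → ℝ} (hg : T.IsWeight j g)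
    (hh : T.IsWeight j h) : T.IsWeight j fun x => g x - h x := by
  have := hg.add (hh.const_mul (-1))
  simpa [← sub_eq_add_neg] using this

omit [MetricSpace Z] in
theorem Current.IsWeight.indicator {T : Current k X} {g : X → ℝ} (hg : T.IsWeight j g) {B : Set X}
    (hB : MeasurableSet B) : T.IsWeight j (B.indicator g) :=
  ⟨hg.1.indicator hB, fun x hx => hg.2 x fun h => hx (by
    by_cases hxB : x ∈ B
    · rw [Set.indicator_of_mem hxB, h]
    · rw [Set.indicator_of_notMem hxB])⟩

omit [MetricSpace Z] in
theorem Current.isWeight_zero (T : Current k X) (j : Z → X) : T.IsWeight j fun _ => 0 :=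
  ⟨integrable_zero _ _ _, fun _ h => absurd rfl h⟩

variable [LocallyCompactSpace X] {T : Current k X} (hT : T.LocallyFiniteMass) (hj : Isometry j)
  (hj' : Isometry j')
include hT

/-- Slot by slot, strict locality allows the replacement of `π i` by `π' i` plus a constant, and the
constant contributes zero because its Lipschitz constant vanishes in the mass bound. -/
theorem Current.LocallyFiniteMass.borelExt_add_const {g : X → ℝ} (hg : Integrable g T.mass)
    {π π' : Fin k → BLip X} (h : ∀ i, ∃ c : ℝ, ∀ x, g x ≠ 0 → π i x - π' i x = c) :
    T.borelExt g π = T.borelExt g π' := by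
  classical
  have key : ∀ s : Finset (Fin k), T.borelExt g (s.piecewise π π') = T.borelExt g π' := by
    intro s
    induction s using Finset.induction_on with
    | empty => simp
    | insert i s hi ih =>
      rw [Finset.piecewise_insert, ← ih]
      conv_rhs => rw [← Function.update_eq_self i (s.piecewise π π')]
      rw [Finset.piecewise_eq_of_notMem _ _ _ hi]
      obtain ⟨c, hc⟩ := h i
      have e : T.borelExt g (Function.update (s.piecewise π π') i (π i)) =
          T.borelExt g (Function.update (s.piecewise π π') i (π' i + c • BLip.one X)) :=
        hT.borelExt_update_congr hg _ i fun x hx => by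
          rw [BLip.add_apply, BLip.smul_apply, BLip.one_apply, ← hc x hx]; ring
      rw [e, hT.borelExt_update_add hg, hT.borelExt_update_smul hg, add_eq_left]
      have h0 := hT.abs_borelExt_le hg (Function.update (s.piecewise π π') i (BLip.one X))
      have h1 : lipProd (Function.update (s.piecewise π π') i (BLip.one X)) = 0 := by
        refine Finset.prod_eq_zero (Finset.mem_univ i) ?_
        rw [Function.update_self]
        exact le_antisymm (lipOn_le le_rfl fun x _ y _ => by simp) (lipOn_nonneg _ _)
      rw [h1, zero_mul] at h0
      rw [abs_nonpos_iff.1 h0, mul_zero]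
  simpa using key Finset.univ

theorem Current.LocallyFiniteMass.borelExt_eq_of_mkQL_eq {g : X → ℝ} (hg : T.IsWeight j g)
    {F F' : Fin (k + 1) → BLip X}
    (h : ∀ i, (homKer k Z i).mkQL (BLip.comp j hj.lipschitz (F i)) =
      (homKer k Z i).mkQL (BLip.comp j hj.lipschitz (F' i))) :
    T.borelExt (fun x => g x * F 0 x) (Fin.tail F) =
      T.borelExt (fun x => g x * F' 0 x) (Fin.tail F') := by
  have h' : ∀ i, BLip.comp j hj.lipschitz (F i) - BLip.comp j hj.lipschitz (F' i) ∈
      homKer k Z i := fun i => (Submodule.Quotient.eq _).1 (h i)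
  have h0 := h' 0
  rw [homKer_zero, Submodule.mem_bot, sub_eq_zero] at h0
  have e0 : (fun x => g x * F 0 x) = fun x => g x * F' 0 x := by
    funext x
    by_cases hx : g x = 0
    · rw [hx, zero_mul, zero_mul]
    · obtain ⟨z, rfl⟩ := hg.2 x hx
      have := congrArg (fun f : BLip Z => f z) h0
      simp only [BLip.comp_apply] at this
      rw [this]
  rw [e0]
  refine hT.borelExt_add_const (integrable_mul_blip hg.1 _) fun i => ?_
  have hi := h' i.succ
  rw [homKer_succ] at hi
  obtain ⟨c, hc⟩ := hi
  refine ⟨c, fun x hx => ?_⟩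
  obtain ⟨z, rfl⟩ := hg.2 x (left_ne_zero_of_mul hx)
  exact hc z

/-- Functions on `Z` are extended to `X` without increasing the norm. The extension `E` is not
linear, but the value depends only on the functions along `j`, because the weight vanishes off the
range of `j`; this restores multilinearity and the invariance under constants. -/
theorem Current.LocallyFiniteMass.exists_lin {g : X → ℝ} (hg : T.IsWeight j g) :
    ∃ A : HPoly k Z →L[ℝ] ℝ, ∀ F : Fin (k + 1) → BLip X,
      A (HPoly.tensor fun i => BLip.comp j hj.lipschitz (F i)) =
        T.borelExt (fun x => g x * F 0 x) (Fin.tail F) := by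
  choose E hE1 hE2 using BLip.exists_comp_eq hj
  obtain ⟨P, hP⟩ : ∃ P : (Fin (k + 1) → BLip X) → ℝ,
    ∀ F, P F = T.borelExt (fun x => g x * F 0 x) (Fin.tail F) := ⟨_, fun _ => rfl⟩
  have hint : ∀ a : BLip X, Integrable (fun x => g x * a x) T.mass := integrable_mul_blip hg.1
  have Padd : ∀ F i a b, P (Function.update F i (a + b)) =
      P (Function.update F i a) + P (Function.update F i b) := by
    intro F i a b
    refine Fin.cases ?_ (fun i => ?_) i
    · simp only [hP, Fin.tail_update_zero, Function.update_self]
      rw [← hT.borelExt_add (hint a) (hint b)]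
      congr 1
      funext x
      rw [BLip.add_apply, mul_add]
    · simp only [hP, Fin.tail_update_succ, Function.update_of_ne (Fin.succ_ne_zero i).symm]
      exact hT.borelExt_update_add (hint _) _ _ _ _
  have Psmul : ∀ F i (c : ℝ) a, P (Function.update F i (c • a)) = c * P (Function.update F i a) := by
    intro F i c a
    refine Fin.cases ?_ (fun i => ?_) i
    · simp only [hP, Fin.tail_update_zero, Function.update_self]
      rw [← hT.borelExt_smul c (hint a)]
      congr 1
      funext x
      rw [BLip.smul_apply]; ring
    · simp only [hP, Fin.tail_update_succ, Function.update_of_ne (Fin.succ_ne_zero i).symm]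
      exact hT.borelExt_update_smul (hint _) _ _ _ _
  have Pcongr : ∀ (f : Fin (k + 1) → BLip Z) (F : Fin (k + 1) → BLip X),
      (∀ i, (homKer k Z i).mkQL (BLip.comp j hj.lipschitz (F i)) = (homKer k Z i).mkQL (f i)) →
      P (fun i => E (f i)) = P F := by
    intro f F hF
    rw [hP, hP]
    refine hT.borelExt_eq_of_mkQL_eq hj hg fun i => ?_
    rw [hE1, hF]
  have hupd : ∀ (f : Fin (k + 1) → BLip Z) (i : Fin (k + 1)) (a : BLip Z) (A : BLip X),
      BLip.comp j hj.lipschitz A = a →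
      P (fun l => E (Function.update f i a l)) = P (Function.update (fun l => E (f l)) i A) := by
    intro f i a A hA
    refine Pcongr _ _ fun l => ?_
    rcases eq_or_ne l i with rfl | hl
    · rw [Function.update_self, Function.update_self, hA]
    · rw [Function.update_of_ne hl, Function.update_of_ne hl, hE1]
  obtain ⟨A, hA⟩ := HPoly.exists_functional (k := k) (Y := Z) (fun f => P fun i => E (f i))
    (fun f i a b => by
      rw [hupd f i (a + b) (E a + E b) (by rw [map_add, hE1, hE1]), Padd, hupd f i a _ (hE1 a),
        hupd f i b _ (hE1 b)])
    (fun f i c a => by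
      rw [hupd f i (c • a) (c • E a) (by rw [map_smul, hE1]), Psmul, hupd f i a _ (hE1 a)])
    (fun f f' hff => Pcongr _ _ fun i => by rw [hE1, hff])
    (C := ∫ x, |g x| ∂T.mass) (fun f => by
      rw [hP]
      refine (hT.abs_borelExt_le (hint _) _).trans ?_
      rw [Fin.prod_univ_succ, ← mul_assoc, mul_comm]
      have hnn : 0 ≤ ∫ x, |g x| ∂T.mass := integral_nonneg fun _ => abs_nonneg _
      refine mul_le_mul ?_ ?_ (lipProd_nonneg _) (mul_nonneg hnn (norm_nonneg _))
      · rw [← integral_mul_const]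
        refine integral_mono (hint _).abs (hg.1.abs.mul_const _) fun x => ?_
        change |g x * E (f 0) x| ≤ |g x| * ‖f 0‖
        rw [abs_mul]
        exact mul_le_mul_of_nonneg_left (((E (f 0)).abs_le_norm x).trans (hE2 _)) (abs_nonneg _)
      · exact Finset.prod_le_prod (fun _ _ => lipOn_nonneg _ _) fun i _ =>
          ((E (f i.succ)).lipOn_le_norm _).trans (hE2 _))
  refine ⟨A, fun F => ?_⟩
  rw [hA, ← hP]
  exact Pcongr _ _ fun i => rfl

theorem Current.LocallyFiniteMass.lin_tensor {g : X → ℝ} (hg : T.IsWeight j g)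
    (F : Fin (k + 1) → BLip X) :
    T.lin hj g (HPoly.tensor fun i => BLip.comp j hj.lipschitz (F i)) =
      T.borelExt (fun x => g x * F 0 x) (Fin.tail F) := by
  have h := hT.exists_lin hj hg
  rw [Current.lin, dif_pos h]
  exact h.choose_spec F

theorem Current.LocallyFiniteMass.lin_unique {g : X → ℝ} (hg : T.IsWeight j g)
    {A : HPoly k Z →L[ℝ] ℝ} (hA : ∀ F : Fin (k + 1) → BLip X,
      A (HPoly.tensor fun i => BLip.comp j hj.lipschitz (F i)) =
        T.borelExt (fun x => g x * F 0 x) (Fin.tail F)) : A = T.lin hj g := by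
  choose E hE1 hE2 using BLip.exists_comp_eq hj
  refine HPoly.clm_ext fun f => ?_
  have e : f = fun i => BLip.comp j hj.lipschitz (E (f i)) := by
    funext i
    rw [hE1]
  rw [e, hA, hT.lin_tensor hj hg]

theorem Current.LocallyFiniteMass.lin_add {g h : X → ℝ} (hg : T.IsWeight j g)
    (hh : T.IsWeight j h) : T.lin hj (fun x => g x + h x) = T.lin hj g + T.lin hj h := by
  refine (hT.lin_unique hj (hg.add hh) fun F => ?_).symm
  rw [add_apply, hT.lin_tensor hj hg, hT.lin_tensor hj hh,
    ← hT.borelExt_add (integrable_mul_blip hg.1 _) (integrable_mul_blip hh.1 _)]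
  congr 1
  funext x
  rw [add_mul]

theorem Current.LocallyFiniteMass.lin_const_mul {g : X → ℝ} (hg : T.IsWeight j g) (a : ℝ) :
    T.lin hj (fun x => a * g x) = a • T.lin hj g := by
  refine (hT.lin_unique hj (hg.const_mul a) fun F => ?_).symm
  rw [smul_apply, hT.lin_tensor hj hg, smul_eq_mul,
    ← hT.borelExt_smul a (integrable_mul_blip hg.1 _)]
  congr 1
  funext x
  rw [mul_assoc]

theorem Current.LocallyFiniteMass.lin_sub {g h : X → ℝ} (hg : T.IsWeight j g)
    (hh : T.IsWeight j h) : T.lin hj (fun x => g x - h x) = T.lin hj g - T.lin hj h := by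
  have e : (fun x => g x - h x) = fun x => g x + -1 * h x := by
    funext x; ring
  rw [e, hT.lin_add hj hg (hh.const_mul (-1)), hT.lin_const_mul hj hh]
  refine ContinuousLinearMap.ext fun p => ?_
  change T.lin hj g p + -1 * T.lin hj h p = T.lin hj g p - T.lin hj h p
  ring

theorem Current.LocallyFiniteMass.lin_zero : T.lin hj (fun _ => 0) = 0 := by
  have := hT.lin_const_mul hj (T.isWeight_zero j) 0
  simpa using this

omit hT [LocallyCompactSpace X] [MetricSpace Z] in
theorem Current.isWeight_sum {ι : Type*} (s : Finset ι) {g : ι → X → ℝ}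
    (hg : ∀ i ∈ s, T.IsWeight j (g i)) : T.IsWeight j fun x => ∑ i ∈ s, g i x := by
  classical
  induction s using Finset.induction_on with
  | empty => simpa using T.isWeight_zero j
  | insert a s ha ih =>
    simp only [Finset.sum_insert ha]
    exact (hg a (Finset.mem_insert_self _ _)).add
      (ih fun i hi => hg i (Finset.mem_insert_of_mem hi))

theorem Current.LocallyFiniteMass.lin_sum {ι : Type*} (s : Finset ι) {g : ι → X → ℝ}
    (hg : ∀ i ∈ s, T.IsWeight j (g i)) :
    T.lin hj (fun x => ∑ i ∈ s, g i x) = ∑ i ∈ s, T.lin hj (g i) := by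
  classical
  induction s using Finset.induction_on with
  | empty => simpa using hT.lin_zero hj
  | insert a s ha ih =>
    have hs := fun i hi => hg i (Finset.mem_insert_of_mem hi)
    simp only [Finset.sum_insert ha]
    rw [hT.lin_add hj (hg a (Finset.mem_insert_self _ _)) (Current.isWeight_sum s hs), ih hs]

/-- Both functionals take the same values on simple tensors of functions coming from `X`, and these
determine a continuous functional. This allows the domain to be shrunk to any set carrying the
weight. -/
theorem Current.LocallyFiniteMass.lin_pull {g : X → ℝ} (hg : T.IsWeight j' g) {i : Z' → Z}
    (hi : LipschitzWith 1 i) (hij : ∀ z, j (i z) = j' z) (p : HPoly k Z) :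
    T.lin hj' g (HPoly.pull i hi p) = T.lin hj g p := by
  have hg' : T.IsWeight j g := ⟨hg.1, fun x hx => by
    obtain ⟨z, rfl⟩ := hg.2 x hx
    exact ⟨i z, hij z⟩⟩
  have h := hT.lin_unique hj hg' (A := (T.lin hj' g).comp (HPoly.pull i hi)) fun F => ?_
  · rw [← h]; rfl
  · rw [ContinuousLinearMap.comp_apply, HPoly.pull_tensor, ← hT.lin_tensor hj' hg F]
    congr 2
    funext l
    exact BLip.ext fun z => congrArg (F l) (hij z)

/-- Each simple tensor of a representation obeys the mass bound with Lipschitz constants taken on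
`A`. The sum over the representation is moved under the integral before the supremum over points is
taken, which matches the order of sum and supremum in $\mathrm{Lip}_k$. -/
theorem Current.LocallyFiniteMass.enorm_lin_le {g : X → ℝ} (hg : T.IsWeight j g) (p : HPoly k Z)
    {A : Set Z} (hA : ∀ x, g x ≠ 0 → x ∈ j '' A) :
    ‖T.lin hj g p‖ₑ ≤ HPoly.lipOn p A * ∫⁻ x, ‖g x‖ₑ ∂T.mass := by
  rw [HPoly.lipOn, ENNReal.iInf_mul' (fun h => absurd h hg.1.2.ne) (fun _ => inferInstance)]
  refine le_iInf fun r => ?_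
  by_cases hr : HPoly.Represents r p
  swap
  · simp only [hr, iInf_false]
    -- A sequence which represents nothing contributes `∞` times the integral. With the convention
    -- `∞ * 0 = 0` this is harmless only if the functional is zero, so the case of an almost
    -- everywhere vanishing weight is treated separately.
    by_cases h0 : ∫⁻ x, ‖g x‖ₑ ∂T.mass = 0
    · have hz : T.lin hj g p = 0 := by
        have : T.lin hj g = 0 := by
          refine (hT.lin_unique hj hg fun F => ?_).symm
          have h1 := hT.abs_borelExt_le (integrable_mul_blip hg.1 (F 0)) (Fin.tail F)
          have h2 : ∫ x, |g x * F 0 x| ∂T.mass = 0 := by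
            refine integral_eq_zero_of_ae ?_
            have := (lintegral_eq_zero_iff' hg.1.1.enorm).1 h0
            filter_upwards [this] with x hx
            have : g x = 0 := by simpa using hx
            simp [this]
          rw [h2, mul_zero] at h1
          rw [abs_nonpos_iff.1 h1]; rfl
        rw [this]; rfl
      rw [hz]; simp
    · rw [ENNReal.top_mul h0]
      exact le_top
  simp only [hr, iInf_pos]
  set S := ⨆ x ∈ A, ∑' n, ENNReal.ofReal (|r n 0 x| * ∏ i : Fin k, lipOn (r n i.succ) A) with hS
  have hsum := (HPoly.represents_iff.1 hr).2.mapL (T.lin hj g)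
  choose E hE1 hE2 using BLip.exists_comp_eq hj
  have hterm : ∀ n, ‖T.lin hj g (HPoly.tensor (r n))‖ₑ ≤
      ∫⁻ x, ‖g x‖ₑ * ENNReal.ofReal (|E (r n 0) x| * ∏ i : Fin k, lipOn (r n i.succ) A) ∂T.mass := by
    intro n
    have e : r n = fun i => BLip.comp j hj.lipschitz (E (r n i)) := by
      funext i
      rw [hE1]
    have hint := integrable_mul_blip hg.1 (E (r n 0))
    have hL : ∏ i : Fin k, lipOn (E (r n i.succ) : X → ℝ) (j '' A) ≤
        ∏ i : Fin k, lipOn (r n i.succ) A := by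
      refine Finset.prod_le_prod (fun _ _ => lipOn_nonneg _ _) fun i _ => ?_
      refine (lipOn_image_le hj _ _).trans ?_
      rw [hE1]
    have hL0 : 0 ≤ ∏ i : Fin k, lipOn (r n i.succ) A :=
      Finset.prod_nonneg fun _ _ => lipOn_nonneg _ _
    have h1 := hT.abs_borelExt_le_lipOn hint (Fin.tail fun i => E (r n i)) (A := j '' A)
      fun x hx => hA x (left_ne_zero_of_mul hx)
    have h2 : T.lin hj g (HPoly.tensor (r n)) =
        T.borelExt (fun x => g x * E (r n 0) x) (Fin.tail fun i => E (r n i)) := by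
      conv_lhs => rw [e]
      exact hT.lin_tensor hj hg fun i => E (r n i)
    rw [h2, ← ofReal_norm, Real.norm_eq_abs]
    refine (ENNReal.ofReal_le_ofReal (h1.trans (mul_le_mul_of_nonneg_right hL
      (integral_nonneg fun _ => abs_nonneg _)))).trans ?_
    have h3 : ENNReal.ofReal (∫ x, |g x * E (r n 0) x| ∂T.mass) =
        ∫⁻ x, ‖g x * E (r n 0) x‖ₑ ∂T.mass := ofReal_integral_norm_eq_lintegral_enorm hint
    rw [ENNReal.ofReal_mul hL0, h3, ← lintegral_const_mul' _ _ ENNReal.ofReal_ne_top]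
    refine lintegral_mono fun x => ?_
    rw [enorm_mul, ENNReal.ofReal_mul (abs_nonneg _), ← Real.norm_eq_abs, ofReal_norm]
    exact le_of_eq (by ring)
  calc ‖T.lin hj g p‖ₑ = ‖∑' n, T.lin hj g (HPoly.tensor (r n))‖ₑ := by rw [hsum.tsum_eq]
    _ ≤ ∑' n, ‖T.lin hj g (HPoly.tensor (r n))‖ₑ := enorm_tsum_le_tsum_enorm
    _ ≤ ∑' n, ∫⁻ x, ‖g x‖ₑ *
        ENNReal.ofReal (|E (r n 0) x| * ∏ i : Fin k, lipOn (r n i.succ) A) ∂T.mass :=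
      ENNReal.tsum_le_tsum hterm
    _ = ∫⁻ x, ∑' n, ‖g x‖ₑ *
        ENNReal.ofReal (|E (r n 0) x| * ∏ i : Fin k, lipOn (r n i.succ) A) ∂T.mass := by
      refine (lintegral_tsum fun n => hg.1.1.enorm.mul ?_).symm
      refine (Measurable.ennreal_ofReal ?_).aemeasurable
      exact (E (r n 0)).continuous.measurable.abs.mul_const _
    _ ≤ ∫⁻ x, S * ‖g x‖ₑ ∂T.mass := by
      refine lintegral_mono fun x => ?_
      simp only [ENNReal.tsum_mul_left]
      by_cases hx : g x = 0
      · simp [hx]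
      · obtain ⟨z, hz, rfl⟩ := hA x hx
        rw [mul_comm]
        refine mul_le_mul_left ?_ _
        refine le_trans (le_of_eq ?_) (le_iSup₂ (f := fun x (_ : x ∈ A) =>
          ∑' n, ENNReal.ofReal (|r n 0 x| * ∏ i : Fin k, lipOn (r n i.succ) A)) z hz)
        refine tsum_congr fun n => ?_
        have := congrArg (fun f : BLip Z => f z) (hE1 (r n 0))
        simp only [BLip.comp_apply] at this
        rw [this]
    _ = S * ∫⁻ x, ‖g x‖ₑ ∂T.mass := lintegral_const_mul'' _ hg.1.1.enorm

end linearization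

/-! ### The local Lipschitz constants and the pointwise norm -/

section pnorm

variable {k : ℕ} {Y : Type u} [MetricSpace Y] {Z : Type u} [MetricSpace Z]

/-- The supremum which appears in the definition of `HPoly.lipOn`. -/
def lipSum {ι : Type*} (r : ι → Fin (k + 1) → BLip Y) (A : Set Y) : ℝ≥0∞ :=
  ⨆ x ∈ A, ∑' j, ENNReal.ofReal (|r j 0 x| * ∏ i : Fin k, Polylip.lipOn (r j i.succ) A)

theorem HPoly.lipOn_eq_iInf (p : HPoly k Y) (A : Set Y) :
    HPoly.lipOn p A = ⨅ r : {r : ℕ → Fin (k + 1) → BLip Y // HPoly.Represents r p}, lipSum r.1 A :=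
  iInf_subtype'

instance (p : HPoly k Y) :
    Nonempty {r : ℕ → Fin (k + 1) → BLip Y // HPoly.Represents r p} :=
  nonempty_subtype.2 (HPoly.exists_represents p)

theorem lipSum_mono {ι : Type*} (r : ι → Fin (k + 1) → BLip Y) {A B : Set Y} (h : A ⊆ B) :
    lipSum r A ≤ lipSum r B := by
  refine iSup₂_le fun x hx => le_trans ?_ (le_iSup₂ (f := fun x (_ : x ∈ B) => ∑' j,
    ENNReal.ofReal (|r j 0 x| * ∏ i : Fin k, Polylip.lipOn (r j i.succ) B)) x (h hx))
  refine ENNReal.tsum_le_tsum fun j => ENNReal.ofReal_le_ofReal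
    (mul_le_mul_of_nonneg_left ?_ (abs_nonneg _))
  exact Finset.prod_le_prod (fun _ _ => lipOn_nonneg _ _) fun i _ => BLip.lipOn_mono _ h

theorem lipSum_le {ι : Type*} (r : ι → Fin (k + 1) → BLip Y) (A : Set Y) :
    lipSum r A ≤ ∑' j, ENNReal.ofReal (∏ i, ‖r j i‖) := by
  refine iSup₂_le fun x _ => ENNReal.tsum_le_tsum fun j => ENNReal.ofReal_le_ofReal ?_
  rw [Fin.prod_univ_succ]
  refine mul_le_mul (BLip.abs_le_norm _ _) ?_ (Finset.prod_nonneg fun _ _ => lipOn_nonneg _ _)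
    (norm_nonneg _)
  exact Finset.prod_le_prod (fun _ _ => lipOn_nonneg _ _) fun i _ => BLip.lipOn_le_norm _ _

theorem HPoly.lipOn_mono (p : HPoly k Y) {A B : Set Y} (h : A ⊆ B) :
    HPoly.lipOn p A ≤ HPoly.lipOn p B :=
  iInf₂_mono fun r _ => lipSum_mono r h

theorem HPoly.lipOn_lt_top (p : HPoly k Y) (A : Set Y) : HPoly.lipOn p A < ∞ := by
  obtain ⟨r, hr⟩ := HPoly.exists_represents p
  refine (iInf₂_le r hr).trans_lt ((lipSum_le r A).trans_lt ?_)
  have h := (HPoly.represents_iff.1 hr).1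
  rw [← ENNReal.ofReal_tsum_of_nonneg (fun j => Finset.prod_nonneg fun _ _ => norm_nonneg _) h]
  exact ENNReal.ofReal_lt_top

/-- Padding with zero tuples turns any encodable index type into the natural numbers without
changing the sums. Disjoint unions and single tensors thereby count as representations. -/
theorem HPoly.lipOn_le_of_hasSum {ι : Type*} [Encodable ι] {r : ι → Fin (k + 1) → BLip Y}
    {p : HPoly k Y} (h1 : Summable fun j => ∏ i, ‖r j i‖)
    (h2 : HasSum (fun j => HPoly.tensor (r j)) p) (A : Set Y) : HPoly.lipOn p A ≤ lipSum r A := by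
  refine (iInf₂_le (reindex r) (HPoly.represents_reindex h1 h2)).trans (iSup₂_mono fun x _ => ?_)
  refine le_of_eq ?_
  have e : (fun j => ENNReal.ofReal (|r j 0 x| * ∏ i : Fin k, Polylip.lipOn (r j i.succ) A)) =
      (fun j => ENNReal.ofReal (|reindex r j 0 x| *
        ∏ i : Fin k, Polylip.lipOn (reindex r j i.succ) A)) ∘ Encodable.encode := by
    funext j
    simp only [Function.comp_apply, reindex_encode]
  rw [e]
  refine ((Encodable.encode_injective (α := ι)).tsum_eq ?_).symm
  intro n hn
  by_contra h
  refine hn ?_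
  dsimp only
  rw [reindex_of_notMem r h]
  simp

theorem HPoly.lipOn_zero (A : Set Y) : HPoly.lipOn (0 : HPoly k Y) A = 0 := by
  have h := HPoly.lipOn_le_of_hasSum (ι := Fin 0) (r := fun _ => (0 : Fin (k + 1) → BLip Y))
    (p := 0) Summable.of_finite (by simp) A
  simpa [lipSum] using h

theorem HPoly.lipOn_add_le (p q : HPoly k Y) (A : Set Y) :
    HPoly.lipOn (p + q) A ≤ HPoly.lipOn p A + HPoly.lipOn q A := by
  rw [HPoly.lipOn_eq_iInf p, HPoly.lipOn_eq_iInf q]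
  refine ENNReal.le_iInf_add_iInf fun ⟨r, hr⟩ ⟨s, hs⟩ => ?_
  obtain ⟨r1, r2⟩ := HPoly.represents_iff.1 hr
  obtain ⟨s1, s2⟩ := HPoly.represents_iff.1 hs
  refine (HPoly.lipOn_le_of_hasSum (r := Sum.elim r s) ?_ ?_ A).trans ?_
  · exact (HasSum.sum (f := fun j => ∏ i, ‖Sum.elim r s j i‖) r1.hasSum s1.hasSum).summable
  · exact HasSum.sum (f := fun j => HPoly.tensor (Sum.elim r s j)) r2 s2
  · refine iSup₂_le fun x hx => ?_
    rw [ENNReal.summable.tsum_sum ENNReal.summable]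
    exact add_le_add
      (le_iSup₂ (f := fun x (_ : x ∈ A) => ∑' j, ENNReal.ofReal (|r j 0 x| *
        ∏ i : Fin k, Polylip.lipOn (r j i.succ) A)) x hx)
      (le_iSup₂ (f := fun x (_ : x ∈ A) => ∑' j, ENNReal.ofReal (|s j 0 x| *
        ∏ i : Fin k, Polylip.lipOn (s j i.succ) A)) x hx)

theorem HPoly.lipOn_smul_le (a : ℝ) (p : HPoly k Y) (A : Set Y) :
    HPoly.lipOn (a • p) A ≤ ENNReal.ofReal |a| * HPoly.lipOn p A := by
  rw [HPoly.lipOn_eq_iInf p, ENNReal.mul_iInf fun h => absurd h ENNReal.ofReal_ne_top]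
  refine le_iInf fun ⟨r, hr⟩ => ?_
  obtain ⟨r1, r2⟩ := HPoly.represents_iff.1 hr
  let s : ℕ → Fin (k + 1) → BLip Y := fun j => Function.update (r j) 0 (a • r j 0)
  have s0 : ∀ j, s j 0 = a • r j 0 := fun j => Function.update_self _ _ _
  have s1 : ∀ j (i : Fin k), s j i.succ = r j i.succ := fun j i =>
    Function.update_of_ne (Fin.succ_ne_zero i) _ _
  have hs : HPoly.Represents s (a • p) := by
    refine HPoly.represents_iff.2 ⟨?_, ?_⟩
    · refine (r1.mul_left |a|).congr fun j => ?_
      rw [Fin.prod_univ_succ, Fin.prod_univ_succ, s0, norm_smul, Real.norm_eq_abs, mul_assoc]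
      simp_rw [s1]
    · refine (r2.const_smul a).congr_fun fun j => ?_
      rw [← HPoly.tensorM_apply, MultilinearMap.map_update_smul, Function.update_eq_self,
        HPoly.tensorM_apply]
  refine (iInf₂_le s hs).trans (iSup₂_le fun x hx => ?_)
  refine le_trans ?_ (mul_le_mul_right (le_iSup₂ (f := fun x (_ : x ∈ A) => ∑' j,
    ENNReal.ofReal (|r j 0 x| * ∏ i : Fin k, Polylip.lipOn (r j i.succ) A)) x hx) _)
  rw [← ENNReal.tsum_mul_left]
  refine ENNReal.tsum_le_tsum fun j => le_of_eq ?_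
  rw [← ENNReal.ofReal_mul (abs_nonneg a), s0, BLip.smul_apply, abs_mul, mul_assoc]
  simp_rw [s1]

theorem HPoly.lipOn_pull_le {i : Y → Z} (hi : LipschitzWith 1 i) (p : HPoly k Z) {A : Set Y}
    {B : Set Z} (h : ∀ y ∈ A, i y ∈ B) : HPoly.lipOn (HPoly.pull i hi p) A ≤ HPoly.lipOn p B := by
  refine le_iInf₂ fun r hr => ?_
  obtain ⟨r1, r2⟩ := HPoly.represents_iff.1 hr
  let s : ℕ → Fin (k + 1) → BLip Y := fun j l => BLip.comp i hi (r j l)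
  have hs : HPoly.Represents s (HPoly.pull i hi p) := by
    refine HPoly.represents_iff.2 ⟨?_, ?_⟩
    · refine Summable.of_nonneg_of_le (fun j => Finset.prod_nonneg fun _ _ => norm_nonneg _)
        (fun j => Finset.prod_le_prod (fun _ _ => norm_nonneg _) fun l _ => ?_) r1
      exact BLip.norm_le (norm_nonneg _) (BLip.abs_comp_sub_le hi _) fun y =>
        BLip.abs_le_norm (r j l) (i y)
    · simpa only [HPoly.pull_tensor] using r2.mapL (HPoly.pull i hi)
  refine (iInf₂_le s hs).trans (iSup₂_le fun x hx => ?_)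
  refine le_trans ?_ (le_iSup₂ (f := fun x (_ : x ∈ B) => ∑' j,
    ENNReal.ofReal (|r j 0 x| * ∏ i : Fin k, Polylip.lipOn (r j i.succ) B)) (i x) (h x hx))
  refine ENNReal.tsum_le_tsum fun j => ENNReal.ofReal_le_ofReal
    (mul_le_mul_of_nonneg_left ?_ (abs_nonneg _))
  refine Finset.prod_le_prod (fun _ _ => lipOn_nonneg _ _) fun l _ => ?_
  refine lipOn_le (lipOn_nonneg _ _) fun y hy z hz => ?_
  refine (BLip.abs_sub_le_lipOn _ (h y hy) (h z hz)).trans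
    (mul_le_mul_of_nonneg_left ?_ (lipOn_nonneg _ _))
  simpa using hi.dist_le_mul y z

theorem HPoly.lipOn_res_le {U V : Opens Y} (h : U ≤ V) (p : HPoly k V) {A : Set U} {B : Set V}
    (hAB : ∀ y ∈ A, (⟨y.1, h y.2⟩ : V) ∈ B) : HPoly.lipOn (HPoly.res h p) A ≤ HPoly.lipOn p B :=
  HPoly.lipOn_pull_le _ p hAB

theorem Stalk.pnorm_le {y : Y} (U : Opens Y) (hy : y ∈ U) (p : HPoly k U) {r : ℝ} (hr : 0 < r) :
    (germ U hy p).pnorm ≤ HPoly.lipOn p {z | dist (z : Y) y < r} :=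
  iInf₂_le_of_le U hy (iInf₂_le_of_le p rfl (iInf₂_le r hr))

/-- Intersecting the domain with the ball in question turns a bound on the ball into one on the
whole domain. -/
theorem Stalk.exists_of_pnorm_lt {y : Y} {g : Stalk k y} {c : ℝ≥0∞} (h : g.pnorm < c) :
    ∃ (U : Opens Y) (hy : y ∈ U) (p : HPoly k U), germ U hy p = g ∧
      HPoly.lipOn p Set.univ < c := by
  simp only [Stalk.pnorm, iInf_lt_iff] at h
  obtain ⟨U, hy, p, hg, r, hr, hlt⟩ := h
  let V : Opens Y := U ⊓ ⟨Metric.ball y r, Metric.isOpen_ball⟩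
  have hyV : y ∈ V := ⟨hy, Metric.mem_ball_self hr⟩
  have hVU : V ≤ U := inf_le_left
  refine ⟨V, hyV, HPoly.res hVU p, by rw [germ_res, hg], lt_of_le_of_lt ?_ hlt⟩
  exact HPoly.lipOn_res_le hVU p fun z _ => z.2.2

theorem Stalk.pnorm_lt_top {y : Y} (g : Stalk k y) : g.pnorm < ∞ := by
  obtain ⟨U, hy, p, rfl⟩ := exists_germ g
  exact (Stalk.pnorm_le U hy p one_pos).trans_lt (HPoly.lipOn_lt_top _ _)

theorem Stalk.pnorm_zero {y : Y} : (0 : Stalk k y).pnorm = 0 := by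
  have h := Stalk.pnorm_le (k := k) (⊤ : Opens Y) (y := y) trivial 0 one_pos
  rw [map_zero, HPoly.lipOn_zero] at h
  exact le_antisymm h zero_le

theorem Stalk.pnorm_add_le {y : Y} (g h : Stalk k y) : (g + h).pnorm ≤ g.pnorm + h.pnorm := by
  refine ENNReal.le_of_forall_pos_le_add fun ε hε _ => ?_
  have hε2 : (ε : ℝ≥0∞) / 2 ≠ 0 := by simpa using hε.ne'
  obtain ⟨U, hU, p, rfl, hp⟩ := Stalk.exists_of_pnorm_lt (ENNReal.lt_add_right g.pnorm_lt_top.ne hε2)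
  obtain ⟨V, hV, q, rfl, hq⟩ := Stalk.exists_of_pnorm_lt (ENNReal.lt_add_right h.pnorm_lt_top.ne hε2)
  have hW : y ∈ U ⊓ V := ⟨hU, hV⟩
  have e : germ U hU p + germ V hV q = germ (U ⊓ V) hW
      (HPoly.res inf_le_left p + HPoly.res inf_le_right q) := by
    rw [map_add, germ_res, germ_res]
  calc (germ U hU p + germ V hV q).pnorm
      ≤ HPoly.lipOn (HPoly.res inf_le_left p + HPoly.res inf_le_right q : HPoly k ↥(U ⊓ V))
        {z | dist (z : Y) y < 1} := by
        rw [e]; exact Stalk.pnorm_le _ hW _ one_pos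
    _ ≤ HPoly.lipOn p Set.univ + HPoly.lipOn q Set.univ :=
        (HPoly.lipOn_add_le _ _ _).trans (add_le_add
          (HPoly.lipOn_res_le _ p fun _ _ => trivial) (HPoly.lipOn_res_le _ q fun _ _ => trivial))
    _ ≤ ((germ U hU p).pnorm + ε / 2) + ((germ V hV q).pnorm + ε / 2) := add_le_add hp.le hq.le
    _ = (germ U hU p).pnorm + (germ V hV q).pnorm + ε := by
        rw [add_add_add_comm, ENNReal.add_halves]

theorem Stalk.pnorm_smul_le {y : Y} (a : ℝ) (g : Stalk k y) :
    (a • g).pnorm ≤ ENNReal.ofReal |a| * g.pnorm := by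
  conv_rhs => unfold Stalk.pnorm
  have ha : ENNReal.ofReal |a| ≠ ∞ := ENNReal.ofReal_ne_top
  rcases eq_or_ne a 0 with rfl | h0
  · rw [zero_smul, Stalk.pnorm_zero]
    exact zero_le
  have ha0 : ENNReal.ofReal |a| ≠ 0 := by simpa using h0
  simp_rw [ENNReal.mul_iInf_of_ne ha0 ha]
  refine le_iInf₂ fun U hy => le_iInf₂ fun p hp => le_iInf₂ fun r hr => ?_
  rw [← hp, ← map_smul]
  exact (Stalk.pnorm_le U hy _ hr).trans (HPoly.lipOn_smul_le _ _ _)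

/-- A good representative of the germ coincides with `p` on a smaller neighbourhood, so the bound
holds there for `p` itself. -/
theorem exists_lipOn_res_lt {U : Opens Y} (p : HPoly k U) {y : Y} (hy : y ∈ U) {c : ℝ≥0∞}
    (h : (germ U hy p).pnorm < c) :
    ∃ (W : Opens Y) (hW : W ≤ U), y ∈ W ∧ HPoly.lipOn (HPoly.res hW p) Set.univ < c := by
  obtain ⟨V, hV, q, hq, hlt⟩ := Stalk.exists_of_pnorm_lt h
  obtain ⟨W, hyW, h1, h2, e⟩ := exists_res_eq hy hV hq.symm
  refine ⟨W, h1, hyW, ?_⟩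
  rw [e]
  exact (HPoly.lipOn_res_le h2 q (B := Set.univ) fun _ _ => trivial).trans_lt hlt

theorem pnorm_germ_lt_of_lipOn_lt {U W : Opens Y} (hW : W ≤ U) (p : HPoly k U) {c : ℝ≥0∞}
    (h : HPoly.lipOn (HPoly.res hW p) Set.univ < c) {z : Y} (hz : z ∈ W) :
    (germ U (hW hz) p).pnorm < c := by
  rw [← germ_res hW hz]
  exact (Stalk.pnorm_le W hz _ one_pos).trans_lt
    ((HPoly.lipOn_mono _ (Set.subset_univ _)).trans_lt h)

/-- Upper semicontinuity: a bound for $\mathrm{Lip}_k$ over a neighbourhood bounds the pointwise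
norms of all germs in it. Measurability and boundedness on compact sets both come from this. -/
theorem Sect.IsCont.isOpen_pnorm_lt {σ : Sect k Y} (hσ : σ.IsCont) (c : ℝ≥0∞) :
    IsOpen {y | (σ y).pnorm < c} := by
  rw [isOpen_iff_forall_mem_open]
  intro y hy
  obtain ⟨U, hU, p, hp⟩ := Sect.isCont_iff.1 hσ y
  have hy' : (germ U hU p).pnorm < c := by rw [← hp y hU]; exact hy
  obtain ⟨W, hW, hyW, hlt⟩ := exists_lipOn_res_lt p hU hy'
  refine ⟨W, fun z hz => ?_, W.isOpen, hyW⟩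
  simp only [Set.mem_ofPred_eq]
  rw [hp z (hW hz)]
  exact pnorm_germ_lt_of_lipOn_lt hW p hlt hz

open Classical in
/-- The pointwise norm of a section over `E`, extended by zero. -/
def Sect.pn {E : Set Y} (σ : Sect k E) (x : Y) : ℝ≥0∞ :=
  if h : x ∈ E then (σ ⟨x, h⟩).pnorm else 0

theorem Sect.pn_apply {E : Set Y} (σ : Sect k E) (z : E) : σ.pn z = (σ z).pnorm :=
  dif_pos z.2

theorem Sect.pn_of_notMem {E : Set Y} (σ : Sect k E) {x : Y} (hx : x ∉ E) : σ.pn x = 0 :=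
  dif_neg hx

theorem Sect.pnormOn_eq (E : Set Y) (ω : Sect k Y) :
    Sect.pnormOn E ω = (Sect.restrict E ω).pn := rfl

theorem Sect.IsCont.measurable_pn [MeasurableSpace Y] [BorelSpace Y] {E : Set Y}
    (hE : MeasurableSet E) {σ : Sect k E} (hσ : σ.IsCont) : Measurable σ.pn := by
  refine measurable_of_Iio fun c => ?_
  have h1 : IsOpen {z : E | (σ z).pnorm < c} := hσ.isOpen_pnorm_lt c
  have h2 : MeasurableSet (Subtype.val '' {z : E | (σ z).pnorm < c}) :=
    (MeasurableEmbedding.subtype_coe hE).measurableSet_image.2 h1.measurableSet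
  have e : σ.pn ⁻¹' Set.Iio c = Subtype.val '' {z : E | (σ z).pnorm < c} ∪
      (Eᶜ ∩ {_x | (0 : ℝ≥0∞) < c}) := by
    ext x
    by_cases hx : x ∈ E
    · simp [Sect.pn, hx]
    · simp [Sect.pn, hx]
  rw [e]
  exact h2.union (hE.compl.inter (MeasurableSet.const _))

end pnorm

/-! ### Countable additivity in the weight, and the pointwise norm estimate -/

section estimate

variable {X : Type u} [MetricSpace X] {Z : Type u} [MetricSpace Z] {j : Z → X} {k : ℕ}
  [MeasurableSpace X] [BorelSpace X] [LocallyCompactSpace X] {T : Current k X}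
  (hT : T.LocallyFiniteMass) (hj : Isometry j)
include hT

theorem Current.LocallyFiniteMass.abs_lin_le {g : X → ℝ} (hg : T.IsWeight j g) (p : HPoly k Z) :
    |T.lin hj g p| ≤ (HPoly.lipOn p Set.univ).toReal * ∫ x, |g x| ∂T.mass := by
  have h := hT.enorm_lin_le hj hg p (A := Set.univ) fun x hx => by
    rw [Set.image_univ]
    exact hg.2 x hx
  have h3 : ENNReal.ofReal (∫ x, |g x| ∂T.mass) = ∫⁻ x, ‖g x‖ₑ ∂T.mass :=
    ofReal_integral_norm_eq_lintegral_enorm hg.1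
  rw [← h3, ← ENNReal.ofReal_toReal (HPoly.lipOn_lt_top p Set.univ).ne,
    ← ENNReal.ofReal_mul ENNReal.toReal_nonneg, Real.enorm_eq_ofReal_abs] at h
  exact (ENNReal.ofReal_le_ofReal_iff (mul_nonneg ENNReal.toReal_nonneg
    (integral_nonneg fun _ => abs_nonneg _))).1 h

/-- `lin` is continuous in the weight for the $L^1$ norm, so dominated convergence along the finite
partial sums suffices; countability of the index makes that filter countably generated. -/
theorem Current.LocallyFiniteMass.hasSum_lin {ι : Type*} [Countable ι] {g : ι → X → ℝ}
    {G H : X → ℝ} (hg : ∀ i, T.IsWeight j (g i)) (hG : ∀ x, HasSum (fun i => g i x) (G x))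
    (hH : Integrable H T.mass) (hgH : ∀ (s : Finset ι) x, |∑ i ∈ s, g i x| ≤ H x) :
    T.IsWeight j G ∧ ∀ p : HPoly k Z, HasSum (fun i => T.lin hj (g i) p) (T.lin hj G p) := by
  have hGm : AEStronglyMeasurable G T.mass :=
    aestronglyMeasurable_of_tendsto_ae (atTop : Filter (Finset ι))
      (f := fun s x => ∑ i ∈ s, g i x) (fun s => (Current.isWeight_sum s fun i _ => hg i).1.1)
      (ae_of_all _ fun x => hG x)
  have hGH : ∀ x, |G x| ≤ H x := fun x =>
    le_of_tendsto ((hG x).abs) (Eventually.of_forall fun s => hgH s x)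
  have hGw : T.IsWeight j G := by
    refine ⟨hH.mono' hGm (ae_of_all _ hGH), fun x hx => ?_⟩
    by_contra hn
    refine hx ((hG x).unique ?_)
    have : (fun i => g i x) = fun _ => 0 := by
      funext i
      by_contra h
      exact hn ((hg i).2 x h)
    rw [this]
    exact hasSum_zero
  refine ⟨hGw, fun p => ?_⟩
  have hlim : Tendsto (fun s : Finset ι => ∫ x, |∑ i ∈ s, g i x - G x| ∂T.mass) atTop (𝓝 0) := by
    have h := tendsto_integral_filter_of_dominated_convergence (μ := T.mass)
      (l := (atTop : Filter (Finset ι))) (F := fun s x => |∑ i ∈ s, g i x - G x|)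
      (f := fun _ => 0) (fun x => 2 * H x)
      (Eventually.of_forall fun s =>
        ((Current.isWeight_sum s fun i _ => hg i).1.1.sub hGw.1.1).norm)
      (Eventually.of_forall fun s => ae_of_all _ fun x => by
        rw [Real.norm_eq_abs, abs_abs, two_mul]
        exact (abs_sub _ _).trans (add_le_add (hgH s x) (hGH x)))
      (hH.const_mul 2) (ae_of_all _ fun x => by
        have := ((hG x).sub_const (G x)).abs
        rwa [sub_self, abs_zero] at this)
    rwa [integral_zero] at h
  rw [HasSum, SummationFilter.unconditional_filter, tendsto_iff_norm_sub_tendsto_zero]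
  refine squeeze_zero (fun _ => norm_nonneg _) (fun s => ?_)
    (by simpa using hlim.const_mul (HPoly.lipOn p Set.univ).toReal)
  have hs := Current.isWeight_sum s fun i _ => hg i
  have e : ∑ i ∈ s, T.lin hj (g i) p - T.lin hj G p =
      T.lin hj (fun x => ∑ i ∈ s, g i x - G x) p := by
    rw [hT.lin_sub hj hs hGw, hT.lin_sum hj s fun i _ => hg i]
    simp
  rw [e]
  exact hT.abs_lin_le hj (hs.sub hGw) p

/-- A localization principle: by countable additivity an integral bound only has to be checked on
the pieces of a countable Borel partition of the set where `g` is nonzero. -/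
theorem Current.LocallyFiniteMass.enorm_lin_le_lintegral_of_iUnion {g : X → ℝ}
    (hg : T.IsWeight j g) (p : HPoly k Z) {B : ℕ → Set X} (hB : ∀ n, MeasurableSet (B n))
    (hd : Pairwise (Function.onFun Disjoint B)) (hc : ∀ x, g x ≠ 0 → ∃ n, x ∈ B n)
    {F : X → ℝ≥0∞} (hF : ∀ n, ‖T.lin hj ((B n).indicator g) p‖ₑ ≤ ∫⁻ x in B n, F x ∂T.mass) :
    ‖T.lin hj g p‖ₑ ≤ ∫⁻ x, F x ∂T.mass := by
  have hsum := (hT.hasSum_lin hj (g := fun n => (B n).indicator g) (G := g)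
    (H := fun x => |g x|) (fun n => hg.indicator (hB n)) (fun x => ?_) hg.1.abs
    (fun s x => ?_)).2 p
  · calc ‖T.lin hj g p‖ₑ = ‖∑' n, T.lin hj ((B n).indicator g) p‖ₑ := by rw [hsum.tsum_eq]
      _ ≤ ∑' n, ‖T.lin hj ((B n).indicator g) p‖ₑ := enorm_tsum_le_tsum_enorm
      _ ≤ ∑' n, ∫⁻ x in B n, F x ∂T.mass := ENNReal.tsum_le_tsum hF
      _ = ∫⁻ x in ⋃ n, B n, F x ∂T.mass := (lintegral_iUnion hB hd _).symm
      _ ≤ ∫⁻ x, F x ∂T.mass := setLIntegral_le_lintegral _ _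
  · by_cases hx : g x = 0
    · have : (fun n => (B n).indicator g x) = fun _ => 0 := by
        funext n
        exact Set.indicator_apply_eq_zero.2 fun _ => hx
      rw [this, hx]
      exact hasSum_zero
    · obtain ⟨n, hn⟩ := hc x hx
      have h := hasSum_single (f := fun n => (B n).indicator g x) n fun m hm =>
        Set.indicator_of_notMem (fun h => (hd hm).le_bot ⟨h, hn⟩) _
      rwa [Set.indicator_of_mem hn] at h
  · have : ∑ n ∈ s, (B n).indicator g x = (⋃ n ∈ s, B n).indicator g x := by
      rw [Finset.indicator_biUnion_apply _ _ fun a _ b _ hab => hd hab]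
    rw [this]
    by_cases hx : x ∈ ⋃ n ∈ s, B n
    · rw [Set.indicator_of_mem hx]
    · rw [Set.indicator_of_notMem hx, abs_zero]
      exact abs_nonneg _

end estimate

/-! ### Relatively open subsets and the pointwise norm estimate -/

section opens

variable {X : Type u} [MetricSpace X] {E : Set X} {k : ℕ}

/-- The inclusion into `X` of a relatively open subset of `E ⊆ X`. -/
def incl (U : Opens E) (z : U) : X := z.1.1

theorem isometry_incl (U : Opens E) : Isometry (incl U) := fun _ _ => rfl

theorem mem_range_incl {U : Opens E} {x : X} :
    x ∈ Set.range (incl U) ↔ ∃ h : x ∈ E, (⟨x, h⟩ : E) ∈ U :=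
  ⟨by rintro ⟨z, rfl⟩; exact ⟨z.1.2, z.2⟩, fun ⟨h, h'⟩ => ⟨⟨⟨x, h⟩, h'⟩, rfl⟩⟩

theorem range_incl (U : Opens E) : Set.range (incl U) = Subtype.val '' (U : Set E) := by
  ext x
  rw [mem_range_incl]
  simp

variable [MeasurableSpace X] [BorelSpace X]

theorem measurableSet_image_of_isOpen (hE : MeasurableSet E) {s : Set E} (hs : IsOpen s) :
    MeasurableSet (Subtype.val '' s) :=
  (MeasurableEmbedding.subtype_coe hE).measurableSet_image.2 hs.measurableSet

theorem measurableSet_range_incl (hE : MeasurableSet E) (U : Opens E) :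
    MeasurableSet (Set.range (incl U)) := by
  rw [range_incl]
  exact measurableSet_image_of_isOpen hE U.isOpen

variable [LocallyCompactSpace X] {T : Current k X} (hT : T.LocallyFiniteMass)
include hT

theorem Current.LocallyFiniteMass.lin_res {U V : Opens E} (h : U ≤ V) {g : X → ℝ}
    (hg : T.IsWeight (incl U) g) (p : HPoly k V) :
    T.lin (isometry_incl U) g (HPoly.res h p) = T.lin (isometry_incl V) g p :=
  hT.lin_pull (isometry_incl V) (isometry_incl U) hg _ (fun _ => rfl) p

/-- Every point where the weight is nonzero has a neighbourhood with $\mathrm{Lip}_k<c$. Countably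
many of them suffice by second countability; after making them disjoint, each piece of the weight is
evaluated on its own neighbourhood. -/
theorem Current.LocallyFiniteMass.enorm_lin_le_of_pnorm_lt (hE : MeasurableSet E) (U : Opens E)
    [SecondCountableTopology U] (p : HPoly k U) {g : X → ℝ} (hg : T.IsWeight (incl U) g)
    {c : ℝ≥0∞} (hc : ∀ z : U, g (incl U z) ≠ 0 → (germ U z.2 p).pnorm < c) :
    ‖T.lin (isometry_incl U) g p‖ₑ ≤ c * ∫⁻ x, ‖g x‖ₑ ∂T.mass := by
  classical
  let ι := {z : U // g (incl U z) ≠ 0}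
  rcases isEmpty_or_nonempty ι with hι | ⟨⟨i₀⟩⟩
  · have : g = fun _ => 0 := by
      funext x
      by_contra h
      obtain ⟨z, rfl⟩ := hg.2 x h
      exact hι.false ⟨z, h⟩
    rw [this, hT.lin_zero]
    simp
  choose W hW hzW hlt using fun z : ι => exists_lipOn_res_lt p z.1.2 (hc z.1 z.2)
  obtain ⟨S, hS, hSe⟩ := TopologicalSpace.isOpen_iUnion_countable
    (fun i : ι => ((↑) : U → E) ⁻¹' (W i : Set E))
    fun i => (W i).isOpen.preimage continuous_subtype_val
  have hmem : ∀ z : ι, ∃ i ∈ S, z.1.1 ∈ W i := by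
    intro z
    have : z.1 ∈ ⋃ i : ι, ((↑) : U → E) ⁻¹' (W i : Set E) := Set.mem_iUnion.2 ⟨z, hzW z⟩
    rw [← hSe] at this
    simpa using this
  obtain ⟨f, hf⟩ := hS.exists_eq_range (by obtain ⟨i, hi, -⟩ := hmem i₀; exact ⟨i, hi⟩)
  let A : ℕ → Set X := fun n => Set.range (incl (W (f n)))
  have hA : ∀ n, MeasurableSet (A n) := fun n => measurableSet_range_incl hE _
  have hAd : ∀ n, MeasurableSet (disjointed A n) := MeasurableSet.disjointed hA
  have h := hT.enorm_lin_le_lintegral_of_iUnion (isometry_incl U) hg p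
    (B := disjointed A) (F := fun x => c * ‖g x‖ₑ) hAd (disjoint_disjointed A)
    (fun x hx => ?_) (fun n => ?_)
  · rwa [lintegral_const_mul'' _ hg.1.1.enorm] at h
  · obtain ⟨z, rfl⟩ := hg.2 x hx
    obtain ⟨i, hi, hz⟩ := hmem ⟨z, hx⟩
    rw [hf] at hi
    obtain ⟨n, rfl⟩ := hi
    rw [← Set.mem_iUnion, iUnion_disjointed]
    exact Set.mem_iUnion.2 ⟨n, ⟨⟨z.1, hz⟩, rfl⟩⟩
  · have hw : T.IsWeight (incl (W (f n))) ((disjointed A n).indicator g) :=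
      ⟨hg.1.indicator (hAd n), fun x hx =>
        disjointed_subset A n (Set.mem_of_indicator_ne_zero hx)⟩
    rw [← hT.lin_res (hW (f n)) hw]
    refine (hT.enorm_lin_le (isometry_incl _) hw _ (A := Set.univ) fun x hx => ?_).trans ?_
    · rw [Set.image_univ]
      exact hw.2 x hx
    · rw [lintegral_const_mul'' _ hg.1.1.enorm.restrict]
      refine mul_le_mul' (hlt _).le (le_of_eq ?_)
      rw [← lintegral_indicator (hAd n)]
      refine lintegral_congr fun x => ?_
      rw [enorm_indicator_eq_indicator_enorm]

/-- The norm is cut into levels of height `ε`. On each level the preceding bound uses the upper end,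
which exceeds the actual norm by at most `ε`; the total error is `ε` times the integral of `|g|`. -/
theorem Current.LocallyFiniteMass.enorm_lin_le_lintegral_pn (hE : MeasurableSet E) {U : Opens E}
    [SecondCountableTopology U] {σ : Sect k E} (hσ : σ.IsCont) {p : HPoly k U}
    (hp : ∀ z (hz : z ∈ U), σ z = germ U hz p) {g : X → ℝ} (hg : T.IsWeight (incl U) g) :
    ‖T.lin (isometry_incl U) g p‖ₑ ≤ ∫⁻ x, ‖g x‖ₑ * σ.pn x ∂T.mass := by
  have hfin : ∫⁻ x, ‖g x‖ₑ ∂T.mass ≠ ∞ := hg.1.2.ne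
  have hpn : ∀ x, σ.pn x ≠ ∞ := by
    intro x
    by_cases hx : x ∈ E
    · rw [σ.pn_apply ⟨x, hx⟩]
      exact (Stalk.pnorm_lt_top _).ne
    · rw [σ.pn_of_notMem hx]
      exact ENNReal.zero_ne_top
  have hm := hσ.measurable_pn hE
  have key : ∀ ε : NNReal, 0 < ε → ‖T.lin (isometry_incl U) g p‖ₑ ≤
      ∫⁻ x, ‖g x‖ₑ * σ.pn x ∂T.mass + ε * ∫⁻ x, ‖g x‖ₑ ∂T.mass := by
    intro ε hε
    let B : ℕ → Set X := fun n => σ.pn ⁻¹' Set.Ico ((n * ε : NNReal) : ℝ≥0∞) (((n + 1) * ε : NNReal))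
    have hB : ∀ n, MeasurableSet (B n) := fun n => hm measurableSet_Ico
    have h := hT.enorm_lin_le_lintegral_of_iUnion (isometry_incl U) hg p
      (B := B) (F := fun x => ‖g x‖ₑ * σ.pn x + ε * ‖g x‖ₑ) hB ?_ (fun x hx => ?_) (fun n => ?_)
    · rwa [lintegral_add_right' _ (hg.1.1.enorm.const_mul _),
        lintegral_const_mul'' _ hg.1.1.enorm] at h
    · have hlt : ∀ m n : ℕ, m < n → Disjoint (B m) (B n) := by
        intro m n hmn
        refine Set.disjoint_left.2 fun x hx hx' => ?_
        refine absurd (hx.2.trans_le ?_) (not_lt.2 hx'.1)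
        rw [ENNReal.coe_le_coe]
        exact mul_le_mul_left (by exact_mod_cast hmn) ε
      intro m n hmn
      rcases hmn.lt_or_gt with h | h
      · exact hlt m n h
      · exact (hlt n m h).symm
    · lift σ.pn x to NNReal using hpn x with a ha
      refine ⟨⌊a / ε⌋₊, ?_⟩
      simp only [B, Set.mem_preimage, ← ha, Set.mem_Ico, ENNReal.coe_le_coe, ENNReal.coe_lt_coe]
      constructor
      · rw [← le_div_iff₀ hε]
        exact Nat.floor_le (zero_le)
      · rw [← div_lt_iff₀ hε]
        exact Nat.lt_floor_add_one _
    · refine (hT.enorm_lin_le_of_pnorm_lt hE U p (hg.indicator (hB n))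
        (c := ((n + 1) * ε : NNReal)) fun z hz => ?_).trans ?_
      · have : incl U z ∈ B n := Set.mem_of_indicator_ne_zero hz
        have h2 := this.2
        rw [← hp z.1 z.2, ← σ.pn_apply]
        exact h2
      · rw [← lintegral_const_mul'' _ (hg.1.indicator (hB n)).1.enorm,
          ← lintegral_indicator (hB n)]
        refine lintegral_mono fun x => ?_
        by_cases hx : x ∈ B n
        · simp only [Set.indicator_of_mem hx]
          have := hx.1
          calc _ = ((n * ε : NNReal) : ℝ≥0∞) * ‖g x‖ₑ + ε * ‖g x‖ₑ := by
                push_cast; ring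
            _ ≤ σ.pn x * ‖g x‖ₑ + ε * ‖g x‖ₑ := by gcongr
            _ = _ := by rw [mul_comm (σ.pn x)]
        · simp [Set.indicator_of_notMem hx]
  refine ENNReal.le_of_forall_pos_le_add fun δ hδ hlt => ?_
  lift (∫⁻ x, ‖g x‖ₑ ∂T.mass) to NNReal using hfin with I hI
  -- With this height the error is at most `δ`; adding one to the integral `I` of `|g|` covers the
  -- case `I = 0`.
  refine (key (δ / (I + 1)) (by positivity)).trans ?_
  gcongr
  rw [← ENNReal.coe_mul, ENNReal.coe_le_coe, div_mul_eq_mul_div, div_le_iff₀ (by positivity)]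
  gcongr
  simp

end opens

/-! ### Evaluation of a current on sections by means of local representations -/

section covers

variable {X : Type u} [MetricSpace X] {E : Set X} {k : ℕ}

theorem PrecompactIn.mono {U V : Opens E} (hV : PrecompactIn V) (h : U ≤ V) : PrecompactIn U :=
  hV.of_isClosed_subset isClosed_closure (closure_mono (Set.image_mono h))

theorem PrecompactIn.secondCountableTopology {U : Opens E} (hU : PrecompactIn U) :
    SecondCountableTopology U := by
  have : SecondCountableTopology (closure (Subtype.val '' (U : Set E))) :=
    hU.isSeparable.secondCountableTopology
  let f : U → closure (Subtype.val '' (U : Set E)) := fun z =>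
    ⟨z.1.1, subset_closure ⟨z.1, z.2, rfl⟩⟩
  have hf : Isometry f := fun _ _ => rfl
  exact hf.isEmbedding.secondCountableTopology

theorem precompactIn_bot : PrecompactIn (⊥ : Opens E) := by
  simp [PrecompactIn]

theorem exists_precompactIn [LocallyCompactSpace X] (z : E) :
    ∃ U : Opens E, z ∈ U ∧ PrecompactIn U := by
  obtain ⟨K, hK, hz⟩ := exists_compact_mem_nhds (z : X)
  refine ⟨relOpen E ⟨interior K, isOpen_interior⟩, mem_interior_iff_mem_nhds.2 hz, ?_⟩
  refine hK.of_isClosed_subset isClosed_closure (closure_minimal ?_ hK.isClosed)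
  rintro _ ⟨w, hw, rfl⟩
  exact interior_subset hw

/-- Neither `X` nor `E` is assumed separable, but `E ∩ K` is second countable as a subset of a
compact metric space, and Lindelöf's theorem applies to it. The empty set is inserted so that an
enumeration exists even if `E ∩ K` is empty. -/
theorem exists_seq_cover {P : Opens E → Prop} (hbot : P ⊥) (hP : ∀ z : E, ∃ U, z ∈ U ∧ P U)
    {K : Set X} (hK : IsCompact K) :
    ∃ U : ℕ → Opens E, (∀ n, P (U n)) ∧ ∀ x ∈ E ∩ K, ∃ n, x ∈ Set.range (incl (U n)) := by
  choose V hV hVP using hP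
  have : SecondCountableTopology ↥(E ∩ K) :=
    (hK.isSeparable.mono Set.inter_subset_right).secondCountableTopology
  let i : ↥(E ∩ K) → E := fun x => ⟨x.1, x.2.1⟩
  have hi : Continuous i := Continuous.subtype_mk continuous_subtype_val _
  obtain ⟨S, hS, hSe⟩ := TopologicalSpace.countable_cover_nhds
    (f := fun x : ↥(E ∩ K) => i ⁻¹' (V (i x) : Set E))
    fun x => ((V (i x)).isOpen.preimage hi).mem_nhds (hV (i x))
  obtain ⟨f, hf⟩ := ((hS.image fun x => V (i x)).insert ⊥).exists_eq_range
    (Set.insert_nonempty _ _)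
  have hmem : ∀ n, f n ∈ insert ⊥ ((fun x => V (i x)) '' S) := fun n => hf ▸ Set.mem_range_self n
  refine ⟨f, fun n => ?_, fun x hx => ?_⟩
  · rcases hmem n with h | ⟨x, -, h⟩
    · rw [h]; exact hbot
    · rw [← h]; exact hVP _
  · have : (⟨x, hx⟩ : ↥(E ∩ K)) ∈ ⋃ y ∈ S, i ⁻¹' (V (i y) : Set E) := hSe ▸ Set.mem_univ _
    obtain ⟨y, hy, hxy⟩ := Set.mem_iUnion₂.1 this
    have : V (i y) ∈ Set.range f := hf ▸ Set.mem_insert_of_mem _ ⟨y, hy, rfl⟩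
    obtain ⟨n, hn⟩ := this
    refine ⟨n, mem_range_incl.2 ⟨hx.1, ?_⟩⟩
    rw [hn]
    exact hxy

/-- `E ∩ K` need not be compact, so finiteness cannot be expected. Each member of the cover meeting
it contains a point of a countable dense subset, and each such point lies in only finitely many
members. -/
theorem countable_setOf_inter_nonempty {ι : Type*} {U : ι → Opens E}
    (hU : LocallyFinite fun i => (U i : Set E)) {K : Set X} (hK : IsCompact K) :
    {i | ∃ x ∈ K, x ∈ Set.range (incl (U i))}.Countable := by
  have : SecondCountableTopology ↥(E ∩ K) :=
    (hK.isSeparable.mono Set.inter_subset_right).secondCountableTopology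
  let j : ↥(E ∩ K) → E := fun x => ⟨x.1, x.2.1⟩
  have hj : Continuous j := Continuous.subtype_mk continuous_subtype_val _
  obtain ⟨D, hD, hDd⟩ := exists_countable_dense ↥(E ∩ K)
  refine (hD.biUnion fun d _ => (hU.point_finite (j d)).countable).mono ?_
  rintro i ⟨x, hxK, hx⟩
  obtain ⟨hxE, hxU⟩ := mem_range_incl.1 hx
  obtain ⟨d, hd, hdU⟩ := hDd.exists_mem_open ((U i).isOpen.preimage hj) ⟨⟨x, hxE, hxK⟩, hxU⟩
  exact Set.mem_biUnion (t := fun d => {i | j d ∈ (U i : Set E)}) hd hdU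

end covers

/-! ### Local representations and independence of the sum -/

section value

variable {X : Type u} [MetricSpace X] {E : Set X} {k : ℕ} [MeasurableSpace X] [BorelSpace X]

/-- The function `p i` represents the section `σ` on the precompact set `U i`, and the weights
`g i ≥ 0`, which are carried by the sets `U i`, add up to at most one everywhere and
to one on the set `S`. -/
structure Current.LocRep (T : Current k X) {ι : Type*} (U : ι → Opens E) (p : ∀ i, HPoly k (U i))
    (g : ι → X → ℝ) (σ : Sect k E) : Prop where
  precompact : ∀ i, PrecompactIn (U i)
  germ_eq : ∀ i z (hz : z ∈ U i), σ z = germ (U i) hz (p i)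
  isWeight : ∀ i, T.IsWeight (incl (U i)) (g i)
  nonneg : ∀ i x, 0 ≤ g i x
  sum_le_one : ∀ (s : Finset ι) x, ∑ i ∈ s, g i x ≤ 1
  hasSum_one : ∀ z : E, σ z ≠ 0 → HasSum (fun i => g i z) 1

variable {T : Current k X} {ι κ : Type*} {U : ι → Opens E} {p : ∀ i, HPoly k (U i)}
    {g : ι → X → ℝ} {V : κ → Opens E} {q : ∀ i, HPoly k (V i)} {h : κ → X → ℝ} {σ : Sect k E}

theorem Current.LocRep.summable (hr : T.LocRep U p g σ) (x : X) : Summable fun i => g i x :=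
  summable_of_sum_le (fun i => hr.nonneg i x) fun s => hr.sum_le_one s x

theorem Current.LocRep.le_one (hr : T.LocRep U p g σ) (i : ι) (x : X) : g i x ≤ 1 := by
  simpa using hr.sum_le_one {i} x

theorem Current.LocRep.mul_isWeight (hr : T.LocRep U p g σ) (hs : T.LocRep V q h σ) (i : ι)
    (l : κ) : T.IsWeight (incl (U i ⊓ V l)) fun x => g i x * h l x := by
  refine ⟨(hr.isWeight i).1.mul_bdd (c := 1) (hs.isWeight l).1.1 (ae_of_all _ fun x => ?_),
    fun x hx => ?_⟩
  · rw [Real.norm_eq_abs, abs_of_nonneg (hs.nonneg l x)]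
    exact hs.le_one l x
  · obtain ⟨h1, h2⟩ := mem_range_incl.1 ((hr.isWeight i).2 x (left_ne_zero_of_mul hx))
    obtain ⟨h3, h4⟩ := mem_range_incl.1 ((hs.isWeight l).2 x (right_ne_zero_of_mul hx))
    exact mem_range_incl.2 ⟨h1, h2, h4⟩

/-- The common refinement used to compare two local representations; the products of the weights
again add up to one where the section is nonzero. -/
theorem Current.LocRep.prod (hr : T.LocRep U p g σ) (hs : T.LocRep V q h σ) :
    T.LocRep (fun a : ι × κ => U a.1 ⊓ V a.2) (fun a => HPoly.res inf_le_left (p a.1))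
      (fun a x => g a.1 x * h a.2 x) σ where
  precompact a := (hr.precompact a.1).mono inf_le_left
  germ_eq a z hz := by rw [germ_res]; exact hr.germ_eq a.1 z hz.1
  isWeight a := hr.mul_isWeight hs a.1 a.2
  nonneg a x := mul_nonneg (hr.nonneg _ _) (hs.nonneg _ _)
  sum_le_one s x := by
    classical
    have h0 : ∀ a : ι × κ, 0 ≤ g a.1 x * h a.2 x := fun a =>
      mul_nonneg (hr.nonneg _ _) (hs.nonneg _ _)
    calc ∑ a ∈ s, g a.1 x * h a.2 x
        ≤ ∑ a ∈ s.image Prod.fst ×ˢ s.image Prod.snd, g a.1 x * h a.2 x :=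
          Finset.sum_le_sum_of_subset_of_nonneg Finset.subset_product fun a _ _ => h0 a
      _ = (∑ i ∈ s.image Prod.fst, g i x) * ∑ l ∈ s.image Prod.snd, h l x := by
          rw [Finset.sum_product, Finset.sum_mul_sum]
      _ ≤ 1 := mul_le_one₀ (hr.sum_le_one _ x) (Finset.sum_nonneg fun l _ => hs.nonneg l x)
          (hs.sum_le_one _ x)
  hasSum_one z hz := by
    have := (hr.hasSum_one z hz).mul (hs.hasSum_one z hz)
      ((hr.summable z).mul_of_nonneg (hs.summable z) (fun i => hr.nonneg i z)
        fun l => hs.nonneg l z)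
    rwa [one_mul] at this

theorem Current.IsWeight.of_le {U V : Opens E} (h : U ≤ V) {g : X → ℝ}
    (hg : T.IsWeight (incl U) g) : T.IsWeight (incl V) g :=
  ⟨hg.1, fun x hx => by
    obtain ⟨h1, h2⟩ := mem_range_incl.1 (hg.2 x hx)
    exact mem_range_incl.2 ⟨h1, h h2⟩⟩

omit [MeasurableSpace X] [BorelSpace X] in
theorem Sect.pn_eq_zero {x : X} (h : ∀ hx : x ∈ E, σ ⟨x, hx⟩ = 0) : σ.pn x = 0 := by
  by_cases hx : x ∈ E
  · rw [σ.pn_apply ⟨x, hx⟩, h hx, Stalk.pnorm_zero]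
  · exact σ.pn_of_notMem hx

theorem tsum_enorm_mul_le {f : ι → ℝ} (hf : ∀ i, 0 ≤ f i) (hs : ∀ s : Finset ι, ∑ i ∈ s, f i ≤ 1)
    (c : ℝ≥0∞) : ∑' i, ‖f i‖ₑ * c ≤ c := by
  rw [ENNReal.tsum_mul_right]
  refine mul_le_of_le_one_left zero_le (ENNReal.summable.tsum_le_of_sum_le fun s => ?_)
  simp_rw [Real.enorm_eq_ofReal (hf _)]
  rw [← ENNReal.ofReal_sum_of_nonneg fun i _ => hf i]
  exact ENNReal.ofReal_le_one.2 (hs s)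

variable [LocallyCompactSpace X] (hT : T.LocallyFiniteMass)
include hT

/-- In the pointwise estimate for the difference of the weights the integrand vanishes identically:
either the weights agree or the norm of the section is zero. -/
theorem Current.LocallyFiniteMass.lin_congr_of_pn {U : Opens E} (hE : MeasurableSet E)
    (hU : PrecompactIn U) (hσ : σ.IsCont) {p : HPoly k U}
    (hp : ∀ z (hz : z ∈ U), σ z = germ U hz p) {g h : X → ℝ} (hg : T.IsWeight (incl U) g)
    (hh : T.IsWeight (incl U) h) (hgh : ∀ z : E, σ z ≠ 0 → g z = h z) :
    T.lin (isometry_incl U) g p = T.lin (isometry_incl U) h p := by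
  have := hU.secondCountableTopology
  have h1 := hT.enorm_lin_le_lintegral_pn hE hσ hp (hg.sub hh)
  have h2 : ∫⁻ x, ‖g x - h x‖ₑ * σ.pn x ∂T.mass = 0 := by
    have : (fun x => ‖g x - h x‖ₑ * σ.pn x) = fun _ => 0 := by
      funext x
      by_cases hx : ∀ hx : x ∈ E, σ ⟨x, hx⟩ = 0
      · rw [Sect.pn_eq_zero hx, mul_zero]
      · push Not at hx
        obtain ⟨hxE, hx⟩ := hx
        rw [hgh ⟨x, hxE⟩ hx, sub_self, enorm_zero, zero_mul]
    rw [this, lintegral_zero]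
  rw [h2, hT.lin_sub (isometry_incl U) hg hh] at h1
  have h3 : T.lin (isometry_incl U) g p - T.lin (isometry_incl U) h p = 0 := by simpa using h1
  linarith

/-- The difference of the two restrictions represents the zero section, whose pointwise norm is
zero. Equality of germs is all that is needed; `p` and `q` are not assumed to coincide on the
overlap. -/
theorem Current.LocallyFiniteMass.lin_eq_of_germ_eq {U V : Opens E} (hE : MeasurableSet E)
    (hU : PrecompactIn U) {p : HPoly k U} {q : HPoly k V}
    (hpq : ∀ z (hz : z ∈ U) (hz' : z ∈ V), germ U hz p = germ V hz' q) {g : X → ℝ}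
    (hg : T.IsWeight (incl (U ⊓ V)) g) :
    T.lin (isometry_incl U) g p = T.lin (isometry_incl V) g q := by
  have h1 : U ⊓ V ≤ U := inf_le_left
  have h2 : U ⊓ V ≤ V := inf_le_right
  have := (hU.mono h1).secondCountableTopology
  rw [← hT.lin_res h1 hg, ← hT.lin_res h2 hg, ← sub_eq_zero, ← map_sub]
  have h3 := hT.enorm_lin_le_lintegral_pn hE (σ := (0 : Sect k E)) (zero_mem (Forms k E))
    (p := HPoly.res h1 p - HPoly.res h2 q) (fun z hz => by
      rw [map_sub, germ_res, germ_res, hpq z hz.1 hz.2, sub_self]; rfl) hg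
  have h4 : ∀ x, (0 : Sect k E).pn x = 0 := fun x => Sect.pn_eq_zero fun _ => rfl
  simpa [h4] using h3

/-- The weights `g i * h l` sum over `l` to `g i` wherever the section is nonzero, and elsewhere the
weight is irrelevant. -/
theorem Current.LocRep.hasSum_mul (hE : MeasurableSet E) [Countable κ] (hσ : σ.IsCont)
    (hr : T.LocRep U p g σ) (hs : T.LocRep V q h σ) (i : ι) :
    HasSum (fun l => T.lin (isometry_incl (U i)) (fun x => g i x * h l x) (p i))
      (T.lin (isometry_incl (U i)) (g i) (p i)) := by
  obtain ⟨h1, h2⟩ := hT.hasSum_lin (isometry_incl (U i)) (g := fun l x => g i x * h l x)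
    (G := fun x => g i x * ∑' l, h l x) (H := g i)
    (fun l => (hr.mul_isWeight hs i l).of_le inf_le_left)
    (fun x => (hs.summable x).hasSum.mul_left _) (hr.isWeight i).1
    (fun s x => by
      rw [← Finset.mul_sum, abs_of_nonneg
        (mul_nonneg (hr.nonneg i x) (Finset.sum_nonneg fun l _ => hs.nonneg l x))]
      exact mul_le_of_le_one_right (hr.nonneg i x) (hs.sum_le_one s x))
  rw [hT.lin_congr_of_pn hE (hr.precompact i) hσ (hr.germ_eq i) (hr.isWeight i) h1 fun z hz => by
    rw [(hs.hasSum_one z hz).tsum_eq, mul_one]]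
  exact h2 (p i)

theorem Current.LocRep.tsum_enorm_le (hE : MeasurableSet E) [Countable ι] (hσ : σ.IsCont)
    (hr : T.LocRep U p g σ) : ∑' i, ‖T.lin (isometry_incl (U i)) (g i) (p i)‖ₑ ≤
      ∫⁻ x, σ.pn x ∂T.mass := by
  calc ∑' i, ‖T.lin (isometry_incl (U i)) (g i) (p i)‖ₑ
      ≤ ∑' i, ∫⁻ x, ‖g i x‖ₑ * σ.pn x ∂T.mass := ENNReal.tsum_le_tsum fun i => by
        have := (hr.precompact i).secondCountableTopology
        exact hT.enorm_lin_le_lintegral_pn hE hσ (hr.germ_eq i) (hr.isWeight i)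
    _ = ∫⁻ x, ∑' i, ‖g i x‖ₑ * σ.pn x ∂T.mass := (lintegral_tsum fun i =>
        (hr.isWeight i).1.1.enorm.mul (hσ.measurable_pn hE).aemeasurable).symm
    _ ≤ ∫⁻ x, σ.pn x ∂T.mass := lintegral_mono fun x =>
        tsum_enorm_mul_le (fun i => hr.nonneg i x) (fun s => hr.sum_le_one s x) _

/-- The double family with weights $g_ih_l$ is absolutely summable by the integral bound for the
product representation. Summing over `l` first gives one side; replacing `p i` by `q l` on overlaps
and summing over `i` first gives the other. -/
theorem Current.LocRep.hasSum_unique (hE : MeasurableSet E) [Countable ι] [Countable κ]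
    (hσ : σ.IsCont) (hfin : ∫⁻ x, σ.pn x ∂T.mass < ∞) (hr : T.LocRep U p g σ)
    (hs : T.LocRep V q h σ) :
    HasSum (fun i => T.lin (isometry_incl (U i)) (g i) (p i))
      (∑' l, T.lin (isometry_incl (V l)) (h l) (q l)) := by
  have hw := fun i l => hr.mul_isWeight hs i l
  have hsum : Summable fun a : ι × κ =>
      T.lin (isometry_incl (U a.1)) (fun x => g a.1 x * h a.2 x) (p a.1) := by
    refine Summable.of_enorm ((Current.LocRep.tsum_enorm_le hT hE hσ (hr.prod hs)).trans_lt
      hfin).ne |>.congr fun a => ?_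
    exact (hT.lin_res inf_le_left (hw a.1 a.2) (p a.1))
  have e1 := hsum.hasSum.prod_fiberwise fun i => hr.hasSum_mul hT hE hσ hs i
  have e2 : HasSum (fun a : κ × ι => T.lin (isometry_incl (V a.1))
      (fun x => h a.1 x * g a.2 x) (q a.1))
      (∑' a : ι × κ, T.lin (isometry_incl (U a.1)) (fun x => g a.1 x * h a.2 x) (p a.1)) := by
    refine ((Equiv.prodComm κ ι).hasSum_iff.2 hsum.hasSum).congr_fun fun a => ?_
    simp only [Equiv.prodComm_apply, Function.comp_apply, Prod.fst_swap, Prod.snd_swap]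
    simp_rw [mul_comm (h a.1 _)]
    exact (hT.lin_eq_of_germ_eq hE (hr.precompact _) (fun z hz hz' => by
      rw [← hr.germ_eq, ← hs.germ_eq]) (hw a.2 a.1)).symm
  have e3 := e2.prod_fiberwise fun l => hs.hasSum_mul hT hE hσ hr l
  rw [e3.tsum_eq]
  exact e1

end value

/-! ### The value of a current on an integrable section over a Borel set -/

section value

variable {X : Type u} [MetricSpace X] {E : Set X} {k : ℕ} [MeasurableSpace X] [BorelSpace X]

/-- A continuous section over `E` which vanishes outside a compact subset of `X` and has
integrable pointwise norm. -/
structure Current.Admissible (T : Current k X) (σ : Sect k E) : Prop where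
  isCont : σ.IsCont
  compact : ∃ K : Set X, IsCompact K ∧ ∀ z : E, σ z ≠ 0 → (z : X) ∈ K
  lintegral_lt_top : ∫⁻ x, σ.pn x ∂T.mass < ∞

open Classical in
/-- The sum `∑ i, T.lin (g i) (p i)` over a local representation of `σ`. -/
def Current.value (T : Current k X) (σ : Sect k E) : ℝ :=
  if h : ∃ (U : ℕ → Opens E) (p : ∀ i, HPoly k (U i)) (g : ℕ → X → ℝ), T.LocRep U p g σ then
    ∑' i, T.lin (isometry_incl (h.choose i)) (h.choose_spec.choose_spec.choose i)
      (h.choose_spec.choose i) else 0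

omit [MeasurableSpace X] [BorelSpace X] in
theorem Sect.pn_add_le (σ τ : Sect k E) (x : X) : (σ + τ).pn x ≤ σ.pn x + τ.pn x := by
  by_cases hx : x ∈ E
  · rw [Sect.pn_apply _ ⟨x, hx⟩, Sect.pn_apply _ ⟨x, hx⟩, Sect.pn_apply _ ⟨x, hx⟩]
    exact Stalk.pnorm_add_le _ _
  · rw [Sect.pn_of_notMem _ hx]
    exact zero_le

omit [MeasurableSpace X] [BorelSpace X] in
theorem Sect.pn_smul_le (a : ℝ) (σ : Sect k E) (x : X) :
    (a • σ).pn x ≤ ENNReal.ofReal |a| * σ.pn x := by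
  by_cases hx : x ∈ E
  · rw [Sect.pn_apply _ ⟨x, hx⟩, Sect.pn_apply _ ⟨x, hx⟩]
    exact Stalk.pnorm_smul_le _ _
  · rw [Sect.pn_of_notMem _ hx]
    exact zero_le

omit [MeasurableSpace X] [BorelSpace X] in
theorem Sect.isCont_add {σ τ : Sect k E} (hσ : σ.IsCont) (hτ : τ.IsCont) : (σ + τ).IsCont :=
  add_mem (S := Submodule ℝ (Sect k E)) (s := Forms k E) hσ hτ

omit [MeasurableSpace X] [BorelSpace X] in
theorem Sect.isCont_smul {σ : Sect k E} (a : ℝ) (hσ : σ.IsCont) : (a • σ).IsCont :=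
  (Forms k E).smul_mem a hσ

theorem Sect.lintegral_pn_add_lt_top (hE : MeasurableSet E) {μ : Measure X} {σ τ : Sect k E}
    (hσ : σ.IsCont) (h1 : ∫⁻ x, σ.pn x ∂μ < ∞) (h2 : ∫⁻ x, τ.pn x ∂μ < ∞) :
    ∫⁻ x, (σ + τ).pn x ∂μ < ∞ := by
  refine (lintegral_mono (Sect.pn_add_le σ τ)).trans_lt ?_
  rw [lintegral_add_left (hσ.measurable_pn hE)]
  exact ENNReal.add_lt_top.2 ⟨h1, h2⟩

omit [BorelSpace X] in
theorem Sect.lintegral_pn_smul_lt_top {μ : Measure X} {σ : Sect k E} (a : ℝ)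
    (h1 : ∫⁻ x, σ.pn x ∂μ < ∞) : ∫⁻ x, (a • σ).pn x ∂μ < ∞ := by
  refine (lintegral_mono (Sect.pn_smul_le a σ)).trans_lt ?_
  rw [lintegral_const_mul' _ _ ENNReal.ofReal_ne_top]
  exact ENNReal.mul_lt_top ENNReal.ofReal_lt_top h1

omit [BorelSpace X] in
theorem Sect.setLIntegral_pn (hE : MeasurableSet E) (σ : Sect k E) (μ : Measure X) :
    ∫⁻ x in E, σ.pn x ∂μ = ∫⁻ x, σ.pn x ∂μ := by
  rw [← lintegral_indicator hE]
  congr 1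
  refine Set.indicator_eq_self.2 fun x hx => ?_
  by_contra h
  exact hx (σ.pn_of_notMem h)

variable {T : Current k X} {σ τ : Sect k E}

theorem Current.Admissible.add (hE : MeasurableSet E) (hσ : T.Admissible σ)
    (hτ : T.Admissible τ) : T.Admissible (σ + τ) := by
  obtain ⟨K, hK, h1⟩ := hσ.compact
  obtain ⟨L, hL, h2⟩ := hτ.compact
  refine ⟨Sect.isCont_add hσ.isCont hτ.isCont, ⟨K ∪ L, hK.union hL, fun z hz => ?_⟩,
    Sect.lintegral_pn_add_lt_top hE hσ.isCont hσ.lintegral_lt_top hτ.lintegral_lt_top⟩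
  by_contra hn
  rw [Set.mem_union, not_or] at hn
  refine hz ?_
  rw [Pi.add_apply, not_not.1 fun h => hn.1 (h1 z h), not_not.1 fun h => hn.2 (h2 z h), add_zero]

theorem Current.Admissible.smul (a : ℝ) (hσ : T.Admissible σ) : T.Admissible (a • σ) := by
  obtain ⟨K, hK, h1⟩ := hσ.compact
  refine ⟨Sect.isCont_smul a hσ.isCont, ⟨K, hK, fun z hz => h1 z fun h => hz ?_⟩,
    Sect.lintegral_pn_smul_lt_top a hσ.lintegral_lt_top⟩
  rw [Pi.smul_apply, h, smul_zero]

theorem Current.LocRep.add {ι : Type*} {U : ι → Opens E} {p q : ∀ i, HPoly k (U i)}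
    {g : ι → X → ℝ} (hr : T.LocRep U p g σ) (hs : T.LocRep U q g τ) :
    T.LocRep U (fun i => p i + q i) g (σ + τ) where
  precompact := hr.precompact
  germ_eq i z hz := by rw [map_add, Pi.add_apply, hr.germ_eq, hs.germ_eq]
  isWeight := hr.isWeight
  nonneg := hr.nonneg
  sum_le_one := hr.sum_le_one
  hasSum_one z hz := by
    by_cases h : σ z = 0
    · refine hs.hasSum_one z fun h' => hz ?_
      rw [Pi.add_apply, h, h', add_zero]
    · exact hr.hasSum_one z h

theorem Current.LocRep.smul {ι : Type*} {U : ι → Opens E} {p : ∀ i, HPoly k (U i)}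
    {g : ι → X → ℝ} (hr : T.LocRep U p g σ) (a : ℝ) :
    T.LocRep U (fun i => a • p i) g (a • σ) where
  precompact := hr.precompact
  germ_eq i z hz := by rw [map_smul, Pi.smul_apply, hr.germ_eq]
  isWeight := hr.isWeight
  nonneg := hr.nonneg
  sum_le_one := hr.sum_le_one
  hasSum_one z hz := hr.hasSum_one z fun h => hz (by rw [Pi.smul_apply, h, smul_zero])

variable [LocallyCompactSpace X] (hT : T.LocallyFiniteMass)
include hT

theorem Current.LocallyFiniteMass.isWeight_of_bounded {U : Opens E} (hU : PrecompactIn U)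
    {g : X → ℝ} (hm : Measurable g) {C : ℝ} (hC : ∀ x, |g x| ≤ C)
    (hs : ∀ x, g x ≠ 0 → x ∈ Set.range (incl U)) : T.IsWeight (incl U) g := by
  have := hT.regular
  refine ⟨?_, hs⟩
  refine IntegrableOn.integrable_of_forall_notMem_eq_zero
    (s := closure (Subtype.val '' (U : Set E))) ?_ fun x hx => ?_
  · exact Measure.integrableOn_of_bounded hU.measure_lt_top.ne hm.aestronglyMeasurable
      (M := C) (ae_of_all _ hC)
  · by_contra h
    refine hx (subset_closure ?_)
    rw [← range_incl]
    exact hs x h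

/-- Borel weights suffice for evaluation, so indicators of a disjointed countable cover replace a
partition of unity. Two sections are represented on one cover with the same weights because
additivity of the value needs this. -/
theorem Current.LocallyFiniteMass.exists_locRep (hE : MeasurableSet E) (hσ : σ.IsCont)
    (hτ : τ.IsCont) {K : Set X} (hK : IsCompact K) (hσK : ∀ z : E, σ z ≠ 0 → (z : X) ∈ K)
    (hτK : ∀ z : E, τ z ≠ 0 → (z : X) ∈ K) :
    ∃ (U : ℕ → Opens E) (p q : ∀ i, HPoly k (U i)) (g : ℕ → X → ℝ),
      T.LocRep U p g σ ∧ T.LocRep U q g τ := by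
  obtain ⟨U, hU, hc⟩ := exists_seq_cover (E := E) (P := fun U => PrecompactIn U ∧
      (∃ p : HPoly k U, ∀ z (hz : z ∈ U), σ z = germ U hz p) ∧
      ∃ q : HPoly k U, ∀ z (hz : z ∈ U), τ z = germ U hz q)
    ⟨precompactIn_bot, ⟨0, fun _ hz => hz.elim⟩, ⟨0, fun _ hz => hz.elim⟩⟩ (fun z => by
      obtain ⟨U, hU, hUc⟩ := exists_precompactIn z
      obtain ⟨V, hV, p, hp⟩ := Sect.isCont_iff.1 hσ z
      obtain ⟨W, hW, q, hq⟩ := Sect.isCont_iff.1 hτ z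
      have h1 : U ⊓ V ⊓ W ≤ V := inf_le_left.trans inf_le_right
      have h2 : U ⊓ V ⊓ W ≤ W := inf_le_right
      refine ⟨U ⊓ V ⊓ W, ⟨⟨hU, hV⟩, hW⟩, hUc.mono (inf_le_left.trans inf_le_left),
        ⟨HPoly.res h1 p, fun w hw => ?_⟩, ⟨HPoly.res h2 q, fun w hw => ?_⟩⟩
      · rw [germ_res, hp w (h1 hw)]
      · rw [germ_res, hq w (h2 hw)]) hK
  choose hUc hp hq using hU
  choose p hp using hp
  choose q hq using hq
  let A : ℕ → Set X := fun n => Set.range (incl (U n))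
  have hA : ∀ n, MeasurableSet (disjointed A n) :=
    MeasurableSet.disjointed fun n => measurableSet_range_incl hE _
  let g : ℕ → X → ℝ := fun n => (disjointed A n).indicator fun _ => 1
  have hg0 : ∀ i x, 0 ≤ g i x := fun i x => Set.indicator_nonneg (fun _ _ => zero_le_one) x
  have hgw : ∀ i, T.IsWeight (incl (U i)) (g i) := fun i =>
    hT.isWeight_of_bounded (hUc i) (measurable_const.indicator (hA i)) (C := 1) (fun x => by
        rw [abs_of_nonneg (hg0 i x)]
        exact Set.indicator_le_self' (fun _ _ => zero_le_one) x) fun x hx =>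
      disjointed_subset A i (Set.mem_of_indicator_ne_zero hx)
  have hgs : ∀ (s : Finset ℕ) x, ∑ i ∈ s, g i x ≤ 1 := by
    intro s x
    have : ∑ i ∈ s, g i x = (⋃ i ∈ s, disjointed A i).indicator (fun _ => 1) x := by
      rw [Finset.indicator_biUnion_apply _ _ fun a _ b _ hab => disjoint_disjointed A hab]
    rw [this]
    exact Set.indicator_le_self' (fun _ _ => zero_le_one) x
  have hg1 : ∀ z : E, (z : X) ∈ K → HasSum (fun i => g i z) 1 := by
    intro z hz
    have : (z : X) ∈ ⋃ n, disjointed A n := by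
      rw [iUnion_disjointed]
      exact Set.mem_iUnion.2 (hc z ⟨z.2, hz⟩)
    obtain ⟨n, hn⟩ := Set.mem_iUnion.1 this
    have h := hasSum_single (f := fun i => g i z) n fun m hm =>
      Set.indicator_of_notMem (fun h => (disjoint_disjointed A hm).le_bot ⟨h, hn⟩) _
    have e : g n z = 1 := Set.indicator_of_mem hn _
    rwa [e] at h
  exact ⟨U, p, q, g, ⟨hUc, hp, hgw, hg0, hgs, fun z hz => hg1 z (hσK z hz)⟩,
    ⟨hUc, hq, hgw, hg0, hgs, fun z hz => hg1 z (hτK z hz)⟩⟩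

theorem Current.LocRep.hasSum_value (hE : MeasurableSet E) (hσ : T.Admissible σ) {ι : Type*}
    [Countable ι] {U : ι → Opens E} {p : ∀ i, HPoly k (U i)} {g : ι → X → ℝ}
    (hr : T.LocRep U p g σ) :
    HasSum (fun i => T.lin (isometry_incl (U i)) (g i) (p i)) (T.value σ) := by
  obtain ⟨K, hK, hσK⟩ := hσ.compact
  have h : ∃ (U : ℕ → Opens E) (p : ∀ i, HPoly k (U i)) (g : ℕ → X → ℝ), T.LocRep U p g σ := by
    obtain ⟨U, p, -, g, h, -⟩ := hT.exists_locRep hE hσ.isCont hσ.isCont hK hσK hσK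
    exact ⟨U, p, g, h⟩
  rw [Current.value, dif_pos h]
  exact hr.hasSum_unique hT hE hσ.isCont hσ.lintegral_lt_top h.choose_spec.choose_spec.choose_spec

theorem Current.LocallyFiniteMass.value_add (hE : MeasurableSet E) (hσ : T.Admissible σ)
    (hτ : T.Admissible τ) : T.value (σ + τ) = T.value σ + T.value τ := by
  obtain ⟨K, hK, h1⟩ := hσ.compact
  obtain ⟨L, hL, h2⟩ := hτ.compact
  obtain ⟨U, p, q, g, hr, hs⟩ := hT.exists_locRep hE hσ.isCont hτ.isCont (hK.union hL)
    (fun z hz => Or.inl (h1 z hz)) fun z hz => Or.inr (h2 z hz)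
  refine ((hr.add hs).hasSum_value hT hE (hσ.add hE hτ)).unique ?_
  simpa only [map_add] using (hr.hasSum_value hT hE hσ).add (hs.hasSum_value hT hE hτ)

theorem Current.LocallyFiniteMass.value_smul (hE : MeasurableSet E) (a : ℝ)
    (hσ : T.Admissible σ) : T.value (a • σ) = a * T.value σ := by
  obtain ⟨K, hK, h1⟩ := hσ.compact
  obtain ⟨U, p, q, g, hr, -⟩ := hT.exists_locRep hE hσ.isCont hσ.isCont hK h1 h1
  refine ((hr.smul a).hasSum_value hT hE (hσ.smul a)).unique ?_
  simpa only [map_smul, smul_eq_mul] using (hr.hasSum_value hT hE hσ).mul_left a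

theorem Current.LocallyFiniteMass.enorm_value_le (hE : MeasurableSet E)
    (hσ : T.Admissible σ) : ‖T.value σ‖ₑ ≤ ∫⁻ x, σ.pn x ∂T.mass := by
  obtain ⟨K, hK, h1⟩ := hσ.compact
  obtain ⟨U, p, q, g, hr, -⟩ := hT.exists_locRep hE hσ.isCont hσ.isCont hK h1 h1
  rw [← (hr.hasSum_value hT hE hσ).tsum_eq]
  exact enorm_tsum_le_tsum_enorm.trans (hr.tsum_enorm_le hT hE hσ.isCont)

end value

/-! ### Restriction of sections to a subset and the domain of the functional -/

section restriction

variable {X : Type u} [MetricSpace X] (E : Set X) {k : ℕ}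

theorem Stalk.restrict_germ (z : E) (U : Opens X) (hz : (z : X) ∈ U) (p : HPoly k U) :
    Stalk.restrict E z (germ U hz p) = germ (relOpen E U) (y := z) hz (HPoly.toRelOpen E U p) := by
  classical
  exact Module.DirectLimit.lift_of _ _ _

theorem Stalk.pnorm_restrict_le (z : E) (g : Stalk k (z : X)) :
    (Stalk.restrict E z g).pnorm ≤ g.pnorm := by
  conv_rhs => unfold Stalk.pnorm
  refine le_iInf₂ fun U hz => le_iInf₂ fun p hp => le_iInf₂ fun r hr => ?_
  rw [← hp, Stalk.restrict_germ]
  exact (Stalk.pnorm_le _ _ _ hr).trans (HPoly.lipOn_pull_le _ p fun y hy => hy)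

theorem Sect.IsCont.restrict {ω : Sect k X} (hω : ω.IsCont) : (Sect.restrict E ω).IsCont := by
  refine Sect.isCont_iff.2 fun z => ?_
  obtain ⟨U, hU, p, hp⟩ := Sect.isCont_iff.1 hω z
  refine ⟨relOpen E U, hU, HPoly.toRelOpen E U p, fun w hw => ?_⟩
  rw [← Stalk.restrict_germ E w U hw, ← hp w hw]
  rfl

theorem Sect.pnormOn_le (ω : Sect k X) (x : X) : Sect.pnormOn E ω x ≤ (ω x).pnorm := by
  by_cases hx : x ∈ E
  · rw [Sect.pnormOn_eq, Sect.pn_apply _ ⟨x, hx⟩]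
    exact Stalk.pnorm_restrict_le E ⟨x, hx⟩ _
  · rw [Sect.pnormOn_eq, Sect.pn_of_notMem _ hx]
    exact zero_le

/-- The sets where the norm is less than `n` are open, increasing in `n` and cover the space, since
every germ has finite norm. -/
theorem Sect.IsCont.exists_pnorm_le {Y : Type u} [MetricSpace Y] {σ : Sect k Y} (hσ : σ.IsCont)
    {K : Set Y} (hK : IsCompact K) : ∃ C : ℝ≥0∞, C < ∞ ∧ ∀ y ∈ K, (σ y).pnorm ≤ C := by
  have h := hK.elim_directed_cover (fun n : ℕ => {y | (σ y).pnorm < n})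
    (fun n => hσ.isOpen_pnorm_lt n) (fun y _ => ?_) (directed_of_isDirected_le fun m n hmn y hy =>
      lt_of_lt_of_le (b := (m : ℝ≥0∞)) hy (Nat.cast_le.2 hmn))
  · obtain ⟨n, hn⟩ := h
    exact ⟨n, ENNReal.natCast_lt_top n, fun y hy => (hn hy).le⟩
  · obtain ⟨n, hn⟩ := ENNReal.exists_nat_gt (σ y).pnorm_lt_top.ne
    exact Set.mem_iUnion.2 ⟨n, hn⟩

theorem Sect.pnorm_eq_zero_of_notMem {Y : Type u} [MetricSpace Y] {σ : Sect k Y} {y : Y}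
    (hy : y ∉ σ.support) : (σ y).pnorm = 0 := by
  have : σ y = 0 := by
    by_contra h
    exact hy (subset_closure h)
  rw [this, Stalk.pnorm_zero]

variable [MeasurableSpace X] [BorelSpace X]

theorem FormsC.lintegral_pnorm_lt_top {μ : Measure X} [IsFiniteMeasureOnCompacts μ]
    (ω : FormsC k X) : ∫⁻ x, (ω.1 x).pnorm ∂μ < ∞ := by
  have hK : IsCompact (Sect.support ω.1) := ω.2.2
  obtain ⟨C, hC, h⟩ := Sect.IsCont.exists_pnorm_le (σ := ω.1) ω.2.1 hK
  calc ∫⁻ x, (ω.1 x).pnorm ∂μ ≤ ∫⁻ x, (Sect.support ω.1).indicator (fun _ => C) x ∂μ := by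
        refine lintegral_mono fun x => ?_
        by_cases hx : x ∈ Sect.support ω.1
        · rw [Set.indicator_of_mem hx]
          exact h x hx
        · rw [Set.indicator_of_notMem hx]
          exact (Sect.pnorm_eq_zero_of_notMem hx).le
    _ = C * μ (Sect.support ω.1) := by
        have : MeasurableSet (Sect.support ω.1) := isClosed_closure.measurableSet
        rw [lintegral_indicator_const this]
    _ < ∞ := ENNReal.mul_lt_top hC hK.measure_lt_top

variable {E} {T : Current k X}

theorem admissible_restrict (hE : MeasurableSet E) {ω : Sect k X} (hω : ω ∈ SectEC k E)
    (hfin : ∫⁻ x in E, Sect.pnormOn E ω x ∂T.mass < ∞) : T.Admissible (Sect.restrict E ω) where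
  isCont := hω.1
  compact := ⟨ω.support, hω.2, fun z hz => subset_closure fun h => hz (by
    change Stalk.restrict E z (ω z) = 0
    rw [h, map_zero])⟩
  lintegral_lt_top := by
    rwa [← Sect.setLIntegral_pn hE]

/-- The sections on which `T⌊E` can be evaluated. -/
def Current.domain (T : Current k X) (hE : MeasurableSet E) : Submodule ℝ (Sect k X) where
  carrier := {ω | ω ∈ SectEC k E ∧ ∫⁻ x in E, Sect.pnormOn E ω x ∂T.mass < ∞}
  add_mem' := by
    rintro ω η ⟨h1, h2⟩ ⟨h3, h4⟩
    refine ⟨add_mem h1 h3, ?_⟩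
    rw [Sect.pnormOn_eq, map_add, Sect.setLIntegral_pn hE]
    exact ((admissible_restrict hE h1 h2).add hE (admissible_restrict hE h3 h4)).lintegral_lt_top
  zero_mem' := by
    refine ⟨zero_mem _, ?_⟩
    have : ∀ x, Sect.pnormOn E (0 : Sect k X) x = 0 := fun x => by
      rw [Sect.pnormOn_eq, map_zero]
      exact Sect.pn_eq_zero fun _ => rfl
    simp [this]
  smul_mem' := by
    rintro a ω ⟨h1, h2⟩
    refine ⟨(SectEC k E).smul_mem a h1, ?_⟩
    rw [Sect.pnormOn_eq, map_smul, Sect.setLIntegral_pn hE]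
    exact ((admissible_restrict hE h1 h2).smul a).lintegral_lt_top

variable [LocallyCompactSpace X] (hT : T.LocallyFiniteMass)
include hT

/-- For closed `E` the part of the support lying in `E` is compact in `E`, so the norm of the
restricted section is bounded there, and the support has finite mass. -/
theorem Current.LocallyFiniteMass.domain_eq (hE : MeasurableSet E) (hc : IsClosed E) :
    T.domain hE = SectEC k E := by
  have := hT.regular
  refine le_antisymm (fun ω h => h.1) fun ω h => ⟨h, ?_⟩
  have hK : IsCompact (Subtype.val ⁻¹' ω.support : Set E) :=
    hc.isClosedEmbedding_subtypeVal.isCompact_preimage h.2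
  obtain ⟨C, hC, hle⟩ := Sect.IsCont.exists_pnorm_le (σ := Sect.restrict E ω) h.1 hK
  have hKm : MeasurableSet ω.support := isClosed_closure.measurableSet
  rw [Sect.pnormOn_eq, Sect.setLIntegral_pn hE]
  calc ∫⁻ x, (Sect.restrict E ω).pn x ∂T.mass
      ≤ ∫⁻ x, ω.support.indicator (fun _ => C) x ∂T.mass := by
        refine lintegral_mono fun x => ?_
        by_cases hx : x ∈ ω.support
        · rw [Set.indicator_of_mem hx]
          by_cases hxE : x ∈ E
          · rw [Sect.pn_apply _ ⟨x, hxE⟩]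
            exact hle ⟨x, hxE⟩ hx
          · rw [Sect.pn_of_notMem _ hxE]
            exact zero_le
        · rw [Set.indicator_of_notMem hx]
          exact (Sect.pnormOn_le E ω x).trans (Sect.pnorm_eq_zero_of_notMem hx).le
    _ = C * T.mass ω.support := by rw [lintegral_indicator_const hKm]
    _ < ∞ := ENNReal.mul_lt_top hC (IsCompact.measure_lt_top h.2)

theorem Current.LocallyFiniteMass.formsC_le_domain (hE : MeasurableSet E) :
    FormsC k X ≤ T.domain hE := by
  have := hT.regular
  refine fun ω h => ⟨⟨Sect.IsCont.restrict E h.1, h.2⟩, ?_⟩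
  exact ((setLIntegral_le_lintegral _ _).trans (lintegral_mono (Sect.pnormOn_le E ω))).trans_lt
    (FormsC.lintegral_pnorm_lt_top ⟨ω, h⟩)

/-- The functional `T̂_E`. -/
def Current.LocallyFiniteMass.evalOn (hE : MeasurableSet E) : T.domain hE →ₗ[ℝ] ℝ where
  toFun ω := T.value (Sect.restrict E ω.1)
  map_add' ω η := by
    rw [Submodule.coe_add, map_add]
    exact hT.value_add hE (admissible_restrict hE ω.2.1 ω.2.2) (admissible_restrict hE η.2.1 η.2.2)
  map_smul' a ω := by
    rw [Submodule.coe_smul, map_smul]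
    exact hT.value_smul hE a (admissible_restrict hE ω.2.1 ω.2.2)

theorem Current.LocallyFiniteMass.abs_evalOn_le (hE : MeasurableSet E) (ω : T.domain hE) :
    ENNReal.ofReal |hT.evalOn hE ω| ≤ ∫⁻ x in E, Sect.pnormOn E ω.1 x ∂T.mass := by
  rw [← Real.enorm_eq_ofReal_abs, Sect.pnormOn_eq, Sect.setLIntegral_pn hE]
  exact hT.enorm_value_le hE (admissible_restrict hE ω.2.1 ω.2.2)

/-- A single open set represents the whole form: the trace on `E` of the interior of a compact
neighbourhood of the support of `f`, with its indicator as weight. Multiplied by `f`, this weight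
becomes $\chi_Ef$. -/
theorem Current.LocallyFiniteMass.evalOn_toForm (hE : MeasurableSet E) (f : LipC X)
    (π : Fin k → BLip X) :
    hT.evalOn hE ⟨(toForm f π).1, hT.formsC_le_domain hE (toForm f π).2⟩ = T.restrict E f π := by
  have hf : IsCompact (tsupport (f.1 : X → ℝ)) := f.2
  obtain ⟨K, hK, hfK⟩ := exists_compact_superset hf
  let V : Opens X := ⟨interior K, isOpen_interior⟩
  let U : Opens E := relOpen E V
  have hU : PrecompactIn U := by
    refine hK.of_isClosed_subset isClosed_closure (closure_minimal ?_ hK.isClosed)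
    rintro _ ⟨w, hw, rfl⟩
    exact interior_subset hw
  let F : Fin (k + 1) → BLip X := Fin.cons f.1 π
  let p : HPoly k U := HPoly.tensor fun i => BLip.comp (incl U) (isometry_incl U).lipschitz (F i)
  have hm : MeasurableSet (E ∩ interior K) := hE.inter isOpen_interior.measurableSet
  let g : X → ℝ := (E ∩ interior K).indicator fun _ => 1
  have hg0 : ∀ x, 0 ≤ g x := fun x => Set.indicator_nonneg (fun _ _ => zero_le_one) x
  have hg1 : ∀ x, g x ≤ 1 := fun x => Set.indicator_le_self' (fun _ _ => zero_le_one) x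
  have hadm := admissible_restrict hE (hT.formsC_le_domain hE (toForm f π).2).1
    (hT.formsC_le_domain hE (toForm f π).2).2
  have hw : T.IsWeight (incl U) g := hT.isWeight_of_bounded hU (measurable_const.indicator hm)
    (C := 1) (fun x => by rw [abs_of_nonneg (hg0 x)]; exact hg1 x) fun x hx => by
      have := Set.mem_of_indicator_ne_zero hx
      exact mem_range_incl.2 ⟨this.1, this.2⟩
  have hr : T.LocRep (fun _ : Unit => U) (fun _ => p) (fun _ => g)
      (Sect.restrict E (toForm f π).1) := by
    refine ⟨fun _ => hU, fun _ z hz => ?_, fun _ => hw, fun _ => hg0, fun s x => ?_,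
      fun z hz => ?_⟩
    · change Stalk.restrict E z (HPoly.toSect (HPoly.tensor F) z) = _
      have hz' : (z : X) ∈ V := hz
      rw [HPoly.germ_toSect _ V hz', Stalk.restrict_germ, HPoly.pull_tensor,
        HPoly.toRelOpen, HPoly.pull_tensor]
      rfl
    · rw [Finset.sum_const, nsmul_eq_mul]
      refine mul_le_one₀ ?_ (hg0 x) (hg1 x)
      exact_mod_cast Finset.card_le_one.2 fun a _ b _ => rfl
    · have hz' : (z : X) ∈ tsupport (f.1 : X → ℝ) := by
        by_contra hn
        refine hz ?_
        change Stalk.restrict E z (HPoly.toSect (HPoly.tensor F) z) = 0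
        have hV : ∀ x ∈ (⟨(tsupport (f.1 : X → ℝ))ᶜ, (isClosed_tsupport _).isOpen_compl⟩ : Opens X),
            F 0 x = 0 := fun x hx => image_eq_zero_of_notMem_tsupport hx
        rw [HPoly.germ_toSect _ ⟨(tsupport (f.1 : X → ℝ))ᶜ, (isClosed_tsupport _).isOpen_compl⟩ hn,
          HPoly.pull_tensor_eq_zero hV, map_zero, map_zero]
      have : g z = 1 :=
        Set.indicator_of_mem (s := E ∩ interior K) ⟨z.2, hfK hz'⟩ fun _ => (1 : ℝ)
      simp only [this]
      exact hasSum_unique _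
  have h := hr.hasSum_value hT hE hadm
  refine (h.unique (hasSum_unique _)).trans ?_
  rw [hT.lin_tensor (isometry_incl U) hw F, Current.restrict]
  congr 1
  funext x
  change g x * f.1 x = _
  by_cases hx : x ∈ E
  · rw [Set.indicator_of_mem hx]
    by_cases hxf : f.1 x = 0
    · rw [hxf, mul_zero]
    · have : g x = 1 := Set.indicator_of_mem (s := E ∩ interior K)
        ⟨hx, hfK (subset_tsupport _ hxf)⟩ fun _ => (1 : ℝ)
      rw [this, one_mul]
  · have : g x = 0 := Set.indicator_of_notMem (fun h => hx h.1) _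
    rw [this, zero_mul, Set.indicator_of_notMem hx]

end restriction

/-! ### Linearizations, and the sum over a partition of unity -/

section linearization

variable {X : Type u} [MetricSpace X] {E : Set X} {k : ℕ}

/-- The extension by zero of a function on `E`. -/
def extZero (φ : BLip E) : X → ℝ := Function.extend Subtype.val φ 0

theorem extZero_apply (φ : BLip E) (z : E) : extZero φ z = φ z :=
  Subtype.val_injective.extend_apply _ _ z

theorem extZero_of_notMem (φ : BLip E) {x : X} (hx : x ∉ E) : extZero φ x = 0 :=
  Function.extend_apply' _ _ _ fun ⟨z, hz⟩ => hx (hz ▸ z.2)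

theorem abs_extZero_le (φ : BLip E) (x : X) : |extZero φ x| ≤ ‖φ‖ := by
  by_cases hx : x ∈ E
  · exact (congrArg abs (extZero_apply φ ⟨x, hx⟩)).trans_le (φ.abs_le_norm _)
  · rw [extZero_of_notMem φ hx, abs_zero]
    exact norm_nonneg _

theorem mem_range_incl_of_extZero_ne_zero {U : Opens E} {φ : BLip E}
    (hφ : tsupport (φ : E → ℝ) ⊆ U) {x : X} (hx : extZero φ x ≠ 0) : x ∈ Set.range (incl U) := by
  have hxE : x ∈ E := by
    by_contra h
    exact hx (extZero_of_notMem φ h)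
  refine mem_range_incl.2 ⟨hxE, hφ (subset_tsupport _ ?_)⟩
  rwa [Function.mem_support, ← extZero_apply φ ⟨x, hxE⟩]

theorem zeroExt_eq {U : Opens E} {φ : BLip E} (hφ : tsupport (φ : E → ℝ) ⊆ U) (F : BLip X) :
    zeroExt U φ (BLip.comp (incl U) (isometry_incl U).lipschitz F) =
      fun x => extZero φ x * F x := by
  funext x
  unfold zeroExt
  split_ifs with h
  · rw [← extZero_apply φ ⟨x, h.1⟩]
    rfl
  · have : extZero φ x = 0 := by
      by_contra hx
      exact h (mem_range_incl.1 (mem_range_incl_of_extZero_ne_zero hφ hx))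
    rw [this, zero_mul]

variable [MeasurableSpace X] [BorelSpace X] {T : Current k X}

theorem measurable_extZero (hE : MeasurableSet E) (φ : BLip E) : Measurable (extZero φ) :=
  (MeasurableEmbedding.subtype_coe hE).measurable_extend φ.continuous.measurable measurable_const

theorem Current.isLinearization_iff {U : Opens E} {φ : BLip E} (hφ : tsupport (φ : E → ℝ) ⊆ U)
    {A : HPoly k U →L[ℝ] ℝ} : T.IsLinearization E U φ A ↔ ∀ F : Fin (k + 1) → BLip X,
      A (HPoly.tensor fun i => BLip.comp (incl U) (isometry_incl U).lipschitz (F i)) =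
        T.borelExt (fun x => extZero φ x * F 0 x) (Fin.tail F) := by
  have key : ∀ F : Fin (k + 1) → BLip X,
      (fun i => BLip.comp (incl U) (isometry_incl U).lipschitz (F i)) =
        Fin.cons (BLip.comp (incl U) (isometry_incl U).lipschitz (F 0))
          fun i => resBLip U (Fin.tail F i) := by
    intro F
    funext i
    refine Fin.cases rfl (fun i => rfl) i
  constructor
  · intro h F
    rw [← zeroExt_eq hφ, ← h, key]
  · intro h f π
    obtain ⟨F, rfl, -⟩ := BLip.exists_comp_eq (isometry_incl U) f
    rw [zeroExt_eq hφ]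
    have := h (Fin.cons F π)
    rwa [key] at this

variable [LocallyCompactSpace X] (hT : T.LocallyFiniteMass)
include hT

theorem Current.LocallyFiniteMass.isWeight_extZero (hE : MeasurableSet E) {U : Opens E}
    (hU : PrecompactIn U) {φ : BLip E} (hφ : tsupport (φ : E → ℝ) ⊆ U) :
    T.IsWeight (incl U) (extZero φ) :=
  hT.isWeight_of_bounded hU (measurable_extZero hE φ) (abs_extZero_le φ)
    fun _ => mem_range_incl_of_extZero_ne_zero hφ

theorem Current.LocallyFiniteMass.isLinearization_iff_eq (hE : MeasurableSet E) {U : Opens E}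
    (hU : PrecompactIn U) {φ : BLip E} (hφ : tsupport (φ : E → ℝ) ⊆ U) {A : HPoly k U →L[ℝ] ℝ} :
    T.IsLinearization E U φ A ↔ A = T.lin (isometry_incl U) (extZero φ) := by
  have hw := hT.isWeight_extZero hE hU hφ
  rw [Current.isLinearization_iff hφ]
  constructor
  · exact fun h => hT.lin_unique (isometry_incl U) hw h
  · rintro rfl
    exact hT.lin_tensor (isometry_incl U) hw

theorem Current.LocallyFiniteMass.existsUnique_linearization (hE : MeasurableSet E) {U : Opens E}
    (hU : PrecompactIn U) {φ : BLip E} (hφ : tsupport (φ : E → ℝ) ⊆ U) :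
    ∃! A : HPoly k U →L[ℝ] ℝ, T.IsLinearization E U φ A :=
  ⟨_, (hT.isLinearization_iff_eq hE hU hφ).2 rfl, fun _ hA =>
    (hT.isLinearization_iff_eq hE hU hφ).1 hA⟩

theorem Current.LocallyFiniteMass.linearization_eq (hE : MeasurableSet E) {U : Opens E}
    (hU : PrecompactIn U) {φ : BLip E} (hφ : tsupport (φ : E → ℝ) ⊆ U) :
    T.linearization E U φ = T.lin (isometry_incl U) (extZero φ) := by
  have h := (hT.existsUnique_linearization hE hU hφ).exists
  rw [Current.linearization, dif_pos h]
  exact (hT.isLinearization_iff_eq hE hU hφ).1 h.choose_spec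

omit [MeasurableSpace X] [BorelSpace X] [LocallyCompactSpace X] hT in
-- Compatibility asks for the germ of only one member of the family at each point; agreement on
-- overlaps gives it for all members containing the point.
theorem OverlapCompatible.germ_eq {Y : Type u} [MetricSpace Y] {ι : Type u} {U : ι → Opens Y}
    {p : ∀ i, HPoly k (U i)} {σ : Sect k Y} (h : OverlapCompatible U p σ) (i : ι) (z : Y)
    (hz : z ∈ U i) : σ z = germ (U i) hz (p i) := by
  obtain ⟨j, hj, e⟩ := h.2.2.1 z
  have hz' : z ∈ U i ⊓ U j := ⟨hz, hj⟩
  rw [e, ← germ_res (inf_le_right : U i ⊓ U j ≤ U j) hz', ← h.2.2.2 i j, germ_res]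

omit [MeasurableSpace X] [BorelSpace X] [LocallyCompactSpace X] hT in
theorem LipPartition.hasSum {Y : Type u} [MetricSpace Y] {ι : Type u} {U : ι → Opens Y}
    {φ : ι → BLip Y} (h : LipPartition U φ) (hU : LocallyFinite fun i => (U i : Set Y)) (y : Y) :
    HasSum (fun i => φ i y) 1 := by
  have hf : (Function.support fun i => φ i y).Finite :=
    (hU.point_finite y).subset fun i hi => h.2.1 i (subset_tsupport _ hi)
  rw [← h.2.2 y, finsum_eq_sum_of_support_subset _ (s := hf.toFinset) (by simp)]
  exact hasSum_sum_of_ne_finset_zero fun i hi => by simpa using hi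

/-- The functions of the partition, extended by zero, are admissible weights. Only countably many
members of the cover meet the compact set carrying the section; for the remaining ones the weight
may be replaced by zero, so discarding them leaves a countable local representation. -/
theorem Current.LocallyFiniteMass.hasSum_linearization (hE : MeasurableSet E) {σ : Sect k E}
    (hσ : T.Admissible σ) {ι : Type u} {U : ι → Opens E} {p : ∀ i, HPoly k (U i)}
    {φ : ι → BLip E} (hU : ∀ i, PrecompactIn (U i)) (hp : OverlapCompatible U p σ)
    (hφ : LipPartition U φ) :
    HasSum (fun i => T.linearization E (U i) (φ i) (p i)) (T.value σ) := by
  obtain ⟨K, hK, hσK⟩ := hσ.compact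
  have hw := fun i => hT.isWeight_extZero hE (hU i) (hφ.2.1 i)
  let J : Set ι := {i | ∃ x ∈ K, x ∈ Set.range (incl (U i))}
  have hJ : J.Countable := countable_setOf_inter_nonempty hp.1 hK
  have hmemJ : ∀ i (z : E), (z : X) ∈ K → extZero (φ i) z ≠ 0 → i ∈ J := fun i z hz h =>
    ⟨z, hz, mem_range_incl_of_extZero_ne_zero (hφ.2.1 i) h⟩
  have := hJ.to_subtype
  have hr : T.LocRep (fun i : J => U i) (fun i => p i) (fun i => extZero (φ i)) σ := by
    have hnn : ∀ (i : ι) (x : X), 0 ≤ extZero (φ i) x := by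
      intro i x
      by_cases hx : x ∈ E
      · exact (hφ.1 i ⟨x, hx⟩).trans_eq (extZero_apply _ ⟨x, hx⟩).symm
      · exact (extZero_of_notMem _ hx).ge
    refine ⟨fun i => hU i, fun i => hp.germ_eq i, fun i => hw i, fun i => hnn i, fun s x => ?_,
      fun z hz => ?_⟩
    · by_cases hx : x ∈ E
      · have h := sum_le_hasSum (s.map (Function.Embedding.subtype _)) (fun i _ => hφ.1 i ⟨x, hx⟩)
          (hφ.hasSum hp.1 ⟨x, hx⟩)
        rw [Finset.sum_map] at h
        refine (Finset.sum_congr rfl fun i _ => ?_).trans_le h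
        exact extZero_apply (φ i) ⟨x, hx⟩
      · rw [Finset.sum_eq_zero fun i _ => extZero_of_notMem _ hx]
        exact zero_le_one
    · have h := hφ.hasSum hp.1 z
      simp_rw [← extZero_apply] at h
      exact (hasSum_subtype_iff_of_support_subset (f := fun i => extZero (φ i) z)
        fun i hi => hmemJ i z (hσK z hz) hi).2 h
  have h := hr.hasSum_value hT hE hσ
  have e : ∀ i, T.linearization E (U i) (φ i) (p i) =
      T.lin (isometry_incl (U i)) (extZero (φ i)) (p i) := fun i => by
    rw [hT.linearization_eq hE (hU i) (hφ.2.1 i)]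
  simp_rw [e]
  refine (hasSum_subtype_iff_of_support_subset (s := J) fun i hi => ?_).1 h
  by_contra hn
  refine hi ?_
  dsimp only
  rw [hT.lin_congr_of_pn hE (hU i) hσ.isCont (hp.germ_eq i) (hw i)
    (T.isWeight_zero _) fun z hz => ?_, hT.lin_zero]
  · rfl
  · by_contra h
    exact hn (hmemJ i z (hσK z hz) h)

end linearization

/-! ### Existence of overlap-compatible families -/

section families

variable {k : ℕ} {Y : Type u} [MetricSpace Y]

theorem HPoly.eq_zero_of_isEmpty [IsEmpty Y] (p : HPoly k Y) : p = 0 := by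
  obtain ⟨r, hr⟩ := HPoly.exists_represents p
  have h := (HPoly.represents_iff.1 hr).2
  have e : (fun j => HPoly.tensor (r j)) = fun _ => (0 : HPoly k Y) := by
    funext j
    exact HPoly.tensor_eq_zero (BLip.ext fun x => isEmptyElim x)
  rw [e] at h
  exact h.unique hasSum_zero

/-- A continuous section is given by a family of functions on neighbourhoods `N x` of the
points `x`, which coincide on all overlaps. -/
theorem Sect.IsCont.exists_compatible {σ : Sect k Y} (hσ : σ.IsCont) {P : Opens Y → Prop}
    (hPm : ∀ U V, U ≤ V → P V → P U) (hP : ∀ y, ∃ U, y ∈ U ∧ P U) :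
    ∃ (N : Y → Opens Y) (s : ∀ x, HPoly k (N x)), (∀ x, x ∈ N x) ∧ (∀ x, P (N x)) ∧
      (∀ x z (hz : z ∈ N x), σ z = germ (N x) hz (s x)) ∧
      ∀ x y, HPoly.res (inf_le_left : N x ⊓ N y ≤ N x) (s x) =
        HPoly.res (inf_le_right : N x ⊓ N y ≤ N y) (s y) := by
  have h0 : ∀ y, ∃ U : Opens Y, y ∈ U ∧ P U ∧ ∃ p : HPoly k U,
      ∀ z (hz : z ∈ U), σ z = germ U hz p := by
    intro y
    obtain ⟨U, hU, hUP⟩ := hP y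
    obtain ⟨V, hV, p, hp⟩ := Sect.isCont_iff.1 hσ y
    refine ⟨U ⊓ V, ⟨hU, hV⟩, hPm _ _ inf_le_left hUP, HPoly.res inf_le_right p, fun z hz => ?_⟩
    rw [germ_res, hp z hz.2]
  choose V₀ hyV hVP p hp using h0
  obtain ⟨v, hvo, hvc, hvf, hvV⟩ := precise_refinement (fun y => (V₀ y : Set Y))
    (fun y => (V₀ y).isOpen) (Set.iUnion_eq_univ_iff.2 fun y => ⟨y, hyV y⟩)
  -- The shrunk cover has closures inside the refined one, so membership in a closure still provides
  -- a representative near the point.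
  obtain ⟨w, hwc, hwo, hwv⟩ := exists_iUnion_eq_closure_subset hvo (fun y => hvf.point_finite y) hvc
  have hwf : LocallyFinite fun i => closure (w i) := hvf.subset hwv
  have hwV : ∀ i, closure (w i) ⊆ V₀ i := fun i => (hwv i).trans (hvV i)
  choose c hc using fun x => Set.mem_iUnion.1 (hwc ▸ Set.mem_univ x : x ∈ ⋃ i, w i)
  have hc' : ∀ x, x ∈ V₀ (c x) := fun x => hwV _ (subset_closure (hc x))
  -- `N x` avoids every closure not containing `x`, and on it the finitely many representatives
  -- attached to closures containing `x` all agree with the chosen one. Both conditions are open by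
  -- local finiteness.
  have h1 : ∀ x, ∃ N : Opens Y, x ∈ N ∧ (N : Set Y) ⊆ w (c x) ∧
      (∀ i, x ∉ closure (w i) → Disjoint (N : Set Y) (closure (w i))) ∧
      ∀ i, x ∈ closure (w i) → ∃ (h₁ : N ≤ V₀ i) (h₂ : N ≤ V₀ (c x)),
        HPoly.res h₁ (p i) = HPoly.res h₂ (p (c x)) := by
    intro x
    have hfin : {i | x ∈ closure (w i)}.Finite := hwf.point_finite x
    have h2 : ∀ i, ∃ W : Opens Y, x ∈ W ∧ (x ∈ closure (w i) → ∃ (h₁ : W ≤ V₀ i)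
        (h₂ : W ≤ V₀ (c x)), HPoly.res h₁ (p i) = HPoly.res h₂ (p (c x))) := by
      intro i
      by_cases hi : x ∈ closure (w i)
      · obtain ⟨W, hW, h₁, h₂, e⟩ := exists_res_eq (hwV i hi) (hc' x)
          ((hp i x _).symm.trans (hp (c x) x (hc' x)))
        exact ⟨W, hW, fun _ => ⟨h₁, h₂, e⟩⟩
      · exact ⟨⊤, trivial, fun h => absurd h hi⟩
    choose W hW hWe using h2
    let C : Set Y := ⋃ i : {i // x ∉ closure (w i)}, closure (w i)
    have hC : IsClosed C := (hwf.comp_injective Subtype.val_injective).isClosed_iUnion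
      fun i => isClosed_closure
    have hxC : x ∉ C := fun h => by
      obtain ⟨i, hi⟩ := Set.mem_iUnion.1 h
      exact i.2 hi
    let N : Opens Y := ⟨w (c x) ∩ Cᶜ ∩ ⋂ i ∈ {i | x ∈ closure (w i)}, (W i : Set Y),
      ((hwo _).inter hC.isOpen_compl).inter (hfin.isOpen_biInter fun i _ => (W i).isOpen)⟩
    refine ⟨N, ⟨⟨hc x, hxC⟩, Set.mem_iInter₂.2 fun i _ => hW i⟩, fun z hz => hz.1.1,
      fun i hi => ?_, fun i hi => ?_⟩
    · exact Set.disjoint_left.2 fun z hz hz' => hz.1.2 (Set.mem_iUnion.2 ⟨⟨i, hi⟩, hz'⟩)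
    · have hN : N ≤ W i := fun z hz => Set.mem_iInter₂.1 hz.2 i hi
      obtain ⟨h₁, h₂, e⟩ := hWe i hi
      refine ⟨hN.trans h₁, hN.trans h₂, ?_⟩
      rw [← HPoly.res_res hN h₁, ← HPoly.res_res hN h₂, e]
  choose N hxN hNw hNd hNe using h1
  have hNV : ∀ x, N x ≤ V₀ (c x) := fun x z hz => hwV _ (subset_closure (hNw x hz))
  refine ⟨N, fun x => HPoly.res (hNV x) (p (c x)), hxN, fun x => hPm _ _ (hNV x) (hVP _),
    fun x z hz => ?_, fun x y => ?_⟩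
  · rw [germ_res, hp (c x) z (hNV x hz)]
  · by_cases he : ∃ z, z ∈ N x ⊓ N y
    · obtain ⟨z, hzx, hzy⟩ := he
      -- If `N x` meets `N y`, it meets `w (c y)`, so that closure must contain `x`. Hence the
      -- representatives chosen at `x` and at `y` already agree on all of `N x`.
      have hx : x ∈ closure (w (c y)) := by
        by_contra h
        exact Set.disjoint_left.1 (hNd x (c y) h) hzx (subset_closure (hNw y hzy))
      obtain ⟨h₁, h₂, e⟩ := hNe x (c y) hx
      have e' := congrArg (HPoly.res (inf_le_left : N x ⊓ N y ≤ N x)) e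
      rw [HPoly.res_res, HPoly.res_res] at e'
      rw [HPoly.res_res, HPoly.res_res, ← e']
    · have : IsEmpty ↥(N x ⊓ N y) := ⟨fun z => he ⟨z.1, z.2⟩⟩
      rw [HPoly.eq_zero_of_isEmpty (HPoly.res _ _), HPoly.eq_zero_of_isEmpty (HPoly.res _ _)]

end families

/-! ### Lipschitz partitions of unity -/

section clip

/-- The truncation of `t` to the interval `[0, 1]`. -/
def clip (t : ℝ) : ℝ := max 0 (min 1 t)

theorem clip_nonneg (t : ℝ) : 0 ≤ clip t := le_max_left _ _

theorem clip_le_one (t : ℝ) : clip t ≤ 1 := max_le zero_le_one (min_le_left _ _)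

theorem clip_mono {s t : ℝ} (h : s ≤ t) : clip s ≤ clip t :=
  max_le_max le_rfl (min_le_min le_rfl h)

theorem clip_of_nonpos {t : ℝ} (h : t ≤ 0) : clip t = 0 :=
  max_eq_left ((min_le_right _ _).trans h)

theorem clip_of_one_le {t : ℝ} (h : 1 ≤ t) : clip t = 1 := by
  rw [clip, min_eq_left h, max_eq_right zero_le_one]

theorem abs_clip_sub_le (s t : ℝ) : |clip s - clip t| ≤ |s - t| := by
  have h1 := abs_max_sub_max_le_abs (min 1 s) (min 1 t) 0
  have h2 := abs_min_sub_min_le_max 1 s 1 t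
  rw [sub_self, abs_zero, max_eq_right (abs_nonneg _)] at h2
  rw [clip, clip, max_comm 0, max_comm 0]
  exact h1.trans h2

/-- For a finitely supported family `g m`, `m : ι`, of numbers in `[0, 1]` which attains the
value one, the increments of the partial suprema add up to one. -/
theorem sum_increments {ι : Type*} [LinearOrder ι] {g : ι → ℝ} (h0 : ∀ m, 0 ≤ g m)
    (h1 : ∀ m, g m ≤ 1) (s : Finset ι) (hs : ∀ m ∈ s, ∀ l < m, l ∉ s → g l = 0) :
    (∀ m ∈ s, g m ≤ ∑ m ∈ s, max 0 (g m - ⨆ l : Set.Iio m, g l)) ∧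
      (∑ m ∈ s, max 0 (g m - ⨆ l : Set.Iio m, g l) = 0 ∨
        ∃ m ∈ s, ∑ m ∈ s, max 0 (g m - ⨆ l : Set.Iio m, g l) = g m) := by
  induction s using Finset.induction_on_max with
  | empty => simp
  | insert a s ha ih =>
    obtain ⟨ih1, ih2⟩ := ih fun m hm l hl hls => hs m (Finset.mem_insert_of_mem hm) l hl fun h => by
      rcases Finset.mem_insert.1 h with rfl | h
      · exact (hl.trans (ha m hm)).false
      · exact hls h
    have has : a ∉ s := fun h => (ha a h).false
    set S := ∑ m ∈ s, max 0 (g m - ⨆ l : Set.Iio m, g l) with hS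
    have hS0 : 0 ≤ S := Finset.sum_nonneg fun _ _ => le_max_left _ _
    have hbdd : BddAbove (Set.range fun l : Set.Iio a => g l) :=
      ⟨1, by rintro _ ⟨l, rfl⟩; exact h1 l⟩
    -- Indices outside the finite set carry the value zero, so the supremum over everything below
    -- `a` is the running maximum over `s`, which is the sum accumulated so far.
    have hL : ⨆ l : Set.Iio a, g l = S := by
      refine le_antisymm (Real.iSup_le (fun l => ?_) hS0) ?_
      · by_cases hl : (l : ι) ∈ s
        · exact ih1 l hl
        · rw [hs a (Finset.mem_insert_self _ _) l l.2 fun h => by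
            rcases Finset.mem_insert.1 h with h | h
            · exact (l.2.trans_eq h.symm).false
            · exact hl h]
          exact hS0
      · rcases ih2 with h | ⟨m, hm, h⟩
        · rw [h]
          exact Real.iSup_nonneg fun l => h0 l
        · rw [h]
          exact le_ciSup hbdd ⟨m, ha m hm⟩
    rw [Finset.sum_insert has, ← hS, hL, ← max_add_add_right, zero_add, sub_add_cancel]
    refine ⟨fun m hm => ?_, ?_⟩
    · rcases Finset.mem_insert.1 hm with rfl | hm
      · exact le_max_right _ _
      · exact (ih1 m hm).trans (le_max_left _ _)
    · rcases le_total (g a) S with h | h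
      · rw [max_eq_left h]
        exact ih2.imp_right fun ⟨m, hm, e⟩ => ⟨m, Finset.mem_insert_of_mem hm, e⟩
      · rw [max_eq_right h]
        exact Or.inr ⟨a, Finset.mem_insert_self _ _, rfl⟩

theorem sum_increments_eq_one {ι : Type*} [LinearOrder ι] {g : ι → ℝ} (h0 : ∀ m, 0 ≤ g m)
    (h1 : ∀ m, g m ≤ 1) (s : Finset ι) (hs : ∀ m ∉ s, g m = 0) {a : ι} (ha : g a = 1) :
    ∑ m ∈ s, max 0 (g m - ⨆ l : Set.Iio m, g l) = 1 := by
  obtain ⟨h2, h3⟩ := sum_increments h0 h1 s fun m _ l _ hl => hs l hl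
  have has : a ∈ s := by
    by_contra h
    rw [hs a h] at ha
    exact zero_ne_one ha
  have h4 := h2 a has
  rw [ha] at h4
  refine le_antisymm ?_ h4
  rcases h3 with h | ⟨m, -, h⟩
  · rw [h] at h4 ⊢
    exact zero_le_one
  · rw [h]
    exact h1 m

end clip

section partition

variable {Y : Type u} [MetricSpace Y]

theorem exists_lipschitz_pos_iff (U : Opens Y) : ∃ d : Y → ℝ, (∀ x, 0 ≤ d x) ∧ (∀ x, d x ≤ 1) ∧
    (∀ x y, |d x - d y| ≤ 1 * dist x y) ∧ ∀ x, 0 < d x ↔ x ∈ U := by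
  by_cases h : ((U : Set Y)ᶜ).Nonempty
  · refine ⟨fun x => clip (Metric.infDist x (U : Set Y)ᶜ), fun x => clip_nonneg _,
      fun x => clip_le_one _, fun x y => ?_, fun x => ?_⟩
    · refine (abs_clip_sub_le _ _).trans ?_
      have := (Metric.lipschitz_infDist_pt (U : Set Y)ᶜ).dist_le_mul x y
      simpa [Real.dist_eq] using this
    · have h1 := U.isOpen.isClosed_compl.notMem_iff_infDist_pos h (x := x)
      rw [Set.mem_compl_iff, not_not] at h1
      rw [← SetLike.mem_coe, h1]
      constructor
      · intro h2
        by_contra h3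
        simp only [clip_of_nonpos (not_lt.1 h3)] at h2
        exact h2.false
      · exact fun h2 => lt_max_of_lt_right (lt_min zero_lt_one h2)
  · rw [Set.not_nonempty_iff_eq_empty, Set.compl_empty_iff] at h
    refine ⟨fun _ => 1, fun _ => zero_le_one, fun _ => le_rfl, fun x y => ?_, fun x => ?_⟩
    · simp
    · simp [← SetLike.mem_coe, h]

theorem abs_iSup_sub_iSup_le {ι : Sort*} {f g : ι → ℝ} {c : ℝ} (hf : ∀ i, 0 ≤ f i ∧ f i ≤ 1)
    (hg : ∀ i, 0 ≤ g i ∧ g i ≤ 1) (hc : 0 ≤ c) (h : ∀ i, |f i - g i| ≤ c) :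
    |(⨆ i, f i) - ⨆ i, g i| ≤ c := by
  have key : ∀ f g : ι → ℝ, (∀ i, 0 ≤ g i ∧ g i ≤ 1) → (∀ i, |f i - g i| ≤ c) →
      (⨆ i, f i) ≤ (⨆ i, g i) + c := fun f g hg h => by
    have hb : BddAbove (Set.range g) := ⟨1, by rintro _ ⟨i, rfl⟩; exact (hg i).2⟩
    refine Real.iSup_le (fun i => ?_) (add_nonneg (Real.iSup_nonneg fun i => (hg i).1) hc)
    have h1 := le_ciSup hb i
    have h2 := (abs_le.1 (h i)).2
    linarith
  have h1 := key f g hg h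
  have h2 := key g f hf fun i => by rw [abs_sub_comm]; exact h i
  rw [abs_le]
  constructor <;> linarith

theorem abs_mul_sub_mul_le_of_le_one {a b a' b' C D d : ℝ} (ha : 0 ≤ a' ∧ a' ≤ 1)
    (hb : 0 ≤ b ∧ b ≤ 1) (h1 : |a - a'| ≤ C * d) (h2 : |b - b'| ≤ D * d) :
    |a * b - a' * b'| ≤ (C + D) * d := by
  have e : a * b - a' * b' = (a - a') * b + a' * (b - b') := by ring
  rw [e, add_mul]
  refine (abs_add_le _ _).trans (add_le_add ?_ ?_)
  · rw [abs_mul, abs_of_nonneg hb.1]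
    exact (mul_le_of_le_one_right (abs_nonneg _) hb.2).trans h1
  · rw [abs_mul, abs_of_nonneg ha.1]
    exact (mul_le_of_le_one_left (abs_nonneg _) ha.2).trans h2

/-- A locally finite open cover of a metric space has a locally finite refinement with a
subordinate partition of unity consisting of (globally) Lipschitz functions. -/
theorem exists_lipPartition {ι : Type u} {U : ι → Opens Y}
    (hU : LocallyFinite fun i => (U i : Set Y)) (hc : ∀ y, ∃ i, y ∈ U i) :
    ∃ (κ : Type u) (W : κ → Opens Y) (c : κ → ι) (φ : κ → BLip Y), (∀ j, W j ≤ U (c j)) ∧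
      LocallyFinite (fun j => (W j : Set Y)) ∧ (∀ y, ∃ j, y ∈ W j) ∧ LipPartition W φ := by
  classical
  let _ : LinearOrder ι := linearOrderOfSTO WellOrderingRel
  choose d hd0 hd1 hdL hdU using fun i => exists_lipschitz_pos_iff (U i)
  have hdb : ∀ x, BddAbove (Set.range fun i => d i x) := fun x =>
    ⟨1, by rintro _ ⟨i, rfl⟩; exact hd1 i x⟩
  -- A Lipschitz and everywhere positive measure of how deep a point lies in some member of the
  -- cover.
  let f : Y → ℝ := fun x => ⨆ i, d i x
  have hfL : ∀ x y, |f x - f y| ≤ 1 * dist x y := fun x y =>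
    abs_iSup_sub_iSup_le (fun i => ⟨hd0 i x, hd1 i x⟩) (fun i => ⟨hd0 i y, hd1 i y⟩)
      (by positivity) fun i => hdL i x y
  have hfc : Continuous f := (LipschitzWith.of_dist_le_mul (K := 1) fun x y => by
    simpa [Real.dist_eq] using hfL x y).continuous
  have hdc : ∀ i, Continuous (d i) := fun i => (LipschitzWith.of_dist_le_mul (K := 1) fun x y => by
    simpa [Real.dist_eq] using hdL i x y).continuous
  have hf0 : ∀ x, 0 < f x := fun x => by
    obtain ⟨i, hi⟩ := hc x
    exact ((hdU i x).2 hi).trans_le (le_ciSup (hdb x) i)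
  -- Telescoping weights: `θ n` lives where $1/(n+1)\le f$ and $nf\le2$, so at this scale the
  -- Lipschitz constants only depend on `n`.
  let θ : ℕ → Y → ℝ := fun n x => clip ((n + 1) * f x - 1) - clip (n * f x - 1)
  have hθ0 : ∀ n x, 0 ≤ θ n x := fun n x => sub_nonneg.2 (clip_mono (by nlinarith [hf0 x]))
  have hθ1 : ∀ n x, θ n x ≤ 1 := fun n x =>
    (sub_le_self _ (clip_nonneg _)).trans (clip_le_one _)
  have hθL : ∀ n x y, |θ n x - θ n y| ≤ (2 * n + 1) * dist x y := fun n x y => by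
    have h1 : |clip ((n + 1) * f x - 1) - clip ((n + 1) * f y - 1)| ≤ (n + 1) * dist x y := by
      refine (abs_clip_sub_le _ _).trans ?_
      rw [sub_sub_sub_cancel_right, ← mul_sub, abs_mul, abs_of_nonneg (by positivity)]
      exact mul_le_mul_of_nonneg_left (by simpa using hfL x y) (by positivity)
    have h2 : |clip (n * f x - 1) - clip (n * f y - 1)| ≤ n * dist x y := by
      refine (abs_clip_sub_le _ _).trans ?_
      rw [sub_sub_sub_cancel_right, ← mul_sub, abs_mul, abs_of_nonneg (by positivity)]
      exact mul_le_mul_of_nonneg_left (by simpa using hfL x y) (by positivity)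
    have e : θ n x - θ n y = (clip ((n + 1) * f x - 1) - clip ((n + 1) * f y - 1)) -
      (clip (n * f x - 1) - clip (n * f y - 1)) := by simp only [θ]; ring
    rw [e]
    refine (abs_sub _ _).trans ((add_le_add h1 h2).trans_eq (by ring))
  have hθs : ∀ n x, θ n x ≠ 0 → n * f x ≤ 2 ∧ 1 ≤ (n + 1) * f x := by
    intro n x h
    constructor
    · by_contra hlt
      refine h ?_
      simp only [θ]
      rw [clip_of_one_le (by linarith [hf0 x, add_mul (n : ℝ) 1 (f x)]), clip_of_one_le (by linarith),
        sub_self]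
    · by_contra hlt
      refine h ?_
      simp only [θ]
      rw [clip_of_nonpos (by linarith), clip_of_nonpos (by
        linarith [hf0 x, add_mul (n : ℝ) 1 (f x)]), sub_self]
  -- Equal to one where $d_i\ge 1/(2(n+1))$ and zero where $d_i\le 1/(4(n+1))$. On the band of `θ n`
  -- some index attains one.
  let g : ℕ → ι → Y → ℝ := fun n i x => clip (4 * (n + 1) * d i x - 1)
  have hg0 : ∀ n i x, 0 ≤ g n i x := fun _ _ _ => clip_nonneg _
  have hg1 : ∀ n i x, g n i x ≤ 1 := fun _ _ _ => clip_le_one _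
  have hgL : ∀ n i x y, |g n i x - g n i y| ≤ 4 * (n + 1) * dist x y := fun n i x y => by
    refine (abs_clip_sub_le _ _).trans ?_
    rw [sub_sub_sub_cancel_right, ← mul_sub, abs_mul, abs_of_nonneg (by positivity)]
    exact mul_le_mul_of_nonneg_left (by simpa using hdL i x y) (by positivity)
  -- Increments of partial suprema along a linear order of the indices. Their Lipschitz constant
  -- does not depend on how many members overlap; normalizing by a sum would lose this, because the
  -- multiplicity of the cover is not bounded.
  let ψ : ℕ → ι → Y → ℝ := fun n i x => max 0 (g n i x - ⨆ l : Set.Iio i, g n l x)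
  have hψ0 : ∀ n i x, 0 ≤ ψ n i x := fun _ _ _ => le_max_left _ _
  have hψg : ∀ n i x, ψ n i x ≤ g n i x := fun n i x =>
    max_le (hg0 _ _ _) (sub_le_self _ (Real.iSup_nonneg fun l => hg0 _ _ _))
  have hψL : ∀ n i x y, |ψ n i x - ψ n i y| ≤ 8 * (n + 1) * dist x y := fun n i x y => by
    have h1 : |(⨆ l : Set.Iio i, g n l x) - ⨆ l : Set.Iio i, g n l y| ≤ 4 * (n + 1) * dist x y :=
      abs_iSup_sub_iSup_le (fun l => ⟨hg0 n l x, hg1 n l x⟩) (fun l => ⟨hg0 n l y, hg1 n l y⟩)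
        (by positivity) fun l => hgL n l x y
    have h2 := abs_max_sub_max_le_abs (g n i x - ⨆ l : Set.Iio i, g n l x)
      (g n i y - ⨆ l : Set.Iio i, g n l y) 0
    rw [max_comm _ (0 : ℝ), max_comm _ (0 : ℝ)] at h2
    refine h2.trans ?_
    rw [sub_sub_sub_comm]
    exact (abs_sub _ _).trans ((add_le_add (hgL n i x y) h1).trans_eq (by ring))
  have hψs : ∀ n i x, ψ n i x ≠ 0 → 1 ≤ 4 * (n + 1) * d i x := by
    intro n i x h
    by_contra hlt
    refine h (le_antisymm ((hψg n i x).trans_eq ?_) (hψ0 n i x))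
    exact clip_of_nonpos (by linarith)
  let φ : ℕ × ι → BLip Y := fun a => BLip.mk' (fun x => θ a.1 x * ψ a.1 a.2 x)
    ((2 * a.1 + 1) + 8 * (a.1 + 1)) 1 (fun x y => abs_mul_sub_mul_le_of_le_one
      ⟨hθ0 _ _, hθ1 _ _⟩ ⟨hψ0 _ _ _, (hψg _ _ _).trans (hg1 _ _ _)⟩ (hθL _ _ _) (hψL _ _ _ _))
    fun x => by
      rw [abs_of_nonneg (mul_nonneg (hθ0 _ _) (hψ0 _ _ _))]
      exact mul_le_one₀ (hθ1 _ _) (hψ0 _ _ _) ((hψg _ _ _).trans (hg1 _ _ _))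
  have hφa : ∀ a x, φ a x = θ a.1 x * ψ a.1 a.2 x := fun _ _ => rfl
  -- The bound 3 instead of 2 makes room for the closed support in an open set. Local finiteness
  -- holds because `f` is bounded below near each point, which bounds `n`.
  let W : ℕ × ι → Opens Y := fun a => U a.2 ⊓ ⟨{x | a.1 * f x < 3},
    isOpen_lt (continuous_const.mul hfc) continuous_const⟩
  have hsupp : ∀ a, tsupport (φ a : Y → ℝ) ⊆ W a := by
    intro a
    have hcl : IsClosed {x | (a.1 : ℝ) * f x ≤ 2 ∧ 1 ≤ 4 * ((a.1 : ℝ) + 1) * d a.2 x} :=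
      (isClosed_le (continuous_const.mul hfc) continuous_const).inter
        (isClosed_le continuous_const (continuous_const.mul (hdc a.2)))
    have hsub : tsupport (φ a : Y → ℝ) ⊆
        {x | (a.1 : ℝ) * f x ≤ 2 ∧ 1 ≤ 4 * ((a.1 : ℝ) + 1) * d a.2 x} := by
      refine closure_minimal (fun x hx => ?_) hcl
      rw [Function.mem_support, hφa] at hx
      exact ⟨(hθs _ _ (left_ne_zero_of_mul hx)).1, hψs _ _ _ (right_ne_zero_of_mul hx)⟩
    intro x hx
    obtain ⟨h1, h2⟩ := hsub hx
    refine ⟨(hdU _ _).1 ?_, ?_⟩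
    · by_contra h
      have h0 : d a.2 x = 0 := le_antisymm (not_lt.1 h) (hd0 _ _)
      rw [h0, mul_zero] at h2
      linarith
    · change (a.1 : ℝ) * f x < 3
      linarith
  have hlf : LocallyFinite fun a => (W a : Set Y) := by
    intro x
    obtain ⟨t, ht, hfin⟩ := hU x
    have hn : {y | f x / 2 < f y} ∈ 𝓝 x :=
      (isOpen_lt continuous_const hfc).mem_nhds (by
        have := hf0 x
        change f x / 2 < f x
        linarith)
    obtain ⟨M, hM⟩ := exists_nat_gt (6 / f x)
    refine ⟨t ∩ {y | f x / 2 < f y}, inter_mem ht hn,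
      ((Set.finite_Iio M).prod hfin).subset ?_⟩
    rintro ⟨n, i⟩ ⟨y, ⟨hyU, hy3⟩, hyt, hyf⟩
    refine ⟨?_, y, hyU, hyt⟩
    change (n : ℝ) * f y < 3 at hy3
    change f x / 2 < f y at hyf
    change n < M
    have : (n : ℝ) < M := by
      refine lt_of_le_of_lt ?_ hM
      rw [le_div_iff₀ (hf0 x)]
      nlinarith [(Nat.cast_nonneg n : (0 : ℝ) ≤ n)]
    exact_mod_cast this
  have hsum : ∀ y, ∑ᶠ a, φ a y = 1 := by
    intro y
    obtain ⟨M, hM⟩ := exists_nat_gt (2 / f y)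
    have hfin : {i | y ∈ U i}.Finite := hU.point_finite y
    have hMf : 2 < M * f y := (div_lt_iff₀ (hf0 y)).1 hM
    have hss : (Function.support fun a => φ a y) ⊆
        ((Finset.range M ×ˢ hfin.toFinset : Finset (ℕ × ι)) : Set (ℕ × ι)) := by
      intro a ha
      have hW := hsupp a (subset_tsupport _ ha)
      rw [Function.mem_support, hφa] at ha
      have h1 := (hθs _ _ (left_ne_zero_of_mul ha)).1
      simp only [Finset.coe_product, Finset.coe_range, Set.Finite.coe_toFinset, Set.mem_prod,
        Set.mem_Iio, Set.mem_ofPred_eq]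
      refine ⟨?_, hW.1⟩
      have : (a.1 : ℝ) < M := lt_of_mul_lt_mul_right (h1.trans_lt hMf) (hf0 y).le
      exact_mod_cast this
    rw [finsum_eq_sum_of_support_subset _ hss, Finset.sum_product]
    have h1 : ∀ n ∈ Finset.range M, ∑ i ∈ hfin.toFinset, φ (n, i) y = θ n y := by
      intro n _
      simp only [hφa]
      rw [← Finset.mul_sum]
      by_cases hθ : θ n y = 0
      · rw [hθ, zero_mul]
      · have h2 := (hθs n y hθ).2
        -- On the band the supremum `f y` is at least $1/(n+1)$, so some `d a y` exceeds half of
        -- that and its cutoff equals one.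
        have hlt : 1 / (2 * ((n : ℝ) + 1)) < f y := by
          rw [div_lt_iff₀ (by positivity)]
          nlinarith
        obtain ⟨i₀, _⟩ := hc y
        have : Nonempty ι := ⟨i₀⟩
        obtain ⟨a, ha⟩ := exists_lt_of_lt_ciSup hlt
        rw [div_lt_iff₀ (by positivity)] at ha
        have hga : g n a y = 1 := clip_of_one_le (by nlinarith)
        have h3 := sum_increments_eq_one (g := fun i => g n i y) (fun i => hg0 n i y)
          (fun i => hg1 n i y) hfin.toFinset (fun i hi => ?_) hga
        · rw [h3, mul_one]
        · have hi' : y ∉ U i := by simpa using hi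
          have h0 : d i y = 0 := le_antisymm (not_lt.1 fun h => hi' ((hdU i y).1 h)) (hd0 _ _)
          change clip _ = 0
          rw [h0]
          exact clip_of_nonpos (by norm_num)
    rw [Finset.sum_congr rfl h1]
    have h4 := Finset.sum_range_sub (fun n : ℕ => clip (n * f y - 1)) M
    simp only [Nat.cast_add, Nat.cast_one] at h4
    change ∑ n ∈ Finset.range M, (clip ((n + 1) * f y - 1) - clip (n * f y - 1)) = 1
    rw [h4, clip_of_one_le (by linarith), clip_of_nonpos (by simp), sub_zero]
  refine ⟨ℕ × ι, W, Prod.snd, φ, fun a => inf_le_left, hlf, fun y => ?_,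
    fun a y => mul_nonneg (hθ0 _ _) (hψ0 _ _ _), hsupp, hsum⟩
  by_contra hn
  have h0 : ∀ a, φ a y = 0 := fun a => by
    by_contra h
    exact hn ⟨a, hsupp a (subset_tsupport _ h)⟩
  have := hsum y
  simp [h0] at this

/-- A continuous section has overlap-compatible families, on arbitrarily fine covers, with
subordinate Lipschitz partitions of unity. -/
theorem Sect.IsCont.exists_overlapCompatible {k : ℕ} {σ : Sect k Y} (hσ : σ.IsCont)
    {P : Opens Y → Prop} (hPm : ∀ U V, U ≤ V → P V → P U) (hP : ∀ y, ∃ U, y ∈ U ∧ P U) :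
    ∃ (ι : Type u) (U : ι → Opens Y) (p : ∀ i, HPoly k (U i)) (φ : ι → BLip Y),
      (∀ i, P (U i)) ∧ OverlapCompatible U p σ ∧ LipPartition U φ := by
  obtain ⟨N, s, hxN, hPN, hs, hc⟩ := hσ.exists_compatible hPm hP
  obtain ⟨v, hvo, hvc, hvf, hvN⟩ := precise_refinement (fun y => (N y : Set Y))
    (fun y => (N y).isOpen) (Set.iUnion_eq_univ_iff.2 fun y => ⟨y, hxN y⟩)
  obtain ⟨κ, W, c, φ, hWU, hWf, hWc, hφ⟩ := exists_lipPartition (U := fun y => ⟨v y, hvo y⟩) hvf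
    fun y => Set.iUnion_eq_univ_iff.1 hvc y
  have hWN : ∀ j, W j ≤ N (c j) := fun j z hz => hvN _ (hWU j hz)
  have hg : ∀ j z (hz : z ∈ W j), σ z = germ (W j) hz (HPoly.res (hWN j) (s (c j))) := by
    intro j z hz
    rw [germ_res, hs (c j) z (hWN j hz)]
  refine ⟨κ, W, fun j => HPoly.res (hWN j) (s (c j)), φ, fun j => hPm _ _ (hWN j) (hPN _),
    ⟨hWf, hWc, fun y => ?_, fun i j => ?_⟩, hφ⟩
  · obtain ⟨j, hj⟩ := hWc y
    exact ⟨j, hj, hg j y hj⟩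
  · have hle : W i ⊓ W j ≤ N (c i) ⊓ N (c j) := inf_le_inf (hWN i) (hWN j)
    have e := congrArg (HPoly.res hle) (hc (c i) (c j))
    rw [HPoly.res_res, HPoly.res_res] at e
    rw [HPoly.res_res, HPoly.res_res, e]

end partition

/-! ### Sequential continuity -/

section seqCont

variable {X : Type u} [MetricSpace X] {k : ℕ}

/-- Clamping `F` between `G - ε` and `G + ε` keeps the Lipschitz constant, changes nothing on `S`,
and makes the closeness to `G` global. -/
theorem BLip.exists_close_extension {S : Set X} {C ε : ℝ} (hC : 0 ≤ C) (hε : 0 ≤ ε) (F G : BLip X)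
    (hF : ‖F‖ ≤ C) (hG : ‖G‖ ≤ C) (h : ∀ x ∈ S, |F x - G x| ≤ ε) :
    ∃ H : BLip X, (∀ x ∈ S, H x = F x) ∧ (∀ x, |H x - G x| ≤ ε) ∧ lipOn (H : X → ℝ) Set.univ ≤ C := by
  have hL : ∀ x y, |max (G x - ε) (min (F x) (G x + ε)) - max (G y - ε) (min (F y) (G y + ε))| ≤
      C * dist x y := by
    intro x y
    have h1 := (F.abs_sub_le_norm x y).trans (mul_le_mul_of_nonneg_right hF dist_nonneg)
    have h2 := (G.abs_sub_le_norm x y).trans (mul_le_mul_of_nonneg_right hG dist_nonneg)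
    refine (abs_max_sub_max_le_max _ _ _ _).trans (max_le ?_ ?_)
    · rwa [sub_sub_sub_cancel_right]
    · refine (abs_min_sub_min_le_max _ _ _ _).trans (max_le h1 ?_)
      rwa [add_sub_add_right_eq_sub]
  have hb : ∀ x, |max (G x - ε) (min (F x) (G x + ε)) - G x| ≤ ε := by
    intro x
    rw [abs_le]
    constructor
    · linarith [le_max_left (G x - ε) (min (F x) (G x + ε))]
    · have : max (G x - ε) (min (F x) (G x + ε)) ≤ G x + ε :=
        max_le (by linarith) (min_le_right _ _)
      linarith
  let H : BLip X := BLip.mk' (fun x => max (G x - ε) (min (F x) (G x + ε))) C (ε + C) hL fun x => by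
    have h1 := hb x
    have h2 := (G.abs_le_norm x).trans hG
    rw [abs_le] at h1 h2 ⊢
    constructor <;> linarith [h1.1, h1.2, h2.1, h2.2]
  refine ⟨H, fun x hx => ?_, hb, lipOn_le hC fun x _ y _ => hL x y⟩
  have h1 := abs_le.1 (h x hx)
  change max (G x - ε) (min (F x) (G x + ε)) = F x
  rw [min_eq_left (by linarith), max_eq_right (by linarith)]

/-- The restriction of a bounded Lipschitz function to a compact set. -/
def BLip.toBCF (S : Set X) (F : BLip X) : BoundedContinuousFunction S ℝ :=
  BoundedContinuousFunction.ofNormedAddCommGroup (fun x => F x)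
    (F.continuous.comp continuous_subtype_val) ‖F‖ fun x => F.abs_le_norm x

theorem BLip.toBCF_apply (S : Set X) (F : BLip X) (x : S) : F.toBCF S x = F x := rfl

theorem BLip.enorm_toBCF_le (S : Set X) (F : BLip X) : ‖F.toBCF S‖ₑ ≤ ⨆ x ∈ S, ‖F x‖ₑ := by
  by_cases h : (⨆ x ∈ S, ‖F x‖ₑ) = ∞
  · rw [h]; exact le_top
  rw [← ENNReal.ofReal_toReal h, ← ofReal_norm]
  refine ENNReal.ofReal_le_ofReal ?_
  refine (BoundedContinuousFunction.norm_le ENNReal.toReal_nonneg).2 fun x => ?_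
  rw [← ENNReal.ofReal_le_iff_le_toReal h, ofReal_norm, BLip.toBCF_apply]
  exact le_iSup₂ (f := fun x (_ : x ∈ S) => ‖F x‖ₑ) x.1 x.2

theorem isCompact_lipschitz_bcf {S : Set X} (hS : IsCompact S) (C : ℝ) :
    IsCompact {a : BoundedContinuousFunction S ℝ |
      (∀ x, |a x| ≤ C) ∧ ∀ x y, |a x - a y| ≤ C * dist x y} := by
  have : CompactSpace S := isCompact_iff_compactSpace.1 hS
  refine BoundedContinuousFunction.arzela_ascoli₂ (Metric.closedBall 0 C)
    (isCompact_closedBall 0 C) _ ?_ (fun a x ha => ?_) ?_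
  · have hcont : ∀ x : S, Continuous fun a : BoundedContinuousFunction S ℝ => a x := fun x =>
      (BoundedContinuousFunction.evalCLM ℝ x).continuous
    rw [Set.ofPred_and, Set.ofPred_forall, Set.ofPred_forall]
    refine IsClosed.inter (isClosed_iInter fun x => isClosed_le (hcont x).abs continuous_const)
      (isClosed_iInter fun x => ?_)
    rw [Set.ofPred_forall]
    exact isClosed_iInter fun y => isClosed_le ((hcont x).sub (hcont y)).abs continuous_const
  · rw [mem_closedBall_zero_iff, Real.norm_eq_abs]
    exact ha.1 x
  · refine Metric.equicontinuous_of_continuity_modulus (fun t => C * t) ?_ _ fun x y a => ?_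
    · simpa using (tendsto_id (α := ℝ) (x := 𝓝 0)).const_mul C
    · rw [Real.dist_eq]
      exact a.2.2 x y

variable [MeasurableSpace X] [BorelSpace X] [LocallyCompactSpace X] {T : Current k X}
  (hT : T.LocallyFiniteMass)
include hT

/-- Along a subsequence all factors converge uniformly on `S` by Arzelà–Ascoli, and strict locality
lets the values follow the limit factors. The limit of the product of the sup norms is zero, so some
limit factor vanishes on `S`, and then the limiting value is zero. -/
theorem Current.LocallyFiniteMass.tendsto_borelExt_zero {g : X → ℝ} (hg : Integrable g T.mass)
    {S : Set X} (hS : IsCompact S) (hgS : ∀ x, g x ≠ 0 → x ∈ S) {C : ℝ} (hC : 0 ≤ C)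
    {F : ℕ → Fin (k + 1) → BLip X} (hF : ∀ n i, ‖F n i‖ ≤ C)
    (h0 : Tendsto (fun n => ∏ i, ⨆ x ∈ S, ‖F n i x‖ₑ) atTop (𝓝 0)) :
    Tendsto (fun n => T.borelExt (fun x => g x * F n 0 x) (Fin.tail (F n))) atTop (𝓝 0) := by
  refine tendsto_of_subseq_tendsto fun ns hns => ?_
  obtain ⟨a, ha, ms, hms, hlim⟩ := (isCompact_univ_pi fun _ : Fin (k + 1) =>
    isCompact_lipschitz_bcf hS C).tendsto_subseq (x := fun n i => (F (ns n) i).toBCF S)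
    fun n i _ => ⟨fun x => ((F (ns n) i).abs_le_norm x).trans (hF _ _),
      fun x y => ((F (ns n) i).abs_sub_le_norm x y).trans
        (mul_le_mul_of_nonneg_right (hF _ _) dist_nonneg)⟩
  refine ⟨ms, ?_⟩
  have hlim' : ∀ i, Tendsto (fun n => (F (ns (ms n)) i).toBCF S) atTop (𝓝 (a i)) := fun i =>
    (tendsto_pi_nhds.1 hlim) i
  have hG : ∀ i, ∃ G : BLip X, (∀ x : S, G x = a i x) ∧ ‖G‖ ≤ C := by
    intro i
    obtain ⟨h1, h2⟩ := ha i trivial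
    have he : ∀ x : S, Function.extend Subtype.val (a i) 0 (x : X) = a i x := fun x =>
      Subtype.val_injective.extend_apply _ _ x
    obtain ⟨G, g1, g2, g3⟩ := exists_blip_extension S (Function.extend Subtype.val (a i) 0) hC hC
      (fun x hx y hy => by
        rw [he ⟨x, hx⟩, he ⟨y, hy⟩]
        exact h2 ⟨x, hx⟩ ⟨y, hy⟩) fun x hx => by
        rw [he ⟨x, hx⟩]
        exact h1 _
    exact ⟨G, fun x => (g1 x x.2).trans (he x), BLip.norm_le hC g2 g3⟩
  choose G hGa hGC using hG
  let ε : ℕ → Fin (k + 1) → ℝ := fun n i => ‖(F (ns (ms n)) i).toBCF S - a i‖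
  have hε : ∀ i, Tendsto (fun n => ε n i) atTop (𝓝 0) := fun i =>
    tendsto_iff_norm_sub_tendsto_zero.1 (hlim' i)
  -- Sequential continuity needs convergence on every compact set, not only on `S`. The factors are
  -- therefore replaced by ones which agree with them on `S` and are globally close to `G`; strict
  -- locality makes the replacement free.
  choose H hHF hHG hHC using fun n i => BLip.exists_close_extension (S := S) hC
    (norm_nonneg _ : 0 ≤ ε n i) (F (ns (ms n)) i) (G i) (hF _ _) (hGC i) fun x hx => by
      rw [hGa i ⟨x, hx⟩]
      exact BoundedContinuousFunction.norm_coe_le_norm ((F (ns (ms n)) i).toBCF S - a i) ⟨x, hx⟩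
  have hFH : ∀ n, T.borelExt (fun x => g x * F (ns (ms n)) 0 x) (Fin.tail (F (ns (ms n)))) =
      T.borelExt (fun x => g x * H n 0 x) (Fin.tail (H n)) := by
    intro n
    have e : (fun x => g x * F (ns (ms n)) 0 x) = fun x => g x * H n 0 x := by
      funext x
      by_cases hx : g x = 0
      · rw [hx, zero_mul, zero_mul]
      · rw [hHF n 0 x (hgS x hx)]
    rw [e]
    exact hT.borelExt_congr (integrable_mul_blip hg _) fun i x hx =>
      (hHF n i.succ x (hgS x (left_ne_zero_of_mul hx))).symm
  simp_rw [hFH]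
  have hconv : Tendsto (fun n => T.borelExt (fun x => g x * G 0 x) (Fin.tail (H n))) atTop
      (𝓝 (T.borelExt (fun x => g x * G 0 x) (Fin.tail G))) := by
    refine hT.tendsto_borelExt (integrable_mul_blip hg _) fun i =>
      ⟨⟨C, fun n => hHC n i.succ⟩, fun K _ => ?_⟩
    rw [Metric.tendstoUniformlyOn_iff]
    intro δ hδ
    filter_upwards [(hε i.succ).eventually (gt_mem_nhds hδ)] with n hn x _
    rw [dist_comm, Real.dist_eq]
    exact (hHG n i.succ x).trans_lt hn
  have hdiff : Tendsto (fun n => T.borelExt (fun x => g x * H n 0 x) (Fin.tail (H n)) -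
      T.borelExt (fun x => g x * G 0 x) (Fin.tail (H n))) atTop (𝓝 0) := by
    refine squeeze_zero_norm (a := fun n => C ^ k * (ε n 0 * ∫ x, |g x| ∂T.mass)) (fun n => ?_) ?_
    · rw [← hT.borelExt_sub (integrable_mul_blip hg _) (integrable_mul_blip hg _), Real.norm_eq_abs]
      have hint : Integrable (fun x => g x * H n 0 x - g x * G 0 x) T.mass :=
        (integrable_mul_blip hg _).sub (integrable_mul_blip hg _)
      refine (hT.abs_borelExt_le hint _).trans (mul_le_mul ?_ ?_
        (integral_nonneg fun _ => abs_nonneg _) (by positivity))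
      · refine (Finset.prod_le_prod (fun _ _ => lipOn_nonneg _ _)
          fun i _ => hHC n i.succ).trans_eq ?_
        rw [Finset.prod_const, Finset.card_univ, Fintype.card_fin]
      · rw [← integral_const_mul]
        refine integral_mono hint.abs (hg.abs.const_mul _) fun x => ?_
        change |g x * H n 0 x - g x * G 0 x| ≤ ε n 0 * |g x|
        rw [← mul_sub, abs_mul, mul_comm]
        exact mul_le_mul_of_nonneg_right (hHG n 0 x) (abs_nonneg _)
    · simpa using ((hε 0).mul_const (∫ x, |g x| ∂T.mass)).const_mul (C ^ k)
  have hzero : ∃ i, ∀ x ∈ S, G i x = 0 := by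
    have h1 : Tendsto (fun n => ∏ i, ‖(F (ns (ms n)) i).toBCF S‖ₑ) atTop (𝓝 0) :=
      tendsto_of_tendsto_of_tendsto_of_le_of_le tendsto_const_nhds
        (h0.comp (hns.comp hms.tendsto_atTop)) (fun _ => zero_le)
        fun n => Finset.prod_le_prod' fun i _ => BLip.enorm_toBCF_le S _
    have h2 : Tendsto (fun n => ∏ i, ‖(F (ns (ms n)) i).toBCF S‖) atTop (𝓝 (∏ i, ‖a i‖)) :=
      tendsto_finsetProd _ fun i _ => (hlim' i).norm
    have h3 : Tendsto (fun n => ∏ i, ‖(F (ns (ms n)) i).toBCF S‖) atTop (𝓝 0) := by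
      have := (ENNReal.tendsto_toReal ENNReal.zero_ne_top).comp h1
      refine (this.congr fun n => ?_)
      rw [Function.comp_apply, ENNReal.toReal_prod]
      exact Finset.prod_congr rfl fun i _ => toReal_enorm _
    obtain ⟨i, -, hi⟩ := Finset.prod_eq_zero_iff.1 (tendsto_nhds_unique h2 h3)
    refine ⟨i, fun x hx => ?_⟩
    rw [hGa i ⟨x, hx⟩, norm_eq_zero.1 hi]
    rfl
  have hlimzero : T.borelExt (fun x => g x * G 0 x) (Fin.tail G) = 0 := by
    obtain ⟨i, hi⟩ := hzero
    -- A vanishing zeroth factor kills the weight itself; for a later factor strict locality is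
    -- used.
    induction i using Fin.cases with
    | zero =>
      have e : (fun x => g x * G 0 x) = fun x => 0 * g x := by
        funext x
        by_cases hx : g x = 0
        · rw [hx, zero_mul, zero_mul]
        · rw [hi x (hgS x hx), mul_zero, zero_mul]
      rw [e, hT.borelExt_smul 0 hg, zero_mul]
    | succ i =>
      exact hT.borelExt_eq_zero (integrable_mul_blip hg _) (i := i) fun x hx =>
        hi x (hgS x (left_ne_zero_of_mul hx))
  have := hdiff.add hconv
  rw [hlimzero, add_zero] at this
  simpa using this

omit [MeasurableSpace X] [BorelSpace X] [LocallyCompactSpace X] hT in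
/-- A simple tensor can be rewritten with the whole size in the first factor. -/
theorem HPoly.exists_tensor_eq {Z : Type u} [MetricSpace Z] (f : Fin (k + 1) → BLip Z) :
    ∃ w : Fin (k + 1) → BLip Z, HPoly.tensor w = HPoly.tensor f ∧ ‖w 0‖ ≤ ∏ i, ‖f i‖ ∧
      (∀ i : Fin k, ‖w i.succ‖ ≤ 1) ∧
      ∀ V : Set Z, ∏ i, ⨆ x ∈ V, ‖w i x‖ₑ ≤ ∏ i, ⨆ x ∈ V, ‖f i x‖ₑ := by
  let P : ℝ := ∏ i : Fin k, ‖f i.succ‖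
  have hP : 0 ≤ P := Finset.prod_nonneg fun _ _ => norm_nonneg _
  -- If some later factor has norm zero, its inverse is zero by convention and both tensors vanish.
  let c : Fin (k + 1) → ℝ := Fin.cons P fun i => ‖f i.succ‖⁻¹
  have hw0 : c 0 = P := rfl
  have hws : ∀ i : Fin k, c i.succ = ‖f i.succ‖⁻¹ := fun i => rfl
  have hprod : ∏ i, c i = P * ∏ i : Fin k, ‖f i.succ‖⁻¹ := Fin.prod_univ_succ c
  refine ⟨fun i => c i • f i, ?_, ?_, fun i => ?_, fun V => ?_⟩
  · rw [← HPoly.tensorM_apply, MultilinearMap.map_smul_univ, HPoly.tensorM_apply, hprod]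
    by_cases h : ∃ i : Fin k, ‖f i.succ‖ = 0
    · obtain ⟨i, hi⟩ := h
      rw [← HPoly.tensorM_apply, (HPoly.tensorM k Z).map_coord_zero i.succ (norm_eq_zero.1 hi),
        smul_zero]
    · push Not at h
      rw [← Finset.prod_mul_distrib, Finset.prod_eq_one fun i _ => mul_inv_cancel₀ (h i), one_smul]
  · rw [norm_smul, hw0, Real.norm_of_nonneg hP, Fin.prod_univ_succ, mul_comm]
  · rw [norm_smul, hws, norm_inv, norm_norm]
    exact inv_mul_le_one
  · have e : ∀ i, (⨆ x ∈ V, ‖(c i • f i) x‖ₑ) = ‖c i‖ₑ * ⨆ x ∈ V, ‖f i x‖ₑ := by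
      intro i
      simp_rw [BLip.smul_apply, enorm_mul, ENNReal.mul_iSup]
    simp_rw [e]
    rw [Finset.prod_mul_distrib]
    refine mul_le_of_le_one_left zero_le ?_
    have hc0 : ‖c 0‖ₑ = ∏ i : Fin k, ‖f i.succ‖ₑ := by
      rw [hw0, Real.enorm_eq_ofReal hP, ENNReal.ofReal_prod_of_nonneg fun _ _ => norm_nonneg _]
      simp_rw [ofReal_norm]
    rw [Fin.prod_univ_succ, hc0, ← Finset.prod_mul_distrib]
    refine Finset.prod_le_one' fun i _ => ?_
    rw [← ofReal_norm, hws, Real.enorm_eq_ofReal (inv_nonneg.2 (norm_nonneg _)),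
      ← ENNReal.ofReal_mul (norm_nonneg _), ENNReal.ofReal_le_one]
    exact mul_inv_le_one

theorem Current.LocallyFiniteMass.abs_lin_tensor_le {Z : Type u} [MetricSpace Z] {j : Z → X}
    (hj : Isometry j) {g : X → ℝ} (hg : T.IsWeight j g) (f : Fin (k + 1) → BLip Z) :
    |T.lin hj g (HPoly.tensor f)| ≤ (∏ i, ‖f i‖) * ∫ x, |g x| ∂T.mass := by
  refine (hT.abs_lin_le hj hg _).trans (mul_le_mul_of_nonneg_right ?_
    (integral_nonneg fun _ => abs_nonneg _))
  refine ENNReal.toReal_le_of_le_ofReal (Finset.prod_nonneg fun _ _ => norm_nonneg _) ?_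
  have h := HPoly.lipOn_le_of_hasSum (ι := Unit) (r := fun _ => f) Summable.of_finite
    (hasSum_unique fun _ => HPoly.tensor f) Set.univ
  exact h.trans ((lipSum_le _ _).trans_eq (tsum_fintype _ |>.trans (by simp)))

theorem Current.LocallyFiniteMass.lin_toRelOpen (E : Set X) (U : Opens X) {g : X → ℝ}
    (hg : T.IsWeight (incl (relOpen E U)) g) (p : HPoly k U) :
    T.lin (isometry_incl (relOpen E U)) g (HPoly.toRelOpen E U p) =
      T.lin (isometry_subtype_coe : Isometry (Subtype.val : U → X)) g p :=
  hT.lin_pull (Z := U) (j := Subtype.val) isometry_subtype_coe (isometry_incl (relOpen E U)) hg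
    (i := fun z => ⟨z.1.1, z.2⟩) (LipschitzWith.of_edist_le fun _ _ => le_rfl) (fun _ => rfl) p

/-- Dominated convergence over the terms of the representations, the dominating sequence being the
suprema over `n` of the products of norms. These control products only, so each term is first
normalized to have its whole size in the zeroth factor; the factors are then bounded individually
and the compactness argument applies. -/
theorem Current.LocallyFiniteMass.tendsto_lin_zero {Z : Type u} [MetricSpace Z] {j : Z → X}
    (hj : Isometry j) {g : X → ℝ} (hg : Integrable g T.mass) {V : Set Z} (hV : IsCompact V)
    (hgV : ∀ x, g x ≠ 0 → x ∈ j '' V) {p : ℕ → HPoly k Z} (hp : HPoly.SeqConv p 0) :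
    Tendsto (fun n => T.lin hj g (p n)) atTop (𝓝 0) := by
  have hw : T.IsWeight j g := ⟨hg, fun x hx => Set.image_subset_range _ _ (hgV x hx)⟩
  obtain ⟨p', q', hp', hq', hconv⟩ := hp
  obtain ⟨r, hr, hr1, hr2⟩ := hconv (fun _ => V) fun _ => hV
  have hrep : ∀ n, HPoly.Represents (r n) (p n) := fun n =>
    ⟨p' n - q', by rw [map_sub, hp', hq', sub_zero], hr n⟩
  have hsum : ∀ n, T.lin hj g (p n) = ∑' l, T.lin hj g (HPoly.tensor (r n l)) := fun n =>
    (((HPoly.represents_iff.1 (hrep n)).2.mapL (T.lin hj g)).tsum_eq).symm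
  simp_rw [hsum]
  have hbl : ∀ l, (⨆ n, ∏ i, ‖r n l i‖ₑ) ≠ ∞ := ENNReal.ne_top_of_tsum_ne_top hr1.ne
  let b : ℕ → ℝ := fun l => (⨆ n, ∏ i, ‖r n l i‖ₑ).toReal
  have hb : ∀ n l, ∏ i, ‖r n l i‖ ≤ b l := by
    intro n l
    rw [← ENNReal.ofReal_le_iff_le_toReal (hbl l),
      ENNReal.ofReal_prod_of_nonneg fun _ _ => norm_nonneg _]
    simp_rw [ofReal_norm]
    exact le_iSup (fun n => ∏ i, ‖r n l i‖ₑ) n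
  have h0 : Tendsto (fun n => ∑' l, T.lin hj g (HPoly.tensor (r n l))) atTop
      (𝓝 (∑' _ : ℕ, (0 : ℝ))) := by
    refine tendsto_tsum_of_dominated_convergence (bound := fun l => b l * ∫ x, |g x| ∂T.mass)
      ((ENNReal.summable_toReal hr1.ne).mul_right _) (fun l => ?_)
      (Eventually.of_forall fun n l => ?_)
    · choose w hw1 hw2 hw3 hw4 using fun n => HPoly.exists_tensor_eq (r n l)
      choose E hE1 hE2 using BLip.exists_comp_eq hj
      have e : ∀ n, T.lin hj g (HPoly.tensor (r n l)) =
          T.borelExt (fun x => g x * E (w n 0) x) (Fin.tail fun i => E (w n i)) := by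
        intro n
        rw [← hT.lin_tensor hj hw fun i => E (w n i), ← hw1]
        simp_rw [hE1]
      simp_rw [e]
      refine hT.tendsto_borelExt_zero hg (hV.image hj.continuous) hgV (C := max (b l) 1)
        (F := fun n i => E (w n i)) (le_max_of_le_right zero_le_one) (fun n i => ?_) ?_
      · refine (hE2 _).trans ?_
        induction i using Fin.cases with
        | zero => exact ((hw2 n).trans (hb n l)).trans (le_max_left _ _)
        | succ i => exact (hw3 n i).trans (le_max_right _ _)
      · refine tendsto_of_tendsto_of_tendsto_of_le_of_le tendsto_const_nhds hr2
          (fun _ => zero_le) fun n => ?_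
        have h1 : ∀ i, (⨆ x ∈ j '' V, ‖E (w n i) x‖ₑ) = ⨆ z ∈ V, ‖w n i z‖ₑ := by
          intro i
          rw [iSup_image]
          have : ∀ z, E (w n i) (j z) = w n i z := fun z =>
            congrArg (fun f : BLip Z => f z) (hE1 (w n i))
          simp_rw [this]
        simp_rw [h1]
        exact (hw4 n V).trans (ENNReal.le_tsum (f := fun l => ∏ i, ⨆ x ∈ V, ‖r n l i x‖ₑ) l)
    · refine (hT.abs_lin_tensor_le hj hw _).trans (mul_le_mul_of_nonneg_right (hb n l) ?_)
      exact integral_nonneg fun _ => abs_nonneg _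
  rwa [tsum_zero] at h0

/-- The functional `T̂`. -/
def Current.LocallyFiniteMass.eval : FormsC k X →ₗ[ℝ] ℝ :=
  (hT.evalOn MeasurableSet.univ).comp
    (Submodule.inclusion (hT.formsC_le_domain MeasurableSet.univ))

/-- The common compact set meets only finitely many members of the cover. It is written as a finite
union of compact sets, one inside each of these members, and the differences are evaluated with
weights carried by those sets, where termwise convergence is available. -/
theorem Current.LocallyFiniteMass.tendsto_eval {ω : ℕ → FormsC k X} {η : FormsC k X}
    (h : FormsC.SeqConv ω η) : Tendsto (fun n => hT.eval (ω n)) atTop (𝓝 (hT.eval η)) := by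
  classical
  obtain ⟨K, ι, U, p, hK, hUc, hp, hsupp, hconv⟩ := h
  have := hT.regular
  have hlf := (hp 0).1
  let J : Finset ι := (hlf.finite_nonempty_inter_compact hK).toFinset
  have hKJ : K ⊆ ⋃ i ∈ J, (U i : Set X) := by
    intro x hx
    obtain ⟨i, hi⟩ := (hp 0).2.1 x
    exact Set.mem_biUnion ((hlf.finite_nonempty_inter_compact hK).mem_toFinset.2 ⟨x, hi, hx⟩) hi
  obtain ⟨C, hC, hCU, hKC⟩ := hK.finite_compact_cover J _ (fun i _ => (U i).isOpen) hKJ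
  let N : X → ℝ := fun x => ∑ i ∈ J, (C i).indicator (fun _ => 1) x
  have hN : Measurable N := Finset.measurable_sum _ fun i _ =>
    measurable_const.indicator (hC i).isClosed.measurableSet
  -- Dividing by the number `N` of compact pieces through a point yields weights that sum to one on
  -- `K`. Off the pieces `N` is zero, and so is every weight.
  let g : ι → X → ℝ := fun i => (C i).indicator fun x => (N x)⁻¹
  have hgm : ∀ i, Measurable (g i) := fun i => hN.inv.indicator (hC i).isClosed.measurableSet
  have hN0 : ∀ x, 0 ≤ N x := fun x =>
    Finset.sum_nonneg fun i _ => Set.indicator_nonneg (fun _ _ => zero_le_one) x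
  have hg0 : ∀ i x, 0 ≤ g i x := fun i x =>
    Set.indicator_nonneg (fun _ _ => inv_nonneg.2 (hN0 _)) x
  have hgN : ∀ x, ∑ i ∈ J, g i x = N x * (N x)⁻¹ := by
    intro x
    simp only [N, Finset.sum_mul]
    refine Finset.sum_congr rfl fun i _ => ?_
    by_cases hx : x ∈ C i
    · simp [g, N, hx]
    · simp [g, hx]
  have hgs : ∀ (s : Finset J) x, ∑ i ∈ s, g i x ≤ 1 := by
    intro s x
    calc ∑ i ∈ s, g i x ≤ ∑ i : J, g i x :=
          Finset.sum_le_sum_of_subset_of_nonneg (Finset.subset_univ _) fun i _ _ => hg0 i x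
      _ = ∑ i ∈ J, g i x := Finset.sum_coe_sort J fun i => g i x
      _ ≤ 1 := by rw [hgN]; exact mul_inv_le_one
  let U' : ι → Opens (Set.univ : Set X) := fun i => relOpen Set.univ (U i)
  have hU'c : ∀ i, PrecompactIn (U' i) := by
    intro i
    refine (hUc i).of_isClosed_subset isClosed_closure (closure_mono ?_)
    rintro _ ⟨z, hz, rfl⟩
    exact hz
  have hgw : ∀ i : J, T.IsWeight (incl (U' i)) (g i) := fun i =>
    hT.isWeight_of_bounded (hU'c i) (hgm i) (C := 1) (fun x => by
      rw [abs_of_nonneg (hg0 i x)]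
      simpa using hgs {i} x) fun x hx =>
      mem_range_incl.2 ⟨trivial, hCU i (Set.mem_of_indicator_ne_zero hx)⟩
  have hr : ∀ n, T.LocRep (fun i : J => U' i) (fun i => HPoly.toRelOpen Set.univ (U i) (p n i))
      (fun i => g i) (Sect.restrict Set.univ (ω n - η : FormsC k X).1) := by
    intro n
    refine ⟨fun i => hU'c i, fun i z hz => ?_, hgw, fun i => hg0 i, hgs, fun z hz => ?_⟩
    · have hz' : (z : X) ∈ U i := hz
      rw [← Stalk.restrict_germ Set.univ z (U i) hz', ← (hp n).germ_eq i z hz']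
      rfl
    · have hzK : (z : X) ∈ K := hsupp n (subset_closure fun h => hz (by
        change Stalk.restrict Set.univ z ((ω n - η : FormsC k X).1 z) = 0
        rw [h, map_zero]))
      have h1 : ∑ i ∈ J, g i z = 1 := by
        rw [hgN]
        refine mul_inv_cancel₀ (ne_of_gt ?_)
        rw [hKC] at hzK
        obtain ⟨i, hi, hzi⟩ := Set.mem_iUnion₂.1 hzK
        refine Finset.sum_pos' (fun i _ => Set.indicator_nonneg (fun _ _ => zero_le_one) _)
          ⟨i, hi, ?_⟩
        rw [Set.indicator_of_mem hzi]
        exact zero_lt_one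
      rw [← h1, ← Finset.sum_coe_sort J fun i => g i z]
      exact hasSum_fintype _
  have hdom := hT.formsC_le_domain MeasurableSet.univ
  have hval : ∀ n, hT.eval (ω n - η) = ∑ i : J,
      T.lin (isometry_subtype_coe : Isometry (Subtype.val : U i → X)) (g i) (p n i) := by
    intro n
    have h1 := (hr n).hasSum_value hT MeasurableSet.univ
      (admissible_restrict MeasurableSet.univ (hdom (ω n - η).2).1 (hdom (ω n - η).2).2)
    refine (h1.unique (hasSum_fintype _)).trans (Finset.sum_congr rfl fun i _ => ?_)
    exact hT.lin_toRelOpen Set.univ (U i) (hgw i) (p n i)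
  have hlim : Tendsto (fun n => hT.eval (ω n - η)) atTop (𝓝 0) := by
    simp_rw [hval]
    rw [← Finset.sum_const_zero (ι := J) (s := Finset.univ)]
    refine tendsto_finsetSum _ fun i _ => ?_
    have hCi : IsCompact (Subtype.val ⁻¹' C i : Set (U i)) := by
      rw [Subtype.isCompact_iff, Set.image_preimage_eq_of_subset fun x hx => ⟨⟨x, hCU i hx⟩, rfl⟩]
      exact hC i
    refine hT.tendsto_lin_zero isometry_subtype_coe (hgw i).1 hCi (fun x hx => ?_) (hconv i)
    have hx' : x ∈ C i := Set.mem_of_indicator_ne_zero hx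
    exact ⟨⟨x, hCU i hx'⟩, hx', rfl⟩
  simp_rw [map_sub] at hlim
  simpa using hlim.add_const (hT.eval η)

theorem Current.LocallyFiniteMass.eval_toForm (f : LipC X) (π : Fin k → BLip X) :
    hT.eval (toForm f π) = T.toMap f π := by
  refine (hT.evalOn_toForm MeasurableSet.univ f π).trans ?_
  rw [Current.restrict, Set.indicator_univ]
  exact hT.borelExt_coe f π

end seqCont

/-! ### Multiplication of polylipschitz functions and germs by Lipschitz functions -/

section mul

variable {k : ℕ} {Y : Type u} [MetricSpace Y]

theorem homKer_le_mul (φ : BLip Y) (i : Fin (k + 1)) : homKer k Y i ≤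
    ((homKer k Y i).mkQL.comp (if i = 0 then φ.mul else ContinuousLinearMap.id ℝ (BLip Y))).ker := by
  intro f hf
  rw [LinearMap.mem_ker]
  refine (Submodule.Quotient.mk_eq_zero _).2 ?_
  induction i using Fin.cases with
  | zero =>
    rw [homKer_zero] at hf ⊢
    rw [(Submodule.mem_bot ℝ).1 hf, map_zero]
    exact Submodule.zero_mem _
  | succ i =>
    rw [if_neg (Fin.succ_ne_zero i)]
    exact hf

/-- Multiplication of the zeroth factor by a bounded Lipschitz function. -/
def HPoly.mulM (φ : BLip Y) : HPoly k Y →L[ℝ] HPoly k Y :=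
  (PiTensorProduct.mapL fun i => (homKer k Y i).liftQL ((homKer k Y i).mkQL.comp
    (if i = 0 then φ.mul else ContinuousLinearMap.id ℝ (BLip Y))) (homKer_le_mul φ i)).completion

theorem HPoly.mulM_tensor (φ : BLip Y) (f : Fin (k + 1) → BLip Y) :
    HPoly.mulM φ (HPoly.tensor f) = HPoly.tensor (Fin.cons (φ.mul (f 0)) (Fin.tail f)) := by
  have e : (Fin.cons (φ.mul (f 0)) (Fin.tail f) : Fin (k + 1) → BLip Y) = fun i =>
      (if i = 0 then φ.mul else ContinuousLinearMap.id ℝ (BLip Y)) (f i) := by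
    funext i
    induction i using Fin.cases with
    | zero => rfl
    | succ i => rw [if_neg (Fin.succ_ne_zero i)]; rfl
  rw [e]
  simp only [HPoly.mulM, HPoly.tensor, ContinuousLinearMap.completion_apply_coe,
    PiTensorProduct.mapL_apply, PiTensorProduct.map_tprod]
  rfl

theorem HPoly.tensor_cons_add (a b : BLip Y) (π : Fin k → BLip Y) :
    HPoly.tensor (Fin.cons (a + b) π) = HPoly.tensor (Fin.cons a π) + HPoly.tensor (Fin.cons b π) :=
  (HPoly.tensorM k Y).cons_add π a b

theorem HPoly.mulM_add (φ ψ : BLip Y) (p : HPoly k Y) :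
    HPoly.mulM (φ + ψ) p = HPoly.mulM φ p + HPoly.mulM ψ p := by
  have h : HPoly.mulM (k := k) (φ + ψ) = HPoly.mulM φ + HPoly.mulM ψ :=
    HPoly.clm_ext fun f => by
      rw [add_apply, HPoly.mulM_tensor, HPoly.mulM_tensor, HPoly.mulM_tensor,
        ← HPoly.tensor_cons_add]
      congr 2
      exact BLip.ext fun x => add_mul _ _ _
  rw [h, add_apply]

theorem HPoly.mulM_one (p : HPoly k Y) : HPoly.mulM (BLip.one Y) p = p := by
  have h : HPoly.mulM (k := k) (BLip.one Y) = ContinuousLinearMap.id ℝ _ :=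
    HPoly.clm_ext fun f => by
      rw [HPoly.mulM_tensor]
      have : (BLip.one Y).mul (f 0) = f 0 := BLip.ext fun x => one_mul _
      rw [this]
      exact congrArg HPoly.tensor (Fin.cons_self_tail f)
  rw [h]; rfl

theorem HPoly.pull_mulM {Z : Type u} [MetricSpace Z] (i : Y → Z) (hi : LipschitzWith 1 i)
    (φ : BLip Z) (p : HPoly k Z) :
    HPoly.pull i hi (HPoly.mulM φ p) = HPoly.mulM (BLip.comp i hi φ) (HPoly.pull i hi p) := by
  have h : (HPoly.pull (k := k) i hi).comp (HPoly.mulM φ) =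
      (HPoly.mulM (BLip.comp i hi φ)).comp (HPoly.pull i hi) :=
    HPoly.clm_ext fun f => by
      rw [ContinuousLinearMap.comp_apply, ContinuousLinearMap.comp_apply, HPoly.mulM_tensor,
        HPoly.pull_tensor, HPoly.pull_tensor, HPoly.mulM_tensor]
      congr 1
      funext l
      induction l using Fin.cases with
      | zero => rfl
      | succ l => rfl
  exact congrArg (fun A : HPoly k Z →L[ℝ] HPoly k Y => A p) h

/-- The restriction of a bounded Lipschitz function to an open set. -/
def BLip.resO (U : Opens Y) : BLip Y →L[ℝ] BLip U :=
  BLip.comp Subtype.val (LipschitzWith.of_edist_le fun _ _ => le_rfl)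

theorem HPoly.res_mulM {U V : Opens Y} (h : U ≤ V) (φ : BLip Y) (p : HPoly k V) :
    HPoly.res h (HPoly.mulM (BLip.resO V φ) p) = HPoly.mulM (BLip.resO U φ) (HPoly.res h p) :=
  HPoly.pull_mulM _ _ _ p

open Classical in
/-- Multiplication of germs by a bounded Lipschitz function. -/
def Stalk.mul (φ : BLip Y) (y : Y) : Stalk k y →ₗ[ℝ] Stalk k y :=
  Module.DirectLimit.lift ℝ (StalkIndex y) (fun i : StalkIndex y => HPoly k i.set)
    (stalkMap k y)
    (fun i => (germ i.set (OrderDual.ofDual i).mem).comp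
      (HPoly.mulM (BLip.resO i.set φ)).toLinearMap)
    (fun i j h p => by
      refine (congrArg (germ j.set (OrderDual.ofDual j).mem)
        (HPoly.res_mulM (StalkIndex.set_anti h) φ p).symm).trans ?_
      exact germ_res (StalkIndex.set_anti h) (OrderDual.ofDual j).mem _)

theorem Stalk.mul_germ (φ : BLip Y) (U : Opens Y) {y : Y} (hy : y ∈ U) (p : HPoly k U) :
    Stalk.mul φ y (germ U hy p) = germ U hy (HPoly.mulM (BLip.resO U φ) p) := by
  classical
  exact Module.DirectLimit.lift_of _ _ _

theorem Stalk.mul_add (φ ψ : BLip Y) {y : Y} (g : Stalk k y) :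
    Stalk.mul (φ + ψ) y g = Stalk.mul φ y g + Stalk.mul ψ y g := by
  obtain ⟨U, hU, p, rfl⟩ := exists_germ g
  rw [Stalk.mul_germ, Stalk.mul_germ, Stalk.mul_germ, map_add, HPoly.mulM_add, map_add]

theorem Stalk.mul_congr {φ ψ : BLip Y} {y : Y} (h : ∀ᶠ x in 𝓝 y, φ x = ψ x) (g : Stalk k y) :
    Stalk.mul φ y g = Stalk.mul ψ y g := by
  obtain ⟨U, hU, p, rfl⟩ := exists_germ g
  obtain ⟨W, hW, hWo, hyW⟩ := eventually_nhds_iff.1 h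
  let V : Opens Y := U ⊓ ⟨W, hWo⟩
  have hyV : y ∈ V := ⟨hU, hyW⟩
  have hVU : V ≤ U := inf_le_left
  have e : BLip.resO V φ = BLip.resO V ψ := BLip.ext fun z => hW z.1 z.2.2
  rw [← germ_res hVU hyV, Stalk.mul_germ, Stalk.mul_germ, e]

theorem Stalk.mul_zero {y : Y} (g : Stalk k y) : Stalk.mul 0 y g = 0 := by
  have h := Stalk.mul_add 0 0 g
  rwa [add_zero, left_eq_add] at h

theorem Stalk.mul_one {y : Y} (g : Stalk k y) : Stalk.mul (BLip.one Y) y g = g := by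
  obtain ⟨U, hU, p, rfl⟩ := exists_germ g
  rw [Stalk.mul_germ]
  exact congrArg _ (HPoly.mulM_one p)

theorem Stalk.mul_sum {ι : Type*} (s : Finset ι) (φ : ι → BLip Y) {y : Y} (g : Stalk k y) :
    Stalk.mul (∑ i ∈ s, φ i) y g = ∑ i ∈ s, Stalk.mul (φ i) y g := by
  classical
  induction s using Finset.induction_on with
  | empty => simpa using Stalk.mul_zero g
  | insert a s ha ih => rw [Finset.sum_insert ha, Finset.sum_insert ha, Stalk.mul_add, ih]

theorem Stalk.mul_eq_zero {φ : BLip Y} {y : Y} (h : y ∉ tsupport (φ : Y → ℝ)) (g : Stalk k y) :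
    Stalk.mul φ y g = 0 := by
  rw [← Stalk.mul_zero g]
  refine Stalk.mul_congr ?_ g
  filter_upwards [(isClosed_tsupport (φ : Y → ℝ)).isOpen_compl.mem_nhds h] with x hx
  exact image_eq_zero_of_notMem_tsupport hx

theorem HPoly.toSect_mulM (φ : BLip Y) (p : HPoly k Y) (y : Y) :
    (HPoly.mulM φ p).toSect y = Stalk.mul φ y (p.toSect y) := by
  have hy : y ∈ (⊤ : Opens Y) := trivial
  rw [HPoly.germ_toSect _ ⊤ hy, HPoly.germ_toSect _ ⊤ hy, Stalk.mul_germ, HPoly.pull_mulM]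
  rfl

/-- The linear map `p ↦ p.toSect`. -/
def HPoly.toSectL (k : ℕ) (Y : Type u) [MetricSpace Y] : HPoly k Y →ₗ[ℝ] Sect k Y :=
  LinearMap.pi fun y => (germ ⊤ (y := y) trivial).comp
    (HPoly.pull Subtype.val (LipschitzWith.of_edist_le fun _ _ => le_rfl)).toLinearMap

theorem HPoly.toSect_mulM_mem (φ : LipC Y) (p : HPoly k Y) :
    (HPoly.mulM φ.1 p).toSect ∈ FormsC k Y := by
  refine ⟨HPoly.toSect_mem _, ?_⟩
  have hf : IsCompact (tsupport (φ.1 : Y → ℝ)) := φ.2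
  refine hf.of_isClosed_subset isClosed_closure
    (closure_minimal (fun y hy => ?_) (isClosed_tsupport _))
  by_contra hn
  exact hy ((HPoly.toSect_mulM φ.1 p y).trans (Stalk.mul_eq_zero hn _))

/-- The compactly supported form defined by `φ p`. -/
def HPoly.mulForm (φ : LipC Y) : HPoly k Y →ₗ[ℝ] FormsC k Y :=
  LinearMap.codRestrict (FormsC k Y)
    ((HPoly.toSectL k Y).comp (HPoly.mulM φ.1).toLinearMap) (HPoly.toSect_mulM_mem φ)

theorem HPoly.mulForm_coe (φ : LipC Y) (p : HPoly k Y) :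
    (HPoly.mulForm φ p).1 = (HPoly.mulM φ.1 p).toSect := rfl

theorem HPoly.mulForm_tensor (φ : LipC Y) (f : Fin (k + 1) → BLip Y) :
    HPoly.mulForm φ (HPoly.tensor f) = toForm (LipC.mul φ (f 0)) (Fin.tail f) := by
  refine Subtype.ext ?_
  rw [HPoly.mulForm_coe, HPoly.mulM_tensor]
  have : φ.1.mul (f 0) = (LipC.mul φ (f 0)).1 := BLip.ext fun x => mul_comm _ _
  rw [this]
  rfl

/-- The factors of a representation are extended one by one without increasing their norms, so the
extended series still converges. -/
theorem HPoly.exists_pull_eq {Z : Type u} [MetricSpace Z] {j : Z → Y} (hj : Isometry j)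
    (p : HPoly k Z) : ∃ q : HPoly k Y, HPoly.pull j hj.lipschitz q = p := by
  obtain ⟨r, hr⟩ := HPoly.exists_represents p
  obtain ⟨h1, h2⟩ := HPoly.represents_iff.1 hr
  choose E hE1 hE2 using BLip.exists_comp_eq hj
  have hs : Summable fun n => HPoly.tensor fun i => E (r n i) := by
    refine Summable.of_norm_bounded h1 fun n => (HPoly.norm_tensor_le _).trans ?_
    exact Finset.prod_le_prod (fun _ _ => norm_nonneg _) fun i _ => hE2 _
  refine ⟨∑' n, HPoly.tensor fun i => E (r n i), ?_⟩
  refine (hs.hasSum.mapL (HPoly.pull j hj.lipschitz)).unique ?_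
  simp_rw [HPoly.pull_tensor, hE1]
  exact h2

end mul

/-! ### Uniqueness of the extension -/

section uniqueness

variable {k : ℕ} {X : Type u} [MetricSpace X]

/-- A Lipschitz partition of unity which is subordinate to a precompact locally finite cover
writes every compactly supported form as a finite sum of global forms. -/
theorem FormsC.exists_eq_sum_mulForm [LocallyCompactSpace X] (ω : FormsC k X) :
    ∃ (J : Type u) (s : Finset J) (φ : J → LipC X) (q : J → HPoly k X),
      ω = ∑ i ∈ s, HPoly.mulForm (φ i) (q i) := by
  have hK : IsCompact (Sect.support ω.1) := ω.2.2
  -- A compact neighbourhood of the support is used, because multiplication of a germ by the partial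
  -- sum is trivial only if that sum equals one near the point, not just at it.
  obtain ⟨K, hKc, hKK⟩ := exists_compact_superset hK
  obtain ⟨ι, U, p, φ, hU, hp, hφ⟩ := Sect.IsCont.exists_overlapCompatible (σ := ω.1) ω.2.1
    (P := fun U => IsCompact (closure (U : Set X)))
    (fun U V h hV => hV.of_isClosed_subset isClosed_closure (closure_mono h)) fun x => by
      obtain ⟨L, hL, hx⟩ := exists_compact_mem_nhds x
      exact ⟨⟨interior L, isOpen_interior⟩, mem_interior_iff_mem_nhds.2 hx,
        hL.of_isClosed_subset isClosed_closure (closure_minimal interior_subset hL.isClosed)⟩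
  have hφc : ∀ i, HasCompactSupport (φ i : X → ℝ) := fun i =>
    (hU i).of_isClosed_subset (isClosed_tsupport _) ((hφ.2.1 i).trans subset_closure)
  -- Each local function is extended to all of `X`; the choice is immaterial since `φ i` is
  -- supported where the extension agrees with it.
  choose q hq using fun i => HPoly.exists_pull_eq
    (isometry_subtype_coe : Isometry (Subtype.val : U i → X)) (p i)
  have hfin := hp.1.finite_nonempty_inter_compact hKc
  refine ⟨ι, hfin.toFinset, fun i => ⟨φ i, hφc i⟩, q, Subtype.ext (funext fun z => ?_)⟩
  have h1 : ∀ i, (HPoly.mulForm (⟨φ i, hφc i⟩ : LipC X) (q i)).1 z =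
      Stalk.mul (φ i) z (ω.1 z) := by
    intro i
    rw [HPoly.mulForm_coe, HPoly.toSect_mulM]
    by_cases hz : z ∈ U i
    · rw [hp.germ_eq i z hz, ← hq i, HPoly.germ_toSect _ (U i) hz]
      rfl
    · have hz' : z ∉ tsupport (φ i : X → ℝ) := fun h => hz (hφ.2.1 i h)
      rw [Stalk.mul_eq_zero hz', Stalk.mul_eq_zero hz']
  rw [Submodule.coe_sum, Finset.sum_apply, Finset.sum_congr rfl fun i _ => h1 i, ← Stalk.mul_sum]
  by_cases h0 : ω.1 z = 0
  · rw [h0, map_zero]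
  · have hz : z ∈ interior K := hKK (subset_closure h0)
    rw [Stalk.mul_congr (ψ := BLip.one X), Stalk.mul_one]
    filter_upwards [isOpen_interior.mem_nhds hz] with x hx
    have h2 := (hφ.hasSum hp.1 x).tsum_eq
    rw [tsum_eq_sum (s := hfin.toFinset) fun i hi => ?_] at h2
    · rw [BLip.one_apply, ← h2]
      exact map_sum (⟨⟨fun f : BLip X => f x, rfl⟩, fun _ _ => rfl⟩ : BLip X →+ ℝ) φ _
    · by_contra h
      exact hi (hfin.mem_toFinset.2 ⟨x, hφ.2.1 i (subset_tsupport _ h), interior_subset hx⟩)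

theorem HPoly.Represents.mulM (φ : BLip X) {r : ℕ → Fin (k + 1) → BLip X} {q : HPoly k X}
    (hr : HPoly.Represents r q) : HPoly.Represents
      (fun j => Fin.cons (φ.mul (r j 0)) (Fin.tail (r j))) (HPoly.mulM φ q) := by
  obtain ⟨h1, h2⟩ := HPoly.represents_iff.1 hr
  refine HPoly.represents_iff.2 ⟨?_, ?_⟩
  · refine (h1.mul_left (2 * ‖φ‖)).of_nonneg_of_le
      (fun j => Finset.prod_nonneg fun _ _ => norm_nonneg _) fun j => ?_
    rw [Fin.prod_univ_succ, Fin.prod_univ_succ, ← mul_assoc]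
    exact mul_le_mul_of_nonneg_right (BLip.norm_mul_le φ (r j 0))
      (Finset.prod_nonneg fun _ _ => norm_nonneg _)
  · simp_rw [← HPoly.mulM_tensor]
    exact h2.mapL (HPoly.mulM φ)

theorem HPoly.Represents.pull {Z : Type v} [MetricSpace Z] (g : Z → X) (hg : LipschitzWith 1 g)
    {r : ℕ → Fin (k + 1) → BLip X} {q : HPoly k X} (hr : HPoly.Represents r q) :
    HPoly.Represents (fun j i => BLip.comp g hg (r j i)) (HPoly.pull g hg q) := by
  obtain ⟨h1, h2⟩ := HPoly.represents_iff.1 hr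
  refine HPoly.represents_iff.2 ⟨?_, ?_⟩
  · refine h1.of_nonneg_of_le (fun j => Finset.prod_nonneg fun _ _ => norm_nonneg _) fun j =>
      Finset.prod_le_prod (fun _ _ => norm_nonneg _) fun i _ => ?_
    exact BLip.norm_le (norm_nonneg _) (BLip.abs_comp_sub_le hg _) fun x => BLip.abs_le_norm (r j i) _
  · simp_rw [← HPoly.pull_tensor]
    exact h2.mapL (HPoly.pull g hg)

/-- The remainders of a representation converge to zero. -/
theorem HPoly.Represents.seqConv {r : ℕ → Fin (k + 1) → BLip X} {q : HPoly k X}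
    (hr : HPoly.Represents r q) :
    HPoly.SeqConv (fun n => q - ∑ l ∈ Finset.range n, HPoly.tensor (r l)) 0 := by
  obtain ⟨q', hq, h1, h2⟩ := hr
  have hfin : ∑' j, ∏ i, ‖r j i‖ₑ ≠ ∞ := by
    have h : ∀ j, ∏ i, ‖r j i‖ₑ = ENNReal.ofReal (∏ i, ‖r j i‖) := fun j => by
      rw [ENNReal.ofReal_prod_of_nonneg fun _ _ => norm_nonneg _]
      simp_rw [ofReal_norm]
    simp_rw [h]
    exact h1.tsum_ofReal_ne_top
  have hzero : Poly.tensor (0 : Fin (k + 1) → BLip X) = 0 := by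
    unfold Poly.tensor
    rw [(PiTensorProduct.tprod ℝ).map_coord_zero (m := (0 : Fin (k + 1) → BLip X)) 0 rfl,
      UniformSpace.Completion.coe_zero]
  -- The remainder is represented by deleting the first `n` tuples. Its terms are dominated by those
  -- of `r`, and its sup-norm sum by the tail of a convergent series.
  let t : ℕ → ℕ → Fin (k + 1) → BLip X := fun n j => if j < n then 0 else r j
  have ht0 : ∀ {n j}, j < n → t n j = 0 := fun h => if_pos h
  have ht1 : ∀ {n j}, ¬ j < n → t n j = r j := fun h => if_neg h
  refine ⟨fun n => q' - ∑ l ∈ Finset.range n, Poly.tensor (r l), 0, fun n => ?_, map_zero _,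
    fun V hV => ⟨t, fun n => ⟨?_, ?_⟩, ?_, ?_⟩⟩
  · simp only [map_sub, map_sum, Poly.toHom_tensor, hq]
  · refine h1.of_nonneg_of_le (fun j => Finset.prod_nonneg fun _ _ => norm_nonneg _) fun j => ?_
    by_cases h : j < n
    · rw [ht0 h, Finset.prod_eq_zero (Finset.mem_univ 0) (by rw [Pi.zero_apply, norm_zero])]
      exact Finset.prod_nonneg fun _ _ => norm_nonneg _
    · rw [ht1 h]
  · have h3 : HasSum (fun j => if j < n then Poly.tensor (r j) else 0)
        (∑ l ∈ Finset.range n, if l < n then Poly.tensor (r l) else 0) :=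
      hasSum_sum_of_ne_finset_zero fun j hj => if_neg fun h => hj (Finset.mem_range.2 h)
    rw [Finset.sum_congr rfl fun l hl => if_pos (Finset.mem_range.1 hl)] at h3
    rw [sub_zero]
    refine (h2.sub h3).congr_fun fun j => ?_
    by_cases h : j < n
    · rw [ht0 h, if_pos h, hzero, sub_self]
    · rw [ht1 h, if_neg h, sub_zero]
  · refine lt_of_le_of_lt (ENNReal.tsum_le_tsum fun j => iSup_le fun n => ?_) hfin.lt_top
    by_cases h : j < n
    · rw [ht0 h, Finset.prod_eq_zero (Finset.mem_univ 0) (by rw [Pi.zero_apply, enorm_zero])]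
      exact bot_le
    · rw [ht1 h]
  · refine tendsto_of_tendsto_of_tendsto_of_le_of_le tendsto_const_nhds
      (ENNReal.tendsto_sum_nat_add (fun j => ∏ i, ‖r j i‖ₑ) hfin) (fun _ => bot_le) fun n => ?_
    have h : ∀ j ∈ Finset.range n, ∏ i, ⨆ x ∈ V i, ‖t n j i x‖ₑ = 0 := fun j hj =>
      Finset.prod_eq_zero (Finset.mem_univ 0) (by simp [ht0 (Finset.mem_range.1 hj)])
    change ∑' j, ∏ i, ⨆ x ∈ V i, ‖t n j i x‖ₑ ≤ _
    rw [← ENNReal.summable.sum_add_tsum_nat_add' (f := fun j => ∏ i, ⨆ x ∈ V i, ‖t n j i x‖ₑ)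
      (k := n), Finset.sum_eq_zero h, zero_add]
    refine ENNReal.tsum_le_tsum fun j => Finset.prod_le_prod' fun i _ => iSup₂_le fun x _ => ?_
    rw [ht1 (by omega)]
    exact enorm_le_iff_norm_le.2 (BLip.abs_le_norm _ _)

theorem FormsC.seqConv_mulForm [LocallyCompactSpace X] (φ : LipC X) {r : ℕ → Fin (k + 1) → BLip X}
    {q : HPoly k X} (hr : HPoly.Represents r q) :
    FormsC.SeqConv (fun n => HPoly.mulForm φ (q - ∑ l ∈ Finset.range n, HPoly.tensor (r l))) 0 := by
  -- The zero section serves only to supply a locally finite precompact cover; the functions on it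
  -- are restrictions of one global function.
  obtain ⟨ι, U, p, _, hU, hp, _⟩ := Sect.IsCont.exists_overlapCompatible
    (σ := (0 : Sect k X)) (zero_mem (Forms k X))
    (P := fun U => IsCompact (closure (U : Set X)))
    (fun U V h hV => hV.of_isClosed_subset isClosed_closure (closure_mono h)) fun x => by
      obtain ⟨L, hL, hx⟩ := exists_compact_mem_nhds x
      exact ⟨⟨interior L, isOpen_interior⟩, mem_interior_iff_mem_nhds.2 hx,
        hL.of_isClosed_subset isClosed_closure (closure_minimal interior_subset hL.isClosed)⟩
  refine ⟨tsupport (φ.1 : X → ℝ), ι, U, fun n i => HPoly.pull Subtype.val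
    (LipschitzWith.of_edist_le fun _ _ => le_rfl)
    (HPoly.mulM φ.1 (q - ∑ l ∈ Finset.range n, HPoly.tensor (r l))), φ.2, hU, fun n =>
    ⟨hp.1, hp.2.1, fun y => ?_, fun i j => ?_⟩, fun n => ?_, fun i => ?_⟩
  · obtain ⟨i, hi⟩ := hp.2.1 y
    refine ⟨i, hi, ?_⟩
    rw [sub_zero]
    exact HPoly.germ_toSect _ (U i) hi
  · unfold HPoly.res
    rw [HPoly.pull_pull (hgh := LipschitzWith.of_edist_le fun _ _ => le_rfl),
      HPoly.pull_pull (hgh := LipschitzWith.of_edist_le fun _ _ => le_rfl)]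
  · rw [sub_zero]
    refine closure_minimal (fun y hy => ?_) (isClosed_tsupport _)
    by_contra hn
    exact hy ((HPoly.toSect_mulM φ.1 _ y).trans (Stalk.mul_eq_zero hn _))
  · have h := ((hr.mulM φ.1).pull (Subtype.val : U i → X)
      (LipschitzWith.of_edist_le fun _ _ => le_rfl)).seqConv
    simpa only [map_sub, map_sum, HPoly.mulM_tensor, HPoly.pull_tensor] using h

/-- Both functionals agree with `T` on the simple tensors of the partial sums, so their difference
on a remainder does not depend on `n`, while sequential continuity forces it to zero. Forms $\varphi
q$ span everything by a partition of unity. -/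
theorem Current.IsExtension.eq [LocallyCompactSpace X] {T : Current k X}
    {A B : FormsC k X →ₗ[ℝ] ℝ} (hA : T.IsExtension A) (hB : T.IsExtension B) : A = B := by
  have key : ∀ (φ : LipC X) (q : HPoly k X),
      A (HPoly.mulForm φ q) = B (HPoly.mulForm φ q) := by
    intro φ q
    obtain ⟨r, hr⟩ := HPoly.exists_represents q
    have hc := FormsC.seqConv_mulForm φ hr
    have h1 := (hA.1 _ _ hc).sub (hB.1 _ _ hc)
    have h2 : ∀ n, A (HPoly.mulForm φ (q - ∑ l ∈ Finset.range n, HPoly.tensor (r l))) -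
        B (HPoly.mulForm φ (q - ∑ l ∈ Finset.range n, HPoly.tensor (r l))) =
        A (HPoly.mulForm φ q) - B (HPoly.mulForm φ q) := by
      intro n
      simp only [map_sub, map_sum, HPoly.mulForm_tensor, hA.2, hB.2]
      ring
    simp_rw [h2, map_zero, sub_zero] at h1
    exact sub_eq_zero.1 (tendsto_nhds_unique tendsto_const_nhds h1)
  refine LinearMap.ext fun ω => ?_
  obtain ⟨J, s, φ, q, rfl⟩ := FormsC.exists_eq_sum_mulForm ω
  simp only [map_sum, key]

end uniqueness

end Polylip

end

theorem theorem1p2 {X : Type*} [MetricSpace X] [LocallyCompactSpace X] [MeasurableSpace X]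
    [BorelSpace X] (k : ℕ) (T : Current k X) (hT : T.LocallyFiniteMass) :
    -- the mass measure exists
    IsLeast {μ : Measure X | μ.Regular ∧ T.MassBound μ} T.mass ∧
    ∃ That : FormsC k X →ₗ[ℝ] ℝ,
      -- `That` is the unique sequentially continuous linear extension of `T`
      T.IsExtension That ∧ (∀ A : FormsC k X →ₗ[ℝ] ℝ, T.IsExtension A → A = That) ∧
      -- the mass bound for all compactly supported polylipschitz forms
      (∀ ω : FormsC k X, ∫⁻ x, (ω.1 x).pnorm ∂T.mass < ∞ ∧
        ENNReal.ofReal |That ω| ≤ ∫⁻ x, (ω.1 x).pnorm ∂T.mass) ∧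
      -- the functionals for Borel sets
      ∀ E : Set X, MeasurableSet E →
        (∀ (U : Opens E) (φ : BLip E), PrecompactIn U → tsupport (φ : E → ℝ) ⊆ U →
          ∃! A : HPoly k U →L[ℝ] ℝ, T.IsLinearization E U φ A) ∧
        ∃ D : Submodule ℝ (Sect k X),
          (∀ ω, ω ∈ D ↔ ω ∈ SectEC k E ∧ ∫⁻ x in E, Sect.pnormOn E ω x ∂T.mass < ∞) ∧
          (IsClosed E → D = SectEC k E) ∧
          ∃ (hD : FormsC k X ≤ D) (TE : D →ₗ[ℝ] ℝ),
            -- `TE` is well defined by the sum over an overlap-compatible family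
            (∀ ω : D, ∃ (ι : Type _) (U : ι → Opens E) (p : ∀ i, HPoly k (U i)) (φ : ι → BLip E),
              (∀ i, PrecompactIn (U i)) ∧ OverlapCompatible U p (Sect.restrict E ω.1) ∧
              LipPartition U φ) ∧
            (∀ (ω : D) (ι : Type _) (U : ι → Opens E) (p : ∀ i, HPoly k (U i)) (φ : ι → BLip E),
              (∀ i, PrecompactIn (U i)) → OverlapCompatible U p (Sect.restrict E ω.1) →
              LipPartition U φ →
              HasSum (fun i => T.linearization E (U i) (φ i) (p i)) (TE ω)) ∧
            -- `TE` factors `T⌊E`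
            (∀ (f : LipC X) (π : Fin k → BLip X),
              TE ⟨(toForm f π).1, hD (toForm f π).2⟩ = T.restrict E f π) ∧
            -- the mass bound for `TE`
            (∀ ω : D, ENNReal.ofReal |TE ω| ≤ ∫⁻ x in E, Sect.pnormOn E ω.1 x ∂T.mass) ∧
            -- for `E = X` one recovers `That`
            (E = Set.univ → ∀ ω : FormsC k X, TE ⟨ω.1, hD ω.2⟩ = That ω) := by
  refine ⟨isLeast_mass hT, hT.eval, ⟨fun ω η h => hT.tendsto_eval h, hT.eval_toForm⟩,
    fun A hA => hA.eq ⟨fun ω η h => hT.tendsto_eval h, hT.eval_toForm⟩, fun ω => ⟨?_, ?_⟩,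
    fun E hE => ⟨fun U φ hU hφ => hT.existsUnique_linearization hE hU hφ, T.domain hE,
      fun ω => Iff.rfl, hT.domain_eq hE, hT.formsC_le_domain hE, hT.evalOn hE, fun ω => ?_,
      fun ω ι U p φ hU hp hφ => hT.hasSum_linearization hE
        (admissible_restrict hE ω.2.1 ω.2.2) hU hp hφ,
      hT.evalOn_toForm hE, hT.abs_evalOn_le hE, fun hEu ω => ?_⟩⟩
  · have := hT.regular
    exact FormsC.lintegral_pnorm_lt_top ω
  -- The bound is proved for the restriction of the form to the whole space, whose pointwise norm is
  -- at most that of the form.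
  · refine (hT.abs_evalOn_le MeasurableSet.univ
      ⟨ω.1, hT.formsC_le_domain MeasurableSet.univ ω.2⟩).trans ?_
    rw [Measure.restrict_univ]
    exact lintegral_mono (Sect.pnormOn_le _ _)
  · exact Sect.IsCont.exists_overlapCompatible (σ := Sect.restrict E ω.1) ω.2.1.1
      (P := PrecompactIn) (fun _ _ h hV => hV.mono h) exists_precompactIn
  -- The global functional is by construction the one for the whole space.
  · subst hEu
    rfl
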